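/- Let $N$ be a compact connected Riemannian symmetric space: a compact connected Riemannian manifold such that for every $p\in N$ there is an isometry $s_p$ of $N$ with $s_p^2=\mathrm{id}$ having $p$ as an isolated fixed point. Let $\mathfrak g$ be the Lie algebra of the identity component of the isometry group of $N$, assumed semi-simple, with Killing form $\mathbf B$ and the positive definite inner product $\langle X,Y\rangle_{\mathfrak g}=-\mathbf B(X,Y)$. For $X\in\mathfrak g$ let $X^\dagger(q)=\frac{d}{dt}\exp(tX)q\big|_{t=0}$ be the corresponding Killing field, and let $\mathfrak n_p\subset\mathfrak g$ be the $(-1)$-eigenspace of the involution of $\mathfrak g$ induced by $s_p$. Assume that $N$ carries its canonical metric, i.e. for every $p$ the canonical isomorphism $\mathfrak n_p\to T_pN$, $X\mapsto X^\dagger(p)$, is an isometry for $\langle\,,\rangle_{\mathfrak g}|_{\mathfrak n_p}$. Give $\wedge^2\mathfrak g$ the inner product $\langle X\wedge Y,Z\wedge W\rangle=\langle X,Z\rangle_{\mathfrak g}\langle Y,W\rangle_{\mathfrak g}-\langle X,W\rangle_{\mathfrak g}\langle Y,Z\rangle_{\mathfrak g}$, and let $\Pi$ be the linear map with $\Pi(X\wedge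 Y)=X^\dagger\wedge Y^\dagger$. Let $M^n$ be a Riemannian manifold and $F:M\to N$ a totally geodesic isometric immersion (possibly $M=N$, $F=\mathrm{id}$). Let $\Sigma^{n-1}$ be a closed Riemannian manifold and $f:\Sigma\to M$ a minimal isometric immersion with trivial normal bundle, and fix a smooth unit normal field $\nu$ along $f$. For functions $\varphi,\psi\in C^\infty(\Sigma)$ put $$Q(\varphi,\psi)=-\int_\Sigma \mathcal J(\varphi)\,\psi\,d\mu_\Sigma,\qquad \mathcal J(\varphi)=\Delta\varphi+\mathrm{Ric}^M(\nu,\nu)\varphi+|A|^2\varphi,$$ where $\Delta=\mathrm{div}\,\mathrm{grad}$ on $\Sigma$, $A$ is the second fundamental form of $f$ and $\mu_\Sigma$ is the Riemannian measure. For a tangent vector field $T$ on $\Sigma$ and $v,w\in\wedge^2\mathfrak g$ put $\varphi_{T,v}=\langle\nu\wedge T,\Pi(v)\rangle$, where vectors tangent to $\Sigma$ and $M$ are regarded as tangent to $N$ through $f$ and $F$, and $q_T(v,w)=Q(\varphi_{T,v},\varphi_{T,w})$. Then for every harmonic $1$-form $\omega$ on $\Sigma$ (a smooth $1$-form with $(d\delta+\delta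 d)\omega=0$), with metric dual $\omega^\sharp$, one has $$\mathrm{Tr}_{\wedge^2\mathfrak g}\,q_{\omega^\sharp}=\sum_i q_{\omega^\sharp}(v_i,v_i)=0$$ for every orthonormal basis $(v_i)$ of $\wedge^2\mathfrak g$. -/

import Mathlib

open scoped Manifold ContDiff Topology Bundle ENNReal
open Bundle MeasureTheory

noncomputable section

namespace TraceFormula

/-- The model space `ℝⁿ` with its standard basis `stdVec i`. -/
abbrev E (n : ℕ) : Type := EuclideanSpace ℝ (Fin n)

/-- The `i`-th standard basis vector of `ℝⁿ`. -/
def stdVec {n : ℕ} (i : Fin n) : E n := EuclideanSpace.single i 1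

/-! ### Riemannian geometry of a metric `G` on (an open subset of) `ℝⁿ`, in coordinates -/

section Coordinates

variable {n : ℕ}

/-- Gram matrix `(b(∂ᵢ, ∂ⱼ))` of a bilinear form. -/
def gram (b : E n →L[ℝ] E n →L[ℝ] ℝ) : Matrix (Fin n) (Fin n) ℝ :=
  Matrix.of fun i j => b (stdVec i) (stdVec j)

/-- The vector `α^♯ = ∑ b^{ij} αⱼ ∂ᵢ` dual to a covector `α` with respect to an inner product. -/
def sharp (b : E n →L[ℝ] E n →L[ℝ] ℝ) (α : E n → ℝ) : E n :=
  ∑ i, (∑ j, (gram b)⁻¹ i j * α (stdVec j)) • stdVec i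

/-- The trace `∑ b^{ij} c(∂ᵢ, ∂ⱼ)` of a bilinear form `c` with respect to an inner product `b`. -/
def metricTrace (b : E n →L[ℝ] E n →L[ℝ] ℝ) (c : E n → E n → ℝ) : ℝ :=
  ∑ i, ∑ j, (gram b)⁻¹ i j * c (stdVec i) (stdVec j)

/-- The squared norm `∑ b^{ik} b^{jl} c(∂ᵢ, ∂ⱼ) c(∂ₖ, ∂ₗ)` of a bilinear form `c` with respect to
an inner product `b`. -/
def metricNormSq (b : E n →L[ℝ] E n →L[ℝ] ℝ) (c : E n → E n → ℝ) : ℝ :=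
  metricTrace b fun u v => metricTrace b fun u' v' => c u u' * c v v'

variable (G : E n → E n →L[ℝ] E n →L[ℝ] ℝ)

/-- The Christoffel symbols of the Levi-Civita connection, `Γ(v, w) = ∇_v w` for constant
fields: `2⟨Γ(v, w), z⟩ = ∂_v⟨w, z⟩ + ∂_w⟨v, z⟩ - ∂_z⟨v, w⟩`. -/
def christoffel (y : E n) (v w : E n) : E n :=
  sharp (G y) fun z =>
    (1 / 2 : ℝ) * (fderiv ℝ G y v w z + fderiv ℝ G y w v z - fderiv ℝ G y z v w)

/-- The curvature tensor `R(u, v)w = ∇_u∇_v w - ∇_v∇_u w - ∇_{[u, v]} w`, written out for constant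
vector fields `u, v, w`. -/
def curvature (y : E n) (u v w : E n) : E n :=
  fderiv ℝ (fun y' => christoffel G y' v w) y u - fderiv ℝ (fun y' => christoffel G y' u w) y v
    + christoffel G y u (christoffel G y v w) - christoffel G y v (christoffel G y u w)

/-- The Ricci tensor `Ric(v, w) = Tr(u ↦ R(u, v)w)`. -/
def ricci (y : E n) (v w : E n) : ℝ :=
  ∑ i, curvature G y (stdVec i) v w i

/-- The covariant derivative `(∇_u η)(v)` of a `1`-form. -/
def covDerivOneForm (η : E n → E n →L[ℝ] ℝ) (y : E n) (u v : E n) : ℝ :=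
  fderiv ℝ η y u v - η y (christoffel G y u v)

/-- The covariant derivative `(∇_u β)(v, w)` of a `2`-form. -/
def covDerivTwoForm (β : E n → E n → E n → ℝ) (y : E n) (u v w : E n) : ℝ :=
  fderiv ℝ (fun y' => β y' v w) y u - β y (christoffel G y u v) w - β y v (christoffel G y u w)

/-- The exterior derivative `dη(u, v) = ∂_u(η(v)) - ∂_v(η(u))` of a `1`-form. -/
def extDerivOneForm (η : E n → E n →L[ℝ] ℝ) (y : E n) (u v : E n) : ℝ :=
  fderiv ℝ η y u v - fderiv ℝ η y v u

/-- The codifferential `δη = -∑ (∇_{eᵢ} η)(eᵢ)` of a `1`-form. -/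
def codiffOneForm (η : E n → E n →L[ℝ] ℝ) (y : E n) : ℝ :=
  -metricTrace (G y) (covDerivOneForm G η y)

/-- The codifferential `(δβ)(w) = -∑ (∇_{eᵢ} β)(eᵢ, w)` of a `2`-form. -/
def codiffTwoForm (β : E n → E n → E n → ℝ) (y : E n) (w : E n) : ℝ :=
  -metricTrace (G y) fun u v => covDerivTwoForm G β y u v w

/-- The Hodge Laplacian `Δ₁η = dδη + δdη` of a `1`-form. -/
def hodgeLaplacianOneForm (η : E n → E n →L[ℝ] ℝ) (y : E n) (w : E n) : ℝ :=
  fderiv ℝ (codiffOneForm G η) y w + codiffTwoForm G (extDerivOneForm η) y w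

/-- The Laplace-Beltrami operator `Δu = div grad u = Tr ∇du` on functions. -/
def laplacian (u : E n → ℝ) (y : E n) : ℝ :=
  metricTrace (G y) (covDerivOneForm G (fderiv ℝ u) y)

end Coordinates

/-! ### Riemannian manifolds -/

section Manifolds

/-- A smooth Riemannian metric on an `n`-dimensional manifold. -/
abbrev Metric (n : ℕ) (M : Type*) [TopologicalSpace M] [ChartedSpace (E n) M]
    [IsManifold (𝓡 n) ∞ M] : Type _ :=
  ContMDiffRiemannianMetric (𝓡 n) ∞ (E n) (fun x : M => TangentSpace (𝓡 n) x)

variable {n : ℕ} {M : Type*} [TopologicalSpace M] [ChartedSpace (E n) M]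

/-- The derivative at `y` of the inverse of the preferred chart at `p`. -/
def chartFrame (p : M) (y : E n) :
    E n →L[ℝ] TangentSpace (𝓡 n) ((extChartAt (𝓡 n) p).symm y) :=
  mfderiv 𝓘(ℝ, E n) (𝓡 n) (extChartAt (𝓡 n) p).symm y

/-- A `1`-form written in the preferred chart at `p`. -/
def chartOneForm (η : ∀ x : M, TangentSpace (𝓡 n) x →L[ℝ] ℝ) (p : M) (y : E n) : E n →L[ℝ] ℝ :=
  (η ((extChartAt (𝓡 n) p).symm y)).comp (chartFrame p y)

/-- The vector field on `M` which is constant, equal to `v`, in the preferred chart at `p`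
(meaningful on the domain of that chart). -/
def coordField (p : M) (v : E n) (q : M) : TangentSpace (𝓡 n) q :=
  chartFrame p (extChartAt (𝓡 n) p q) v

variable [IsManifold (𝓡 n) ∞ M] (g : Metric n M)

/-- The metric `g` written in the preferred chart at `p`. -/
def chartMetric (p : M) (y : E n) : E n →L[ℝ] E n →L[ℝ] ℝ :=
  ContinuousLinearMap.bilinearComp (E := E n) (F := E n)
    (g.inner ((extChartAt (𝓡 n) p).symm y)) (chartFrame p y) (chartFrame p y)

/-- The Ricci tensor of `g` at `p`. -/
def ricciTensor (p : M) (v w : TangentSpace (𝓡 n) p) : ℝ :=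
  ricci (chartMetric g p) (extChartAt (𝓡 n) p p) v w

/-- The Laplace-Beltrami operator of `g`. -/
def laplaceBeltrami (u : M → ℝ) (p : M) : ℝ :=
  laplacian (chartMetric g p) (fun y => u ((extChartAt (𝓡 n) p).symm y)) (extChartAt (𝓡 n) p p)

/-- The Hodge Laplacian of `g` on `1`-forms. -/
def hodgeLaplacian (η : ∀ x : M, TangentSpace (𝓡 n) x →L[ℝ] ℝ) (p : M)
    (w : TangentSpace (𝓡 n) p) : ℝ :=
  hodgeLaplacianOneForm (chartMetric g p) (chartOneForm η p) (extChartAt (𝓡 n) p p) w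

/-- A harmonic `1`-form: a smooth `1`-form `η` with `Δ₁η = 0`. -/
def IsHarmonicOneForm (η : ∀ x : M, TangentSpace (𝓡 n) x →L[ℝ] ℝ) : Prop :=
  ContMDiff (𝓡 n) ((𝓡 n).prod 𝓘(ℝ, E n →L[ℝ] ℝ)) ∞
      (fun x => TotalSpace.mk' (E n →L[ℝ] ℝ) (E := fun x : M => TangentSpace (𝓡 n) x →L[ℝ] ℝ)
        x (η x)) ∧
    ∀ (p : M) (w : TangentSpace (𝓡 n) p), hodgeLaplacian g η p w = 0

/-- The metric dual `η^♯` of a `1`-form. -/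
def oneFormSharp (η : ∀ x : M, TangentSpace (𝓡 n) x →L[ℝ] ℝ) (p : M) : TangentSpace (𝓡 n) p :=
  sharp (g.inner p) (η p)

/-- The Riemannian measure (Riemannian density) of `g`. In each chart it has the density
`√det(gᵢⱼ)` with respect to Lebesgue measure; these local measures agree on overlaps, and the
Riemannian measure is the smallest measure that dominates all of them. -/
def riemannianMeasure [MeasurableSpace M] : Measure M :=
  ⨆ p : M, ((volume.restrict (extChartAt (𝓡 n) p).target).withDensity fun y =>
    ENNReal.ofReal (Real.sqrt (gram (chartMetric g p y)).det)).map (extChartAt (𝓡 n) p).symm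

end Manifolds

/-! ### Immersions -/

section Immersions

variable {m n : ℕ}
  {S : Type*} [TopologicalSpace S] [ChartedSpace (E m) S] [IsManifold (𝓡 m) ∞ S]
  {M : Type*} [TopologicalSpace M] [ChartedSpace (E n) M] [IsManifold (𝓡 n) ∞ M]

/-- `f` is an isometric immersion `(S, gS) → (M, gM)`. -/
def IsIsometricImmersion (gS : Metric m S) (gM : Metric n M) (f : S → M) : Prop :=
  ContMDiff (𝓡 m) (𝓡 n) ∞ f ∧
    ∀ (p : S) (v w : TangentSpace (𝓡 m) p),
      gM.inner (f p) (mfderiv (𝓡 m) (𝓡 n) f p v) (mfderiv (𝓡 m) (𝓡 n) f p w) = gS.inner p v w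

/-- The covariant derivative `∇^M_v V` at `p`, for the Levi-Civita connection of `gM`, of a vector
field `V` along `f : S → M` in the direction `v ∈ T_pS`. -/
def covDerivAlong (gM : Metric n M) (f : S → M) (V : ∀ q : S, TangentSpace (𝓡 n) (f q)) (p : S)
    (v : TangentSpace (𝓡 m) p) : TangentSpace (𝓡 n) (f p) :=
  mvfderiv (𝓡 m)
      (fun q => (mfderiv (𝓡 n) 𝓘(ℝ, E n) (extChartAt (𝓡 n) (f p)) (f q) (V q) : E n)) p v
    + christoffel (chartMetric gM (f p)) (extChartAt (𝓡 n) (f p) (f p))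
        (mfderiv (𝓡 m) (𝓡 n) f p v) (V p)

variable (m) in
/-- `ξ ∈ T_{f(p)}M` is normal to the immersion `f` at `p`. -/
def IsNormalAt (gM : Metric n M) (f : S → M) (p : S) (ξ : TangentSpace (𝓡 n) (f p)) : Prop :=
  ∀ v : TangentSpace (𝓡 m) p, gM.inner (f p) ξ (mfderiv (𝓡 m) (𝓡 n) f p v) = 0

/-- The component `⟨A(v, w), ξ⟩ = ⟨∇^M_v W, ξ⟩` of the second fundamental form
`A(v, w) = (∇^M_v W)^⊥` of `f` at `p` in the normal direction `ξ`, where `W` is a tangent vector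
field of `S` with `W(p) = w`. -/
def secondFundamentalForm (gM : Metric n M) (f : S → M) (p : S) (ξ : TangentSpace (𝓡 n) (f p))
    (v w : TangentSpace (𝓡 m) p) : ℝ :=
  gM.inner (f p)
    (covDerivAlong gM f (fun q => mfderiv (𝓡 m) (𝓡 n) f q (coordField p w q)) p v) ξ

variable (m) in
/-- `f` is totally geodesic: its second fundamental form vanishes. -/
def IsTotallyGeodesic (gM : Metric n M) (f : S → M) : Prop :=
  ∀ (p : S) (ξ : TangentSpace (𝓡 n) (f p)), IsNormalAt m gM f p ξ →
    ∀ v w : TangentSpace (𝓡 m) p, secondFundamentalForm gM f p ξ v w = 0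

/-- `f` is minimal: its mean curvature vector (the trace of the second fundamental form)
vanishes. -/
def IsMinimal (gS : Metric m S) (gM : Metric n M) (f : S → M) : Prop :=
  ∀ (p : S) (ξ : TangentSpace (𝓡 n) (f p)), IsNormalAt m gM f p ξ →
    metricTrace (gS.inner p) (secondFundamentalForm gM f p ξ) = 0

variable (m) in
/-- `ν` is a smooth unit normal vector field along `f`. For a hypersurface immersion, such a field
exists if and only if the normal bundle is trivial. -/
def IsUnitNormalField (gM : Metric n M) (f : S → M) (ν : ∀ q : S, TangentSpace (𝓡 n) (f q)) :
    Prop :=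
  ContMDiff (𝓡 m) (𝓡 n).tangent ∞ (fun q => (⟨f q, ν q⟩ : TangentBundle (𝓡 n) M)) ∧
    ∀ q : S, IsNormalAt m gM f q (ν q) ∧ gM.inner (f q) (ν q) (ν q) = 1

/-- The Jacobi operator `J(φ) = Δφ + Ric^M(ν, ν)φ + |A|²φ` of a hypersurface with unit normal
field `ν`. -/
def jacobiOperator (gS : Metric m S) (gM : Metric n M) (f : S → M)
    (ν : ∀ q : S, TangentSpace (𝓡 n) (f q)) (φ : S → ℝ) (p : S) : ℝ :=
  laplaceBeltrami gS φ p + ricciTensor gM (f p) (ν p) (ν p) * φ p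
    + metricNormSq (gS.inner p) (secondFundamentalForm gM f p (ν p)) * φ p

/-- The index form `Q(φ, ψ) = -∫_S J(φ) ψ dμ` of a hypersurface with unit normal field `ν`. -/
def indexForm [MeasurableSpace S] (gS : Metric m S) (gM : Metric n M) (f : S → M)
    (ν : ∀ q : S, TangentSpace (𝓡 n) (f q)) (φ ψ : S → ℝ) : ℝ :=
  -∫ p, jacobiOperator gS gM f ν φ p * ψ p ∂(riemannianMeasure gS)

end Immersions

/-! ### Killing vector fields -/

section Killing

variable {r : ℕ} {N : Type*} [TopologicalSpace N] [ChartedSpace (E r) N] [IsManifold (𝓡 r) ∞ N]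

/-- Smoothness of a vector field. -/
def IsSmoothField (X : ∀ x : N, TangentSpace (𝓡 r) x) : Prop :=
  ContMDiff (𝓡 r) (𝓡 r).tangent ∞ (fun x => (⟨x, X x⟩ : TangentBundle (𝓡 r) N))

/-- Killing vector fields: smooth fields `X` with `X⟨Y, Z⟩ = ⟨[X, Y], Z⟩ + ⟨Y, [X, Z]⟩` for all
smooth fields `Y, Z`, that is, `L_X g = 0`. -/
def IsKillingField (g : Metric r N) (X : ∀ x : N, TangentSpace (𝓡 r) x) : Prop :=
  IsSmoothField X ∧
    ∀ Y Z : ∀ x : N, TangentSpace (𝓡 r) x, IsSmoothField Y → IsSmoothField Z → ∀ x : N,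
      mvfderiv (𝓡 r) (fun q => g.inner q (Y q) (Z q)) x (X x)
        = g.inner x (VectorField.mlieBracket (𝓡 r) X Y x) (Z x)
          + g.inner x (Y x) (VectorField.mlieBracket (𝓡 r) X Z x)

lemma minSmoothness_two_le : minSmoothness ℝ 2 ≤ (∞ : ℕ∞ω) := by
  rw [minSmoothness_of_isRCLikeNormedField]
  exact ENat.LEInfty.out

lemma isManifold_minSmoothness (k : ℕ) : IsManifold (𝓡 r) (minSmoothness ℝ k) N := by
  rw [minSmoothness_of_isRCLikeNormedField]
  exact IsManifold.of_le (n := ∞) (by exact_mod_cast le_top)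

lemma IsSmoothField.mdiffAt {X : ∀ x : N, TangentSpace (𝓡 r) x} (hX : IsSmoothField X) (x : N) :
    MDifferentiableAt (𝓡 r) (𝓡 r).tangent (fun x => (⟨x, X x⟩ : TangentBundle (𝓡 r) N)) x :=
  (hX x).mdifferentiableAt (by simp)

lemma IsSmoothField.mlieBracket {X Y : ∀ x : N, TangentSpace (𝓡 r) x}
    (hX : IsSmoothField X) (hY : IsSmoothField Y) :
    IsSmoothField (VectorField.mlieBracket (𝓡 r) X Y) := by
  have : IsManifold (𝓡 r) ((⊤ : ℕ∞) + 1) N := by simpa using ‹IsManifold (𝓡 r) ∞ N›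
  have := isManifold_minSmoothness (r := r) (N := N) 2
  have := isManifold_minSmoothness (r := r) (N := N) 3
  exact ContDiff.mlieBracket_vectorField (m := ⊤) (n := ⊤) hX hY (by simp)

lemma smooth_inner (g : Metric r N) {Y Z : ∀ x : N, TangentSpace (𝓡 r) x}
    (hY : IsSmoothField Y) (hZ : IsSmoothField Z) :
    ContMDiff (𝓡 r) 𝓘(ℝ, ℝ) ∞ (fun q => g.inner q (Y q) (Z q)) := by
  have := ContMDiff.clm_bundle_apply₂ (F₁ := E r) (F₂ := E r) (F₃ := ℝ)
    (E₁ := fun x : N => TangentSpace (𝓡 r) x) (E₂ := fun x : N => TangentSpace (𝓡 r) x)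
    (E₃ := Bundle.Trivial N ℝ) (b := fun x : N => x) g.contMDiff hY hZ
  intro x
  have h := this x
  rw [contMDiffAt_section] at h
  exact h

/-- `[X, Y]h = X(Yh) - Y(Xh)` on smooth functions `h`. -/
lemma mvfderiv_mlieBracket {X Y : ∀ x : N, TangentSpace (𝓡 r) x}
    (hX : IsSmoothField X) (hY : IsSmoothField Y) {h : N → ℝ}
    (hh : ContMDiff (𝓡 r) 𝓘(ℝ, ℝ) ∞ h)
    (hXh : ContMDiff (𝓡 r) 𝓘(ℝ, ℝ) ∞ (fun q => mvfderiv (𝓡 r) h q (X q)))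
    (hYh : ContMDiff (𝓡 r) 𝓘(ℝ, ℝ) ∞ (fun q => mvfderiv (𝓡 r) h q (Y q))) (x : N) :
    mvfderiv (𝓡 r) h x (VectorField.mlieBracket (𝓡 r) X Y x)
      = mvfderiv (𝓡 r) (fun q => mvfderiv (𝓡 r) h q (Y q)) x (X x)
        - mvfderiv (𝓡 r) (fun q => mvfderiv (𝓡 r) h q (X q)) x (Y x) := by
  have := isManifold_minSmoothness (r := r) (N := N) 2
  have := isManifold_minSmoothness (r := r) (N := N) 3
  have : IsManifold (𝓡 r) ((⊤ : ℕ∞) + 1) N := by simpa using ‹IsManifold (𝓡 r) ∞ N›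
  rcases subsingleton_or_nontrivial (E r) with hs | hs
  · have hz : ∀ v : TangentSpace (𝓡 r) x, v = 0 := fun v => hs.elim v 0
    rw [hz (VectorField.mlieBracket (𝓡 r) X Y x), hz (X x), hz (Y x)]
    simp
  obtain ⟨v, hv⟩ := exists_ne (0 : E r)
  set W : ∀ q : N, TangentSpace (𝓡 r) q :=
    FiberBundle.extend (E r) (x := x) (show TangentSpace (𝓡 r) x from v) with hWdef
  have hWx : W x = v := FiberBundle.extend_apply_self ..
  have hW2 : ∀ᶠ q in 𝓝 x, ContMDiffAt (𝓡 r) (𝓡 r).tangent ∞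
      (fun x => (⟨x, W x⟩ : TangentBundle (𝓡 r) N)) q := by
    obtain ⟨s, hs, hsW⟩ := FiberBundle.exists_contMDiffOn_extend (k := ∞) (𝓡 r) (E r)
      (V := fun q : N => TangentSpace (𝓡 r) q) (x₀ := x) v
    filter_upwards [eventually_mem_nhds_iff.2 hs] with q hq
    exact (hsW q (mem_of_mem_nhds hq)).contMDiffAt hq
  have hWd : ∀ᶠ q in 𝓝 x, MDifferentiableAt (𝓡 r) (𝓡 r).tangent
      (fun x => (⟨x, W x⟩ : TangentBundle (𝓡 r) N)) q :=
    hW2.mono fun q hq => hq.mdifferentiableAt (by simp)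
  have hW : ContMDiffAt (𝓡 r) (𝓡 r).tangent ∞
      (fun x => (⟨x, W x⟩ : TangentBundle (𝓡 r) N)) x := hW2.self_of_nhds
  have hhd : ∀ q, MDifferentiableAt (𝓡 r) 𝓘(ℝ, ℝ) h q :=
    fun q => (hh q).mdifferentiableAt (by simp)
  have hsm : ∀ (k : N → ℝ), ContMDiff (𝓡 r) 𝓘(ℝ, ℝ) ∞ k →
      ∀ Z : (∀ q : N, TangentSpace (𝓡 r) q), ContMDiffAt (𝓡 r) (𝓡 r).tangent ∞
        (fun x => (⟨x, Z x⟩ : TangentBundle (𝓡 r) N)) x →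
      ContMDiffAt (𝓡 r) (𝓡 r).tangent ∞
        (fun x => (⟨x, (k • Z) x⟩ : TangentBundle (𝓡 r) N)) x :=
    fun k hk Z hZ => (hk x).smul_section hZ
  have hbr : ∀ Z : (∀ q : N, TangentSpace (𝓡 r) q), IsSmoothField Z →
      ContMDiffAt (𝓡 r) (𝓡 r).tangent ∞ (fun q =>
        (⟨q, VectorField.mlieBracket (𝓡 r) Z W q⟩ : TangentBundle (𝓡 r) N)) x :=
    fun Z hZ => ContMDiffAt.mlieBracket_vectorField (m := ⊤) (n := ⊤) (hZ x) hW (by simp)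
  have key : ∀ Z Z' : (∀ q : N, TangentSpace (𝓡 r) q), IsSmoothField Z →
      ContMDiff (𝓡 r) 𝓘(ℝ, ℝ) ∞ (fun q => mvfderiv (𝓡 r) h q (Z q)) →
      VectorField.mlieBracket (𝓡 r) Z' (VectorField.mlieBracket (𝓡 r) Z (h • W)) x
        = mvfderiv (𝓡 r) (fun q => mvfderiv (𝓡 r) h q (Z q)) x (Z' x) • W x
          + mvfderiv (𝓡 r) h x (Z x) • VectorField.mlieBracket (𝓡 r) Z' W x
          + (mvfderiv (𝓡 r) h x (Z' x) • VectorField.mlieBracket (𝓡 r) Z W x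
          + h x • VectorField.mlieBracket (𝓡 r) Z' (VectorField.mlieBracket (𝓡 r) Z W) x) := by
    intro Z Z' hZ hZh
    have h1 : VectorField.mlieBracket (𝓡 r) Z (h • W) =ᶠ[𝓝 x]
        ((fun q => mvfderiv (𝓡 r) h q (Z q)) • W + h • VectorField.mlieBracket (𝓡 r) Z W) := by
      filter_upwards [hWd] with q hq
      exact VectorField.mlieBracket_smul_right (hhd q) hq
    rw [Filter.EventuallyEq.mlieBracket_vectorField_eq (Filter.EventuallyEq.refl _ Z') h1,
      VectorField.mlieBracket_add_right, VectorField.mlieBracket_smul_right,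
      VectorField.mlieBracket_smul_right (hhd x)]
    · exact (hbr Z hZ).mdifferentiableAt (by simp)
    · exact (hZh x).mdifferentiableAt (by simp)
    · exact hWd.self_of_nhds
    · exact (hsm _ hZh W hW).mdifferentiableAt (by simp)
    · exact (hsm _ hh _ (hbr Z hZ)).mdifferentiableAt (by simp)
  have J1 := VectorField.leibniz_identity_mlieBracket_apply ((hX x).of_le minSmoothness_two_le) ((hY x).of_le minSmoothness_two_le)
    ((hsm h hh W hW).of_le minSmoothness_two_le)
  have J2 := VectorField.leibniz_identity_mlieBracket_apply ((hX x).of_le minSmoothness_two_le) ((hY x).of_le minSmoothness_two_le)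
    (hW.of_le minSmoothness_two_le)
  rw [key Y X hY hYh, key X Y hX hXh,
    VectorField.mlieBracket_smul_right (hhd x) hWd.self_of_nhds, J2] at J1
  have h3 : (mvfderiv (𝓡 r) h x (VectorField.mlieBracket (𝓡 r) X Y x)
      - (mvfderiv (𝓡 r) (fun q => mvfderiv (𝓡 r) h q (Y q)) x (X x)
        - mvfderiv (𝓡 r) (fun q => mvfderiv (𝓡 r) h q (X q)) x (Y x))) • W x = 0 := by
    rw [← sub_eq_zero, ← neg_eq_zero] at J1
    rw [← J1]
    module
  rw [smul_eq_zero, sub_eq_zero] at h3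
  exact h3.resolve_right (by rw [hWx]; exact hv)

lemma mvfderiv_inner_add (g : Metric r N) {Y Z Y' Z' : ∀ x : N, TangentSpace (𝓡 r) x}
    (hY : IsSmoothField Y) (hZ : IsSmoothField Z) (hY' : IsSmoothField Y')
    (hZ' : IsSmoothField Z') (x : N) (v : TangentSpace (𝓡 r) x) :
    mvfderiv (𝓡 r) (fun q => g.inner q (Y q) (Z q) + g.inner q (Y' q) (Z' q)) x v
      = mvfderiv (𝓡 r) (fun q => g.inner q (Y q) (Z q)) x v
        + mvfderiv (𝓡 r) (fun q => g.inner q (Y' q) (Z' q)) x v := by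
  rw [mvfderiv_fun_add ((smooth_inner g hY hZ x).mdifferentiableAt (by simp))
    ((smooth_inner g hY' hZ' x).mdifferentiableAt (by simp))]
  rfl

/-- The bracket of two Killing fields is a Killing field. -/
lemma IsKillingField.mlieBracket {g : Metric r N} {X₁ X₂ : ∀ x : N, TangentSpace (𝓡 r) x}
    (h₁ : IsKillingField g X₁) (h₂ : IsKillingField g X₂) :
    IsKillingField g (VectorField.mlieBracket (𝓡 r) X₁ X₂) := by
  refine ⟨h₁.1.mlieBracket h₂.1, fun Y Z hY hZ x => ?_⟩
  have := isManifold_minSmoothness (r := r) (N := N) 3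
  have e₁ : (fun q => mvfderiv (𝓡 r) (fun q => g.inner q (Y q) (Z q)) q (X₁ q)) = _ :=
    funext (h₁.2 Y Z hY hZ)
  have e₂ : (fun q => mvfderiv (𝓡 r) (fun q => g.inner q (Y q) (Z q)) q (X₂ q)) = _ :=
    funext (h₂.2 Y Z hY hZ)
  have s₁ := (smooth_inner g (h₁.1.mlieBracket hY) hZ).add (smooth_inner g hY (h₁.1.mlieBracket hZ))
  have s₂ := (smooth_inner g (h₂.1.mlieBracket hY) hZ).add (smooth_inner g hY (h₂.1.mlieBracket hZ))
  rw [mvfderiv_mlieBracket h₁.1 h₂.1 (smooth_inner g hY hZ) (by rw [e₁]; exact s₁)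
    (by rw [e₂]; exact s₂), e₁, e₂,
    mvfderiv_inner_add g (h₂.1.mlieBracket hY) hZ hY (h₂.1.mlieBracket hZ),
    mvfderiv_inner_add g (h₁.1.mlieBracket hY) hZ hY (h₁.1.mlieBracket hZ),
    h₁.2 _ _ (h₂.1.mlieBracket hY) hZ, h₁.2 _ _ hY (h₂.1.mlieBracket hZ),
    h₂.2 _ _ (h₁.1.mlieBracket hY) hZ, h₂.2 _ _ hY (h₁.1.mlieBracket hZ)]
  rw [VectorField.leibniz_identity_mlieBracket_apply ((h₁.1 x).of_le minSmoothness_two_le) ((h₂.1 x).of_le minSmoothness_two_le)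
      ((hY x).of_le minSmoothness_two_le),
    VectorField.leibniz_identity_mlieBracket_apply ((h₁.1 x).of_le minSmoothness_two_le) ((h₂.1 x).of_le minSmoothness_two_le)
      ((hZ x).of_le minSmoothness_two_le)]
  simp only [map_add, add_apply]
  ring

/-- The space of Killing vector fields of `(N, g)`. -/
def killingSpace (g : Metric r N) : Submodule ℝ (∀ x : N, TangentSpace (𝓡 r) x) where
  carrier := {X | IsKillingField g X}
  zero_mem' := by
    refine ⟨contMDiff_zeroSection ℝ (fun x : N => TangentSpace (𝓡 r) x), fun Y Z hY hZ x => ?_⟩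
    simp
  add_mem' := by
    rintro X X' ⟨hX, h⟩ ⟨hX', h'⟩
    refine ⟨ContMDiff.add_section hX hX', fun Y Z hY hZ x => ?_⟩
    rw [VectorField.mlieBracket_add_left (hX.mdiffAt x) (hX'.mdiffAt x),
      VectorField.mlieBracket_add_left (hX.mdiffAt x) (hX'.mdiffAt x), Pi.add_apply, map_add,
      h Y Z hY hZ, h' Y Z hY hZ]
    simp only [map_add, add_apply]
    ring
  smul_mem' := by
    rintro c X ⟨hX, h⟩
    refine ⟨ContMDiff.const_smul_section hX, fun Y Z hY hZ x => ?_⟩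
    rw [VectorField.mlieBracket_const_smul_left (hX.mdiffAt x),
      VectorField.mlieBracket_const_smul_left (hX.mdiffAt x), Pi.smul_apply, map_smul,
      h Y Z hY hZ]
    simp only [map_smul, smul_apply, smul_eq_mul]
    ring

/-- The Lie algebra `𝔤` of the isometry group of a compact Riemannian manifold `(N, g)`, realised
as the space of its Killing fields: an element is the fundamental vector field
`X^†(q) = d/dt exp(tX)q |_{t=0}` that it generates. Since `[X^†, Y^†] = -[X, Y]^†`, the bracket of
`𝔤` is minus the bracket of vector fields. -/
def IsometryAlgebra (g : Metric r N) : Type _ := killingSpace g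

namespace IsometryAlgebra

variable (g : Metric r N)

instance : AddCommGroup (IsometryAlgebra g) := inferInstanceAs (AddCommGroup (killingSpace g))

instance : Module ℝ (IsometryAlgebra g) := inferInstanceAs (Module ℝ (killingSpace g))

/-- The linear map `X ↦ X^†(p)`. -/
def eval (p : N) : IsometryAlgebra g →ₗ[ℝ] TangentSpace (𝓡 r) p :=
  (LinearMap.proj p).comp (killingSpace g).subtype

variable {g}

@[ext]
lemma ext {X Y : IsometryAlgebra g} (h : ∀ p, eval g p X = eval g p Y) : X = Y :=
  Subtype.ext (funext h)

lemma isKillingField (X : IsometryAlgebra g) : IsKillingField g (fun p => eval g p X) := X.2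

instance : Bracket (IsometryAlgebra g) (IsometryAlgebra g) where
  bracket X Y := ⟨-VectorField.mlieBracket (𝓡 r) (fun p => eval g p X) (fun p => eval g p Y),
    (killingSpace g).neg_mem (X.isKillingField.mlieBracket Y.isKillingField)⟩

lemma eval_lie (X Y : IsometryAlgebra g) (p : N) :
    eval g p ⁅X, Y⁆ =
      -VectorField.mlieBracket (𝓡 r) (fun q => eval g q X) (fun q => eval g q Y) p := rfl

instance : LieRing (IsometryAlgebra g) where
  add_lie X Y Z := by
    ext p
    have h := VectorField.mlieBracket_add_left (W := fun q => eval g q Z)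
      (X.isKillingField.1.mdiffAt p) (Y.isKillingField.1.mdiffAt p)
    rw [map_add, eval_lie, eval_lie, eval_lie, ← neg_add, ← h]
    rfl
  lie_add X Y Z := by
    ext p
    have h := VectorField.mlieBracket_add_right (V := fun q => eval g q X)
      (Y.isKillingField.1.mdiffAt p) (Z.isKillingField.1.mdiffAt p)
    rw [map_add, eval_lie, eval_lie, eval_lie, ← neg_add, ← h]
    rfl
  lie_self X := by
    ext p
    rw [eval_lie, VectorField.mlieBracket_self]
    simp
  leibniz_lie X Y Z := by
    ext p
    have := isManifold_minSmoothness (r := r) (N := N) 3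
    have h := VectorField.leibniz_identity_mlieBracket_apply
      ((X.isKillingField.1 p).of_le minSmoothness_two_le)
      ((Y.isKillingField.1 p).of_le minSmoothness_two_le)
      ((Z.isKillingField.1 p).of_le minSmoothness_two_le)
    have e : ∀ A B : IsometryAlgebra g, (fun q => eval g q ⁅A, B⁆) = (-1 : ℝ) •
        VectorField.mlieBracket (𝓡 r) (fun q => eval g q A) (fun q => eval g q B) := by
      intro A B
      funext q
      simp [eval_lie]
    have d : ∀ A B : IsometryAlgebra g, _ := fun A B : IsometryAlgebra g =>
      (A.isKillingField.1.mlieBracket B.isKillingField.1).mdiffAt p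
    rw [map_add, eval_lie, eval_lie, eval_lie, e, e, e,
      VectorField.mlieBracket_const_smul_right (d Y Z),
      VectorField.mlieBracket_const_smul_right (d X Z),
      VectorField.mlieBracket_const_smul_left (d X Y), h]
    module

instance : LieAlgebra ℝ (IsometryAlgebra g) where
  lie_smul c X Y := by
    ext p
    have h := VectorField.mlieBracket_const_smul_right (V := fun q => eval g q X) (c := c)
      (Y.isKillingField.1.mdiffAt p)
    rw [map_smul, eval_lie, eval_lie, smul_neg, ← h]
    rfl

end IsometryAlgebra

end Killing

/-! ### Riemannian symmetric spaces -/

section Symmetric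

variable {r : ℕ} {N : Type*} [TopologicalSpace N] [ChartedSpace (E r) N] [IsManifold (𝓡 r) ∞ N]

/-- `σ` is a symmetry of `(N, g)` at `p`: an involutive isometry of which `p` is an isolated fixed
point. -/
structure IsSymmetryAt (g : Metric r N) (p : N) (σ : N → N) : Prop where
  isometry : IsIsometricImmersion g g σ
  involutive : Function.Involutive σ
  fixed : σ p = p
  isolated : ∀ᶠ q in 𝓝 p, σ q = q → q = p

/-- The space `𝔫_p`: the `(-1)`-eigenspace of the involution of `𝔤` induced by the symmetry `s p` at
`p`. On fundamental vector fields that involution is the push-forward by `s p`. -/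
def minusSpace (g : Metric r N) (s : N → N → N) (p : N) : Submodule ℝ (IsometryAlgebra g) where
  carrier := {X | ∀ q : N, mfderiv (𝓡 r) (𝓡 r) (s p) q (IsometryAlgebra.eval g q X)
    = -IsometryAlgebra.eval g (s p q) X}
  zero_mem' q := by simp
  add_mem' {X Y} hX hY q := by
    rw [map_add, map_add, hX q, hY q, map_add, neg_add]
  smul_mem' c X hX q := by
    rw [map_smul, map_smul, hX q, map_smul, smul_neg]

/-- The inner product `⟨X, Y⟩_𝔤 = -B(X, Y)` on `𝔤`, where `B` is the Killing form. -/
def algebraForm (g : Metric r N) :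
    IsometryAlgebra g →ₗ[ℝ] IsometryAlgebra g →ₗ[ℝ] ℝ :=
  -killingForm ℝ (IsometryAlgebra g)

/-- `g` is the canonical metric induced by minus the Killing form: at every point `p` it is carried
over from `⟨,⟩_𝔤` restricted to `𝔫_p` by the canonical isomorphism `𝔫_p ≃ T_pN`, `X ↦ X^†(p)`. -/
def IsCanonicalMetric (g : Metric r N) (s : N → N → N) : Prop :=
  ∀ p : N, ∃ e : minusSpace g s p ≃ₗ[ℝ] TangentSpace (𝓡 r) p,
    (∀ X, e X = IsometryAlgebra.eval g p X) ∧
      ∀ X Y, g.inner p (e X) (e Y) = algebraForm g X Y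

end Symmetric

/-! ### The quadratic form on `∧²𝔤` -/

section TestFunctions

/-- The form `⟨x ∧ y, z ∧ w⟩ = ⟨x, z⟩⟨y, w⟩ - ⟨x, w⟩⟨y, z⟩` induced on `∧²V` by a symmetric bilinear
form on `V`. -/
def wedgeForm {V : Type*} [AddCommGroup V] [Module ℝ V] (b : V →ₗ[ℝ] V →ₗ[ℝ] ℝ) :
    ⋀[ℝ]^2 V →ₗ[ℝ] ⋀[ℝ]^2 V →ₗ[ℝ] ℝ :=
  (exteriorPower.pairingDual ℝ V 2).comp (exteriorPower.map 2 b)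

/-- The wedge product `x ∧ y ∈ ∧²V`. -/
def wedge {V : Type*} [AddCommGroup V] [Module ℝ V] (x y : V) : ⋀[ℝ]^2 V :=
  exteriorPower.ιMulti ℝ 2 ![x, y]

variable {m n r : ℕ}
  {S : Type*} [TopologicalSpace S] [ChartedSpace (E m) S] [IsManifold (𝓡 m) ∞ S]
  {M : Type*} [TopologicalSpace M] [ChartedSpace (E n) M] [IsManifold (𝓡 n) ∞ M]
  {N : Type*} [TopologicalSpace N] [ChartedSpace (E r) N] [IsManifold (𝓡 r) ∞ N]

/-- The inner product `g_p` as a bilinear form on `T_pN`. -/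
def tangentForm (g : Metric r N) (p : N) :
    TangentSpace (𝓡 r) p →ₗ[ℝ] TangentSpace (𝓡 r) p →ₗ[ℝ] ℝ :=
  (ContinuousLinearMap.coeLM ℝ).comp (g.inner p).toLinearMap

/-- `Π(v)(p) ∈ ∧²T_pN`, where `Π(X ∧ Y) = X^† ∧ Y^†`. -/
def wedgeEval (g : Metric r N) (p : N) :
    ⋀[ℝ]^2 (IsometryAlgebra g) →ₗ[ℝ] ⋀[ℝ]^2 (TangentSpace (𝓡 r) p) :=
  exteriorPower.map 2 (IsometryAlgebra.eval g p)

/-- The test function `φ_{T,v} = ⟨ν ∧ T, Π(v)⟩` on `S`, where tangent vectors of `S` and `M` are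
regarded as tangent vectors of `N` through `f : S → M` and `F : M → N`. -/
def testFunction (gN : Metric r N) (F : M → N) (f : S → M)
    (ν : ∀ q : S, TangentSpace (𝓡 n) (f q)) (T : ∀ q : S, TangentSpace (𝓡 m) q)
    (v : ⋀[ℝ]^2 (IsometryAlgebra gN)) (p : S) : ℝ :=
  wedgeForm (tangentForm gN (F (f p)))
    (wedge (mfderiv (𝓡 n) (𝓡 r) F (f p) (ν p))
      (mfderiv (𝓡 n) (𝓡 r) F (f p) (mfderiv (𝓡 m) (𝓡 n) f p (T p))))
    (wedgeEval gN (F (f p)) v)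

/-- The quadratic form `q_T(v, w) = Q(φ_{T,v}, φ_{T,w})` on `∧²𝔤`. -/
def testQuadraticForm [MeasurableSpace S] (gS : Metric m S) (gM : Metric n M) (gN : Metric r N)
    (F : M → N) (f : S → M) (ν : ∀ q : S, TangentSpace (𝓡 n) (f q))
    (T : ∀ q : S, TangentSpace (𝓡 m) q) (v w : ⋀[ℝ]^2 (IsometryAlgebra gN)) : ℝ :=
  indexForm gS gM f ν (testFunction gN F f ν T v) (testFunction gN F f ν T w)

end TestFunctions

end TraceFormula

end

set_option linter.unusedSectionVars false

/-! The trace vanishes pointwise, before any integration: with `φᵢ = φ_{T,vᵢ}` and `T = ω^♯`, the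
sum `∑ J(φᵢ) φᵢ` is zero at every point of `Σ`.

Each `u ∈ T_qN` is lifted to the element `Θu ∈ 𝔫_q` whose Killing field takes the value `u` at `q`.
The Killing form is invariant under the symmetry at `q`, so `𝔫_q` is orthogonal to the isotropy
algebra; since the metric is canonical, `⟨Θu, c⟩ = ⟨u, c^†(q)⟩` for all `c ∈ 𝔤`. Hence `Θ` maps `TN`
isometrically into the trivial bundle with fibre `𝔤`, and `φ_{T,v} = ⟨N ∧ τ, v⟩` with `N = Θν`, `τ =
ΘT`. Summing over an orthonormal basis of `∧²𝔤` turns products of coefficients into inner products,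
and the claim becomes `⟨Δ(N ∧ τ), N ∧ τ⟩ + (Ric(ν,ν) + |A|²) |N ∧ τ|² = 0`.

Two properties of `Θ` carry the computation. Paired with `c`, its second fundamental form `II(u,v) =
∂_u(Θv) - Θ(∇_u v)` equals `⟨v, ∇_u c^†⟩`, so it is skew by the Killing equation
(`IsKillingFrame.frameForm_skew`). Since brackets from `𝔫_q` vanish at `q`, the tangential part of
`II` is symmetric in one pair of arguments and skew in another, hence zero: the flat derivative
induces the Levi-Civita connection (`IsKillingFrame.isIsometricFrame`). Both properties survive on
`M` because `F` is totally geodesic. On `Σ` one gets `II = A N + ρ` with `ρ` skew and orthogonal to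
`N`.

For an orthonormal basis `e_a` of `TΣ` three facts are combined in `local_trace_identity`. (1)
`-⟨ΔN, N⟩ = ∑ |∂_a N|² = Ric(ν,ν) + |A|²`, from `|N| = 1` and the Gauss equation
(`IsIsometricFrame.energy_normal`). (2) `⟨Δτ, τ⟩ = -2 ∑ A(e_a,T)²`, from harmonicity; `II` is
trace-free by minimality and skewness, and the contributions of `ρ` cancel
(`IsIsometricFrame.laplacian_of_harmonic`). (3) The cross terms of `Δ(N ∧ τ)` give `+2 ∑ A(e_a,T)²`,
since `⟨N, ∂_a τ⟩ = A(e_a,T) = -⟨τ, ∂_a N⟩`. So (1) cancels the potential of the Jacobi operator and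
(2) cancels (3).

To interchange the finite sum with the integral, each summand must be integrable: it is continuous
on a compact manifold whose Riemannian measure is finite. -/

noncomputable section

namespace TraceFormula

/-! ### Inner products on `ℝⁿ` and orthonormal bases -/

section MetricAlgebra

variable {n : ℕ}

/-- `b` is a (symmetric, positive definite) inner product on `ℝⁿ`. -/
structure IsInner (b : E n →L[ℝ] E n →L[ℝ] ℝ) : Prop where
  symm : ∀ u v, b u v = b v u
  pos : ∀ v, v ≠ 0 → 0 < b v v

/-- `e` is an orthonormal basis for `b`. -/
def IsOrthonormalFor (b : E n →L[ℝ] E n →L[ℝ] ℝ) (e : Module.Basis (Fin n) ℝ (E n)) : Prop :=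
  ∀ i j, b (e i) (e j) = if i = j then 1 else 0

variable {b : E n →L[ℝ] E n →L[ℝ] ℝ}

lemma IsInner.eq_zero (hb : IsInner b) {v : E n} (h : b v v = 0) : v = 0 := by
  by_contra hv
  exact (hb.pos v hv).ne' h

lemma IsInner.ext (hb : IsInner b) {u v : E n} (h : ∀ w, b u w = b v w) : u = v := by
  rw [← sub_eq_zero]
  apply hb.eq_zero
  have : ∀ w, b (u - v) w = 0 := fun w => by rw [map_sub, sub_apply, h, sub_self]
  exact this _

/-- A symmetric form has an orthogonal basis, and positivity allows its vectors to be normalised. -/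
lemma IsInner.exists_orthonormal (hb : IsInner b) : ∃ e, IsOrthonormalFor b e := by
  let β : E n →ₗ[ℝ] E n →ₗ[ℝ] ℝ := (ContinuousLinearMap.coeLM ℝ).comp b.toLinearMap
  have hβ : ∀ u v, β u v = b u v := fun _ _ => rfl
  have hs : LinearMap.IsSymm β := ⟨fun u v => by simpa [hβ] using hb.symm u v⟩
  obtain ⟨v, hv⟩ := LinearMap.BilinForm.exists_orthogonal_basis hs
  have hn : Module.finrank ℝ (E n) = n := by simp
  let v' := v.reindex (finCongr hn)
  have hv' : ∀ i j, i ≠ j → b (v' i) (v' j) = 0 := by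
    intro i j hij
    have := hv (i := (finCongr hn).symm i) (j := (finCongr hn).symm j) (by simpa using hij)
    simpa [v', hβ, Function.onFun] using this
  have hp : ∀ i, 0 < b (v' i) (v' i) := fun i => hb.pos _ (v'.ne_zero i)
  have hu : ∀ i, IsUnit (Real.sqrt (b (v' i) (v' i)))⁻¹ := fun i => by
    simpa using (Real.sqrt_pos.2 (hp i)).ne'
  refine ⟨v'.isUnitSMul hu, fun i j => ?_⟩
  simp only [Module.Basis.isUnitSMul_apply, map_smul, smul_apply, smul_eq_mul]
  split_ifs with h
  · subst h
    have := Real.mul_self_sqrt (hp i).le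
    have h0 := (Real.sqrt_pos.2 (hp i)).ne'
    field_simp
    nlinarith
  · rw [hv' i j h]; simp

/-- A map `c(u, v)` is bilinear. -/
structure IsBilin {W W' : Type*} [AddCommGroup W] [Module ℝ W] [AddCommGroup W'] [Module ℝ W']
    (c : W → W → W') : Prop where
  add_left : ∀ u u' v, c (u + u') v = c u v + c u' v
  smul_left : ∀ (a : ℝ) u v, c (a • u) v = a • c u v
  add_right : ∀ u v v', c u (v + v') = c u v + c u v'
  smul_right : ∀ (a : ℝ) u v, c u (a • v) = a • c u v

section IsBilin

variable {W W' : Type*} [AddCommGroup W] [Module ℝ W] [AddCommGroup W'] [Module ℝ W']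
  {c : W → W → W'}

/-- The bundled bilinear map. -/
def IsBilin.toLin (hc : IsBilin c) : W →ₗ[ℝ] W →ₗ[ℝ] W' :=
  LinearMap.mk₂ ℝ c hc.add_left hc.smul_left hc.add_right hc.smul_right

@[simp] lemma IsBilin.toLin_apply (hc : IsBilin c) (u v : W) : hc.toLin u v = c u v := rfl

lemma IsBilin.sum_left (hc : IsBilin c) {ι : Type*} (s : Finset ι) (a : ι → ℝ) (u : ι → W) (v : W) :
    c (∑ i ∈ s, a i • u i) v = ∑ i ∈ s, a i • c (u i) v := by
  simp only [← hc.toLin_apply, map_sum, map_smul, LinearMap.sum_apply, LinearMap.smul_apply]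

lemma IsBilin.sum_right (hc : IsBilin c) {ι : Type*} (s : Finset ι) (a : ι → ℝ) (u : W) (v : ι → W) :
    c u (∑ i ∈ s, a i • v i) = ∑ i ∈ s, a i • c u (v i) := by
  simp only [← hc.toLin_apply, map_sum, map_smul]

end IsBilin

lemma stdVec_repr (v : E n) : v = ∑ i, v i • stdVec i := by
  ext j
  simp [stdVec, Finset.sum_apply, Pi.single_apply]

/-- The inverse of the Gram matrix in terms of an orthonormal basis. -/
lemma gram_inv_apply {e : Module.Basis (Fin n) ℝ (E n)} (he : IsOrthonormalFor b e) (i j : Fin n) :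
    (gram b)⁻¹ i j = ∑ a, (e a) i * (e a) j := by
  let P : Matrix (Fin n) (Fin n) ℝ := Matrix.of fun i a => (e a) i
  -- The columns of `P` are the basis vectors, so orthonormality reads `Pᵀ G P = 1`; rearranged, `G
  -- (P Pᵀ) = 1`.
  have h1 : P.transpose * gram b * P = 1 := by
    ext a c
    have := he a c
    rw [stdVec_repr (e a), stdVec_repr (e c)] at this
    simp only [map_sum, map_smul, sum_apply, smul_apply,
      smul_eq_mul] at this
    rw [Matrix.one_apply, ← this]
    simp only [Matrix.mul_apply, gram, P, Matrix.of_apply, Matrix.transpose_apply, Finset.sum_mul]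
    refine Finset.sum_congr rfl fun k _ => ?_
    rw [Finset.mul_sum]
    refine Finset.sum_congr rfl fun l _ => ?_
    ring
  have h2 : gram b * (P * P.transpose) = 1 := by
    have h3 : P * (P.transpose * gram b) = 1 := by
      rw [mul_eq_one_comm]; exact h1
    rw [mul_eq_one_comm, Matrix.mul_assoc]; exact h3
  rw [Matrix.inv_eq_right_inv h2]
  simp [Matrix.mul_apply, P]

/-- Replaces contraction with `g^{ij}` by a sum over an orthonormal basis, the form in which all
later traces are computed. -/
lemma metricTrace_eq {e : Module.Basis (Fin n) ℝ (E n)} (he : IsOrthonormalFor b e)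
    {c : E n → E n → ℝ} (hc : IsBilin c) : metricTrace b c = ∑ a, c (e a) (e a) := by
  have h : ∀ a, c (e a) (e a) = ∑ i, ∑ j, (e a i * e a j) * c (stdVec i) (stdVec j) := by
    intro a
    conv_lhs => rw [stdVec_repr (e a)]
    rw [hc.sum_left]
    refine Finset.sum_congr rfl fun i _ => ?_
    rw [hc.sum_right, Finset.smul_sum]
    refine Finset.sum_congr rfl fun j _ => ?_
    simp only [smul_eq_mul]; ring
  simp only [metricTrace, gram_inv_apply he, h, Finset.sum_mul]
  rw [Finset.sum_comm]
  refine (Finset.sum_congr rfl fun i _ => Finset.sum_comm).trans ?_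
  rw [Finset.sum_comm]
  refine (Finset.sum_congr rfl fun i _ => Finset.sum_comm).trans ?_
  rw [Finset.sum_comm]

lemma sharp_eq {e : Module.Basis (Fin n) ℝ (E n)} (he : IsOrthonormalFor b e)
    (α : E n →ₗ[ℝ] ℝ) : sharp b α = ∑ a, α (e a) • e a := by
  have h : ∀ a, α (e a) = ∑ j, e a j * α (stdVec j) := by
    intro a
    conv_lhs => rw [stdVec_repr (e a)]
    simp
  ext k
  simp only [sharp, gram_inv_apply he, h]
  simp only [stdVec, WithLp.ofLp_sum, WithLp.ofLp_smul, Finset.sum_apply, Pi.smul_apply, smul_eq_mul, PiLp.single_apply, mul_ite,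
    mul_one, mul_zero, Finset.sum_ite_eq, Finset.mem_univ, if_true]
  simp only [Finset.sum_mul]
  rw [Finset.sum_comm]
  refine Finset.sum_congr rfl fun i _ => Finset.sum_congr rfl fun j _ => by ring

lemma IsOrthonormalFor.repr {e : Module.Basis (Fin n) ℝ (E n)} (he : IsOrthonormalFor b e)
    (w : E n) : w = ∑ a, b (e a) w • e a := by
  have h := e.sum_repr w
  have h2 : ∀ a, b (e a) w = e.repr w a := by
    intro a
    conv_lhs => rw [← h]
    simp only [map_sum, map_smul, he a]
    simp
  simp only [h2, h]

lemma inner_sharp (hb : IsInner b) (α : E n →ₗ[ℝ] ℝ) (w : E n) : b (sharp b α) w = α w := by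
  obtain ⟨e, he⟩ := hb.exists_orthonormal
  rw [sharp_eq he]
  conv_rhs => rw [he.repr w]
  simp [mul_comm]

end MetricAlgebra

end TraceFormula
end

noncomputable section

namespace TraceFormula

/-! ### Calculus of a metric in coordinates -/

section MetricCalculus

variable {n : ℕ}

instance instNormedAddCommGroupForms : NormedAddCommGroup (E n →L[ℝ] E n →L[ℝ] ℝ) :=
  ContinuousLinearMap.toNormedAddCommGroup

instance instNormedSpaceForms : NormedSpace ℝ (E n →L[ℝ] E n →L[ℝ] ℝ) :=
  ContinuousLinearMap.toNormedSpace

/-- `G` is a smooth Riemannian metric on a neighbourhood of `y`. -/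
def IsMetricNear (G : E n → E n →L[ℝ] E n →L[ℝ] ℝ) (y : E n) : Prop :=
  ∀ᶠ z in 𝓝 y, IsInner (G z) ∧ ContDiffAt ℝ ∞ G z

variable {G : E n → E n →L[ℝ] E n →L[ℝ] ℝ} {y : E n}

lemma IsMetricNear.isInner (h : IsMetricNear G y) : IsInner (G y) := h.self_of_nhds.1

lemma IsMetricNear.contDiffAt (h : IsMetricNear G y) : ContDiffAt ℝ ∞ G y := h.self_of_nhds.2

lemma IsMetricNear.differentiableAt (h : IsMetricNear G y) : DifferentiableAt ℝ G y :=
  h.contDiffAt.differentiableAt (by simp)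

lemma IsMetricNear.eventually (h : IsMetricNear G y) : ∀ᶠ z in 𝓝 y, IsMetricNear G z :=
  eventually_eventually_nhds.2 h

/-- A kernel vector of the Gram matrix would be orthogonal to everything, itself included. -/
lemma isUnit_gram {b : E n →L[ℝ] E n →L[ℝ] ℝ} (hb : IsInner b) : IsUnit (gram b) := by
  rw [Matrix.isUnit_iff_isUnit_det, isUnit_iff_ne_zero]
  intro h0
  obtain ⟨v, hv, h⟩ := Matrix.exists_mulVec_eq_zero_iff.2 h0
  let w : E n := ∑ i, v i • stdVec i
  have hw : w = 0 := by
    apply hb.eq_zero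
    have : ∀ i, b (stdVec i) w = 0 := by
      intro i
      have := congrFun h i
      simpa [Matrix.mulVec, dotProduct, gram, w, mul_comm] using this
    have h2 : b w w = ∑ i, v i * b (stdVec i) w := by
      conv_lhs => rw [show b w = b (∑ i, v i • stdVec i) from rfl]
      simp only [map_sum, map_smul, sum_apply, smul_apply, smul_eq_mul]
    simp [h2, this]
  apply hv
  ext i
  have := congrArg (fun u : E n => u i) hw
  simpa [w, stdVec, Pi.single_apply] using this

-- Inversion is smooth at the units of a complete normed algebra. The choice of matrix norm is
-- immaterial, so it is kept local.
attribute [local instance] Matrix.linftyOpNormedRing Matrix.linftyOpNormedAlgebra in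
lemma IsMetricNear.contDiffAt_gram_inv (h : IsMetricNear G y) (i j : Fin n) :
    ContDiffAt ℝ ∞ (fun z => (gram (G z))⁻¹ i j) y := by
  have hA : ContDiffAt ℝ ∞ (fun z => gram (G z)) y := by
    have hl : ∀ i j, ContDiffAt ℝ ∞ (fun z => gram (G z) i j) y := fun i j =>
      (h.contDiffAt.clm_apply contDiffAt_const).clm_apply contDiffAt_const
    have he : (fun z => gram (G z)) = fun z => ∑ i, ∑ j, gram (G z) i j • Matrix.single i j (1 : ℝ) := by
      funext z
      conv_lhs => rw [Matrix.matrix_eq_sum_single (gram (G z))]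
      simp
    rw [he]
    exact ContDiffAt.sum fun i _ => ContDiffAt.sum fun j _ => (hl i j).smul contDiffAt_const
  obtain ⟨u, hu⟩ := isUnit_gram h.isInner
  have hI : ContDiffAt ℝ ∞ (Ring.inverse : Matrix (Fin n) (Fin n) ℝ → _) (gram (G y)) := by
    rw [← hu]
    exact contDiffAt_ringInverse ℝ u
  have hc := hI.comp y hA
  have hl : ContDiff ℝ ∞ (fun A : Matrix (Fin n) (Fin n) ℝ => A i j) :=
    (LinearMap.toContinuousLinearMap (Matrix.entryLinearMap ℝ ℝ i j)).contDiff
  have := hl.contDiffAt.comp y hc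
  refine this.congr_of_eventuallyEq (Filter.Eventually.of_forall fun z => ?_)
  simp [Matrix.nonsing_inv_eq_ringInverse]

lemma IsMetricNear.contDiffAt_metricTrace (h : IsMetricNear G y) {k : ℕ∞} {c : E n → E n → E n → ℝ}
    (hc : ∀ u v, ContDiffAt ℝ k (fun z => c z u v) y) :
    ContDiffAt ℝ k (fun z => metricTrace (G z) (c z)) y :=
  ContDiffAt.sum fun i _ => ContDiffAt.sum fun j _ =>
    ((h.contDiffAt_gram_inv i j).of_le (by exact_mod_cast le_top)).mul (hc _ _)

lemma IsMetricNear.contDiffAt_sharp (h : IsMetricNear G y) {α : E n → E n → ℝ}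
    (hα : ∀ v, ContDiffAt ℝ ∞ (fun z => α z v) y) :
    ContDiffAt ℝ ∞ (fun z => sharp (G z) (α z)) y :=
  ContDiffAt.sum fun i _ => (ContDiffAt.sum fun j _ =>
    (h.contDiffAt_gram_inv i j).mul (hα _)).smul contDiffAt_const

lemma fderiv_apply_const {F F' : Type*} [NormedAddCommGroup F] [NormedSpace ℝ F]
    [NormedAddCommGroup F'] [NormedSpace ℝ F'] {W : Type*} [NormedAddCommGroup W] [NormedSpace ℝ W]
    {c : W → F →L[ℝ] F'} {y : W} (hc : DifferentiableAt ℝ c y) (u : F) (w : W) :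
    fderiv ℝ (fun z => c z u) y w = fderiv ℝ c y w u := by
  rw [fderiv_clm_apply hc (differentiableAt_const u)]
  simp

lemma fderiv_apply_const₂ {F F' F'' : Type*} [NormedAddCommGroup F] [NormedSpace ℝ F]
    [NormedAddCommGroup F'] [NormedSpace ℝ F'] [NormedAddCommGroup F''] [NormedSpace ℝ F'']
    {W : Type*} [NormedAddCommGroup W] [NormedSpace ℝ W]
    {c : W → F →L[ℝ] F' →L[ℝ] F''} {y : W} (hc : DifferentiableAt ℝ c y) (u : F) (v : F') (w : W) :
    fderiv ℝ (fun z => c z u v) y w = fderiv ℝ c y w u v := by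
  rw [fderiv_apply_const (hc.clm_apply (differentiableAt_const u)), fderiv_apply_const hc]

lemma IsMetricNear.fderiv_symm (h : IsMetricNear G y) (u v w : E n) :
    fderiv ℝ G y u v w = fderiv ℝ G y u w v := by
  rw [← fderiv_apply_const₂ h.differentiableAt, ← fderiv_apply_const₂ h.differentiableAt]
  have : (fun z => G z v w) =ᶠ[𝓝 y] fun z => G z w v := h.mono fun z hz => hz.1.symm v w
  rw [this.fderiv_eq]

/-! ### The Christoffel symbols -/

lemma inner_christoffel (hb : IsInner (G y)) (v w z : E n) :
    G y (christoffel G y v w) z =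
      (1 / 2 : ℝ) * (fderiv ℝ G y v w z + fderiv ℝ G y w v z - fderiv ℝ G y z v w) := by
  let α : E n →ₗ[ℝ] ℝ :=
    { toFun := fun z => (1 / 2 : ℝ) *
        (fderiv ℝ G y v w z + fderiv ℝ G y w v z - fderiv ℝ G y z v w)
      map_add' := fun a b => by simp only [map_add, add_apply]; ring
      map_smul' := fun a b => by
        simp only [map_smul, smul_apply, smul_eq_mul, RingHom.id_apply]; ring }
  exact inner_sharp hb α z

lemma isBilin_christoffel (hb : IsInner (G y)) : IsBilin (christoffel G y) where
  add_left u u' v := hb.ext fun w => by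
    simp only [map_add, add_apply, inner_christoffel hb]; ring
  smul_left a u v := hb.ext fun w => by
    simp only [map_smul, smul_apply, smul_eq_mul, inner_christoffel hb]; ring
  add_right u v v' := hb.ext fun w => by
    simp only [map_add, add_apply, inner_christoffel hb]; ring
  smul_right a u v := hb.ext fun w => by
    simp only [map_smul, smul_apply, smul_eq_mul, inner_christoffel hb]; ring

lemma IsMetricNear.christoffel_symm (h : IsMetricNear G y) (v w : E n) :
    christoffel G y v w = christoffel G y w v := by
  refine h.isInner.ext fun z => ?_
  rw [inner_christoffel h.isInner, inner_christoffel h.isInner, h.fderiv_symm z v w]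
  ring

lemma IsMetricNear.fderiv_metric (h : IsMetricNear G y) (u v w : E n) :
    fderiv ℝ G y u v w = G y (christoffel G y u v) w + G y v (christoffel G y u w) := by
  rw [h.isInner.symm v, inner_christoffel h.isInner, inner_christoffel h.isInner,
    h.fderiv_symm u w v]
  ring

/-- Koszul's formula: a torsion-free metric connection is given by the Christoffel symbols. -/
lemma IsMetricNear.koszul (h : IsMetricNear G y) (T : E n → E n → E n → ℝ)
    (hsymm : ∀ u v w, T u v w = T v u w)
    (hmet : ∀ u v w, fderiv ℝ G y u v w = T u v w + T u w v) (u v w : E n) :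
    T u v w = G y (christoffel G y u v) w := by
  rw [inner_christoffel h.isInner, hmet, hmet, hmet, hsymm v w u, hsymm v u w, hsymm w u v]
  ring

lemma IsMetricNear.contDiffAt_christoffel (h : IsMetricNear G y) (v w : E n) :
    ContDiffAt ℝ ∞ (fun z => christoffel G z v w) y := by
  refine h.contDiffAt_sharp fun z => ?_
  have hd : ContDiffAt ℝ ∞ (fderiv ℝ G) y := h.contDiffAt.fderiv_right (by simp)
  have := fun a b c : E n => ((hd.clm_apply (contDiffAt_const (c := a))).clm_apply
    (contDiffAt_const (c := b))).clm_apply (contDiffAt_const (c := c))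
  exact contDiffAt_const.mul (((this _ _ _).add (this _ _ _)).sub (this _ _ _))

/-- The derivative of the trace of a field of bilinear forms. -/
lemma IsMetricNear.fderiv_metricTrace (h : IsMetricNear G y) {c : E n → E n → E n → ℝ}
    (hc : ∀ u v, DifferentiableAt ℝ (fun z => c z u v) y) (hb : IsBilin (c y)) (w : E n) :
    fderiv ℝ (fun z => metricTrace (G z) (c z)) y w =
      metricTrace (G y) fun u v => fderiv ℝ (fun z => c z u v) y w
        - c y (christoffel G y w u) v - c y u (christoffel G y w v) := by
  set A : E n → Matrix (Fin n) (Fin n) ℝ := fun z => (gram (G z))⁻¹ with hA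
  have hAd : ∀ i j, DifferentiableAt ℝ (fun z => A z i j) y := fun i j =>
    (h.contDiffAt_gram_inv i j).differentiableAt (by simp)
  have hGd : ∀ i j, DifferentiableAt ℝ (fun z => gram (G z) i j) y := fun i j =>
    (h.differentiableAt.clm_apply (differentiableAt_const _)).clm_apply (differentiableAt_const _)
  let dA : Matrix (Fin n) (Fin n) ℝ := fun i j => fderiv ℝ (fun z => A z i j) y w
  let dG : Matrix (Fin n) (Fin n) ℝ := fun i j => fderiv ℝ (fun z => gram (G z) i j) y w
  have hAG : ∀ᶠ z in 𝓝 y, A z * gram (G z) = 1 := h.mono fun z hz =>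
    Matrix.nonsing_inv_mul _ ((Matrix.isUnit_iff_isUnit_det _).1 (isUnit_gram hz.1))
  have hGA : gram (G y) * A y = 1 := mul_eq_one_comm.1 hAG.self_of_nhds
  have h1 : dA * gram (G y) + A y * dG = 0 := by
    ext i j
    have he : (fun z => ∑ k, A z i k * gram (G z) k j) =ᶠ[𝓝 y]
        fun _ => (1 : Matrix (Fin n) (Fin n) ℝ) i j :=
      hAG.mono fun z hz => by simp only [← hz, Matrix.mul_apply]
    have := congrArg (fun l : E n →L[ℝ] ℝ => l w) he.fderiv_eq
    simp only [fderiv_fun_const, Pi.zero_apply, zero_apply] at this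
    rw [fderiv_fun_sum fun k _ => (hAd i k).fun_mul (hGd k j)] at this
    rw [Matrix.zero_apply, ← this]
    simp only [Matrix.add_apply, Matrix.mul_apply, sum_apply]
    rw [← Finset.sum_add_distrib]
    refine Finset.sum_congr rfl fun k _ => ?_
    rw [fderiv_fun_mul (hAd i k) (hGd k j)]
    simp [dA, dG]; ring
  -- the matrix of the connection
  let K : Matrix (Fin n) (Fin n) ℝ := fun k i => christoffel G y w (stdVec i) k
  -- Metric compatibility of the connection in matrix form.
  have hdG : dG = K.transpose * gram (G y) + gram (G y) * K := by
    ext i j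
    simp only [dG, gram, Matrix.of_apply]
    rw [fderiv_apply_const₂ h.differentiableAt, h.fderiv_metric]
    conv_lhs => rw [stdVec_repr (christoffel G y w (stdVec i)),
      stdVec_repr (christoffel G y w (stdVec j))]
    simp only [map_sum, map_smul, sum_apply, smul_apply, smul_eq_mul, Matrix.add_apply,
      Matrix.mul_apply, K, Matrix.of_apply]
    exact congrArg₂ (· + ·) rfl (Finset.sum_congr rfl fun k _ => mul_comm _ _)
  -- The two terms of the derivative of `G⁻¹` become the Christoffel corrections in the two slots of
  -- `c`.
  have h2 : dA = -(A y * K.transpose) - K * A y := by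
    have h3 : dA = -(A y * dG * A y) := by
      have h4 : dA * gram (G y) = -(A y * dG) := eq_neg_of_add_eq_zero_left h1
      calc dA = dA * gram (G y) * A y := by rw [Matrix.mul_assoc, hGA, Matrix.mul_one]
        _ = _ := by rw [h4, Matrix.neg_mul]
    rw [h3, hdG, Matrix.mul_add, Matrix.add_mul, neg_add, sub_eq_add_neg,
      ← Matrix.mul_assoc (A y) (gram (G y)) K, hAG.self_of_nhds, Matrix.one_mul,
      Matrix.mul_assoc, Matrix.mul_assoc, hGA, Matrix.mul_one]
  have hL : fderiv ℝ (fun z => metricTrace (G z) (c z)) y w =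
      ∑ i, ∑ j, (dA i j * c y (stdVec i) (stdVec j)
        + A y i j * fderiv ℝ (fun z => c z (stdVec i) (stdVec j)) y w) := by
    change fderiv ℝ (fun z => ∑ i, ∑ j, A z i j * c z (stdVec i) (stdVec j)) y w = _
    rw [fderiv_fun_sum fun i _ => DifferentiableAt.fun_sum fun j _ => (hAd i j).fun_mul (hc _ _),
      sum_apply]
    refine Finset.sum_congr rfl fun i _ => ?_
    rw [fderiv_fun_sum fun j _ => (hAd i j).fun_mul (hc _ _), sum_apply]
    refine Finset.sum_congr rfl fun j _ => ?_
    rw [fderiv_fun_mul (hAd i j) (hc _ _)]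
    simp [dA, A]; ring
  have hc1 : ∀ i j, c y (christoffel G y w (stdVec i)) (stdVec j) =
      ∑ k, K k i * c y (stdVec k) (stdVec j) := fun i j => by
    conv_lhs => rw [stdVec_repr (christoffel G y w (stdVec i)), hb.sum_left]
    rfl
  have hc2 : ∀ i j, c y (stdVec i) (christoffel G y w (stdVec j)) =
      ∑ k, K k j * c y (stdVec i) (stdVec k) := fun i j => by
    conv_lhs => rw [stdVec_repr (christoffel G y w (stdVec j)), hb.sum_right]
    rfl
  have e1 : ∑ i, ∑ j, (K * A y) i j * c y (stdVec i) (stdVec j) =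
      ∑ i, ∑ j, A y i j * c y (christoffel G y w (stdVec i)) (stdVec j) := by
    simp only [Matrix.mul_apply, hc1, Finset.sum_mul, Finset.mul_sum]
    rw [Finset.sum_congr rfl fun i _ => Finset.sum_comm, Finset.sum_comm]
    refine Finset.sum_congr rfl fun i _ => ?_
    rw [Finset.sum_comm]
    refine Finset.sum_congr rfl fun j _ => Finset.sum_congr rfl fun k _ => by ring
  have e2 : ∑ i, ∑ j, (A y * K.transpose) i j * c y (stdVec i) (stdVec j) =
      ∑ i, ∑ j, A y i j * c y (stdVec i) (christoffel G y w (stdVec j)) := by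
    simp only [Matrix.mul_apply, hc2, Finset.sum_mul, Finset.mul_sum, Matrix.transpose_apply]
    refine Finset.sum_congr rfl fun i _ => ?_
    rw [Finset.sum_comm]
    refine Finset.sum_congr rfl fun j _ => Finset.sum_congr rfl fun k _ => by ring
  rw [hL, h2]
  simp only [metricTrace, Matrix.sub_apply, Matrix.neg_apply, sub_mul, neg_mul, mul_sub,
    Finset.sum_add_distrib, Finset.sum_sub_distrib, Finset.sum_neg_distrib]
  rw [e1, e2]
  ring

end MetricCalculus

end TraceFormula
end

noncomputable section

namespace TraceFormula

/-! ### Isometric maps of the tangent bundle into a trivial bundle -/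

section Frames

variable {n : ℕ} {V : Type*} [NormedAddCommGroup V] [NormedSpace ℝ V]

lemma fderiv_bilin {W F F' : Type*} [NormedAddCommGroup W] [NormedSpace ℝ W]
    [NormedAddCommGroup F] [NormedSpace ℝ F] [NormedAddCommGroup F'] [NormedSpace ℝ F']
    (B : V →L[ℝ] F →L[ℝ] F') {a : W → V} {c : W → F} {y : W}
    (ha : DifferentiableAt ℝ a y) (hc : DifferentiableAt ℝ c y) (w : W) :
    fderiv ℝ (fun z => B (a z) (c z)) y w = B (fderiv ℝ a y w) (c y) + B (a y) (fderiv ℝ c y w) := by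
  rw [B.fderiv_of_bilinear ha hc]
  simp [add_comm]

lemma fderiv_clm {W F F' : Type*} [NormedAddCommGroup W] [NormedSpace ℝ W]
    [NormedAddCommGroup F] [NormedSpace ℝ F] [NormedAddCommGroup F'] [NormedSpace ℝ F']
    {Θ : W → F →L[ℝ] F'} {c : W → F} {y : W}
    (ha : DifferentiableAt ℝ Θ y) (hc : DifferentiableAt ℝ c y) (w : W) :
    fderiv ℝ (fun z => Θ z (c z)) y w = fderiv ℝ Θ y w (c y) + Θ y (fderiv ℝ c y w) := by
  rw [fderiv_clm_apply ha hc]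
  simp [add_comm]

/-- The covariant Hessian `∇dφ` of a vector valued function. -/
def hess (G : E n → E n →L[ℝ] E n →L[ℝ] ℝ) (φ : E n → V) (y u v : E n) : V :=
  fderiv ℝ (fderiv ℝ φ) y u v - fderiv ℝ φ y (christoffel G y u v)

/-- The second fundamental form `∂_u(Θv) - Θ(∇_u v)` of a bundle map `Θ` from the tangent bundle
to a trivial bundle. -/
def frameForm (G : E n → E n →L[ℝ] E n →L[ℝ] ℝ) (Θ : E n → E n →L[ℝ] V) (y u v : E n) : V :=
  fderiv ℝ Θ y u v - Θ y (christoffel G y u v)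

/-- `Θ` is an isometric bundle map, near `y`, from the tangent bundle to the trivial bundle with
fibre `(V, B)`, inducing the Levi-Civita connection. -/
structure IsIsometricFrame (B : V →L[ℝ] V →L[ℝ] ℝ) (G : E n → E n →L[ℝ] E n →L[ℝ] ℝ)
    (Θ : E n → E n →L[ℝ] V) (y : E n) : Prop where
  metric : IsMetricNear G y
  smooth : ∀ᶠ z in 𝓝 y, ContDiffAt ℝ ∞ Θ z
  isom : ∀ᶠ z in 𝓝 y, ∀ u v, B (Θ z u) (Θ z v) = G z u v
  perp : ∀ᶠ z in 𝓝 y, ∀ u v w, B (frameForm G Θ z u v) (Θ z w) = 0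

variable {B : V →L[ℝ] V →L[ℝ] ℝ} {G : E n → E n →L[ℝ] E n →L[ℝ] ℝ} {Θ : E n → E n →L[ℝ] V}
  {y : E n}

lemma isBilin_frameForm (hb : IsInner (G y)) : IsBilin (frameForm G Θ y) := by
  have h := isBilin_christoffel hb
  constructor
  · intro u u' v; simp only [frameForm, map_add, add_apply, h.add_left]; abel
  · intro a u v; simp only [frameForm, map_smul, smul_apply, h.smul_left, smul_sub]
  · intro u u' v; simp only [frameForm, map_add, h.add_right]; abel
  · intro a u v; simp only [frameForm, map_smul, h.smul_right, smul_sub]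

lemma isBilin_hess (hb : IsInner (G y)) (φ : E n → V) : IsBilin (hess G φ y) := by
  have h := isBilin_christoffel hb
  constructor
  · intro u u' v; simp only [hess, map_add, add_apply, h.add_left]; abel
  · intro a u v; simp only [hess, map_smul, smul_apply, h.smul_left, smul_sub]
  · intro u u' v; simp only [hess, map_add, h.add_right]; abel
  · intro a u v; simp only [hess, map_smul, h.smul_right, smul_sub]

lemma fderiv_fderiv_comm {φ : E n → V} (hφ : ContDiffAt ℝ ∞ φ y) (u v : E n) :
    fderiv ℝ (fderiv ℝ φ) y u v = fderiv ℝ (fderiv ℝ φ) y v u :=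
  (hφ.isSymmSndFDerivAt (by rw [minSmoothness_of_isRCLikeNormedField]; exact ENat.LEInfty.out)).eq u v

lemma hess_symm (hG : IsMetricNear G y) {φ : E n → V} (hφ : ContDiffAt ℝ ∞ φ y) (u v : E n) :
    hess G φ y u v = hess G φ y v u := by
  rw [hess, hess, fderiv_fderiv_comm hφ, hG.christoffel_symm]

lemma differentiableAt_fderiv {W : Type*} [NormedAddCommGroup W] [NormedSpace ℝ W]
    {φ : W → V} {y : W} (hφ : ContDiffAt ℝ ∞ φ y) : DifferentiableAt ℝ (fderiv ℝ φ) y :=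
  (hφ.fderiv_right (m := ∞) (by simp)).differentiableAt (by simp)

/-- An isometric bundle map induces the Levi-Civita connection as soon as it is torsion-free. -/
lemma IsIsometricFrame.of_torsion (hB : ∀ x x', B x x' = B x' x) (hG : IsMetricNear G y)
    (hΘ : ∀ᶠ z in 𝓝 y, ContDiffAt ℝ ∞ Θ z)
    (hiso : ∀ᶠ z in 𝓝 y, ∀ u v, B (Θ z u) (Θ z v) = G z u v)
    (htor : ∀ᶠ z in 𝓝 y, ∀ u v w, B (fderiv ℝ Θ z u v) (Θ z w) = B (fderiv ℝ Θ z v u) (Θ z w)) :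
    IsIsometricFrame B G Θ y := by
  refine ⟨hG, hΘ, hiso, ?_⟩
  filter_upwards [hG.eventually, hΘ, eventually_eventually_nhds.2 hiso, htor] with z hGz hΘz hi ht
  intro u v w
  have hd : DifferentiableAt ℝ Θ z := hΘz.differentiableAt (by simp)
  -- `⟨∂_u(Θv), Θw⟩` is symmetric in `u, v` by the torsion hypothesis and metric by differentiating
  -- the isometry, so Koszul's formula identifies it.
  have key := hGz.koszul (fun u v w => B (fderiv ℝ Θ z u v) (Θ z w)) ht (fun u v w => by
    have he : (fun z => G z v w) =ᶠ[𝓝 z] fun z => B (Θ z v) (Θ z w) :=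
      hi.mono fun x hx => (hx v w).symm
    rw [← fderiv_apply_const₂ hGz.differentiableAt, he.fderiv_eq,
      fderiv_bilin B (hd.clm_apply (differentiableAt_const v))
        (hd.clm_apply (differentiableAt_const w)), fderiv_apply_const hd, fderiv_apply_const hd,
      hB (Θ z v)]) u v w
  rw [frameForm, map_sub, sub_apply, hi.self_of_nhds, key, sub_self]

/-- The Gauss equation. -/
lemma IsIsometricFrame.gauss (h : IsIsometricFrame B G Θ y)
    (u v w z : E n) :
    G y (curvature G y u v w) z =
      B (frameForm G Θ y v w) (frameForm G Θ y u z)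
        - B (frameForm G Θ y u w) (frameForm G Θ y v z) := by
  have hs := h.smooth.self_of_nhds
  have hd : DifferentiableAt ℝ Θ y := hs.differentiableAt (by simp)
  have hΓ : ∀ v w, DifferentiableAt ℝ (fun x => christoffel G x v w) y := fun v w =>
    (h.metric.contDiffAt_christoffel v w).differentiableAt (by simp)
  have hdd := differentiableAt_fderiv hs
  have hII : ∀ v w, DifferentiableAt ℝ (fun x => frameForm G Θ x v w) y := fun v w =>
    ((hdd.clm_apply (differentiableAt_const v)).clm_apply (differentiableAt_const w)).sub
      (hd.clm_apply (hΓ v w))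
  -- the derivative of the form, paired with a tangent vector
  have h1 : ∀ u v w, B (fderiv ℝ (fun x => frameForm G Θ x v w) y u) (Θ y z)
      = - B (frameForm G Θ y v w) (frameForm G Θ y u z) := by
    intro u v w
    have he : (fun x => B (frameForm G Θ x v w) (Θ x z)) =ᶠ[𝓝 y] fun _ => 0 :=
      h.perp.mono fun x hx => hx v w z
    have h2 := fderiv_bilin B (hII v w) (hd.clm_apply (differentiableAt_const z)) u
    rw [he.fderiv_eq, fderiv_apply_const hd] at h2
    have h3 : fderiv ℝ Θ y u z = frameForm G Θ y u z + Θ y (christoffel G y u z) := by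
      simp [frameForm]
    rw [h3, map_add, h.perp.self_of_nhds] at h2
    simp at h2
    linarith
  have h4 : ∀ u v w, fderiv ℝ (fun x => frameForm G Θ x v w) y u
      = fderiv ℝ (fderiv ℝ Θ) y u v w - frameForm G Θ y u (christoffel G y v w)
        - Θ y (christoffel G y u (christoffel G y v w))
        - Θ y (fderiv ℝ (fun x => christoffel G x v w) y u) := by
    intro u v w
    have h5 := fderiv_fun_sub
      ((hdd.clm_apply (differentiableAt_const v)).clm_apply (differentiableAt_const w))
      (hd.clm_apply (hΓ v w))
    have h6 := congrArg (fun l : E n →L[ℝ] V => l u) h5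
    simp only [sub_apply] at h6
    rw [fderiv_apply_const₂ hdd, fderiv_clm hd (hΓ v w)] at h6
    rw [show (fun x => frameForm G Θ x v w) =
      fun x => fderiv ℝ Θ x v w - Θ x (christoffel G x v w) from rfl, h6]
    simp only [frameForm]
    abel
  have h7 := h1 u v w
  have h8 := h1 v u w
  rw [h4] at h7 h8
  -- Flatness of the trivial bundle: the second derivatives of `Θ` cancel in the difference of `h7`
  -- and `h8`, and the remaining tangential terms assemble into the curvature.
  have h9 : fderiv ℝ (fderiv ℝ Θ) y u v w = fderiv ℝ (fderiv ℝ Θ) y v u w := by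
    rw [fderiv_fderiv_comm hs]
  rw [h9] at h7
  simp only [map_sub, sub_apply, h.perp.self_of_nhds, h.isom.self_of_nhds] at h7 h8
  simp only [curvature, map_sub, map_add, sub_apply, add_apply]
  linarith

/-- The gradient of a `1`-form in terms of the image of its dual vector field. -/
lemma IsIsometricFrame.covDeriv_eq (h : IsIsometricFrame B G Θ y) {η : E n → E n →L[ℝ] ℝ}
    {T : E n → E n} (hT : ∀ᶠ z in 𝓝 y, ContDiffAt ℝ ∞ T z)
    (hηT : ∀ᶠ z in 𝓝 y, ∀ w, η z w = G z (T z) w) (hη : ∀ᶠ z in 𝓝 y, DifferentiableAt ℝ η z)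
    (hB : ∀ x x', B x x' = B x' x) :
    ∀ᶠ z in 𝓝 y, ∀ u v, covDerivOneForm G η z u v =
      B (fderiv ℝ (fun x => Θ x (T x)) z u) (Θ z v) := by
  filter_upwards [hT, eventually_eventually_nhds.2 hηT, hη, h.smooth,
    eventually_eventually_nhds.2 h.isom, h.perp] with z hTz hz hηz hs hi hp
  intro u v
  have hd : DifferentiableAt ℝ Θ z := hs.differentiableAt (by simp)
  have hTd : DifferentiableAt ℝ T z := hTz.differentiableAt (by simp)
  have he : (fun x => η x v) =ᶠ[𝓝 z] fun x => B (Θ x (T x)) (Θ x v) := by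
    filter_upwards [hz, hi] with x h1 h2
    rw [h1, h2]
  rw [covDerivOneForm, ← fderiv_apply_const hηz, he.fderiv_eq,
    fderiv_bilin B (hd.clm_apply hTd) (hd.clm_apply (differentiableAt_const v)),
    fderiv_apply_const hd, hz.self_of_nhds, ← hi.self_of_nhds]
  have h3 : fderiv ℝ Θ z u v = frameForm G Θ z u v + Θ z (christoffel G z u v) := by
    simp [frameForm]
  rw [h3, map_add, hB _ (frameForm G Θ z u v), hp]
  ring

/-- For a harmonic `1`-form with dual field `T` and an isometric frame with trace-free second
fundamental form, the tangential part of the Laplacian of `ΘT`. -/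
lemma IsIsometricFrame.laplacian_of_harmonic (hB : ∀ x x', B x x' = B x' x)
    (h : IsIsometricFrame B G Θ y) {η : E n → E n →L[ℝ] ℝ}
    {T : E n → E n} (hT : ∀ᶠ z in 𝓝 y, ContDiffAt ℝ ∞ T z)
    (hηT : ∀ᶠ z in 𝓝 y, ∀ w, η z w = G z (T z) w) (hη : ∀ᶠ z in 𝓝 y, ContDiffAt ℝ ∞ η z)
    {e : Module.Basis (Fin n) ℝ (E n)} (he : IsOrthonormalFor (G y) e)
    (htr : ∑ a, frameForm G Θ y (e a) (e a) = 0)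
    (w : E n) (hharm : hodgeLaplacianOneForm G η y w = 0) :
    ∑ a, B (hess G (fun x => Θ x (T x)) y (e a) (e a)) (Θ y w) =
      - ∑ a, (B (frameForm G Θ y (e a) (T y)) (frameForm G Θ y w (e a))
        + B (frameForm G Θ y (e a) (T y)) (frameForm G Θ y (e a) w)) := by
  set τ : E n → V := fun x => Θ x (T x) with hτ
  have hb := h.metric.isInner
  have hs := h.smooth.self_of_nhds
  have hd : DifferentiableAt ℝ Θ y := hs.differentiableAt (by simp)
  have hTd : DifferentiableAt ℝ T y := hT.self_of_nhds.differentiableAt (by simp)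
  have hτs : ContDiffAt ℝ ∞ τ y := hs.clm_apply hT.self_of_nhds
  have hτdd := differentiableAt_fderiv hτs
  have hC := h.covDeriv_eq hT hηT (hη.mono fun z hz => hz.differentiableAt (by simp)) hB
  -- By `hC` this is `(∇_u η)(v)` near `y`, written through the flat derivative of `τ = ΘT`.
  let D : E n → E n → E n → ℝ := fun z u v => B (fderiv ℝ τ z u) (Θ z v)
  have hDd : ∀ u v, DifferentiableAt ℝ (fun z => D z u v) y := fun u v =>
    (B.differentiableAt.comp y (hτdd.clm_apply (differentiableAt_const u))).clm_apply
      (hd.clm_apply (differentiableAt_const v))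
  have hDb : ∀ z, IsBilin (D z) := fun z => by
    constructor
    · intro u u' v; simp only [D, map_add, add_apply]
    · intro a u v; simp only [D, map_smul, smul_apply]
    · intro u u' v; simp only [D, map_add]
    · intro a u v; simp only [D, map_smul]
  -- the covariant derivative of `D`
  have hnabla : ∀ w u v, fderiv ℝ (fun z => D z u v) y w - D y (christoffel G y w u) v
      - D y u (christoffel G y w v) =
      B (hess G τ y w u) (Θ y v) + B (frameForm G Θ y u (T y)) (frameForm G Θ y w v) := by
    intro w u v
    have h1 : fderiv ℝ (fun z => D z u v) y w = _ :=
      fderiv_bilin B (hτdd.clm_apply (differentiableAt_const u))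
        (hd.clm_apply (differentiableAt_const v)) w
    have h2 : fderiv ℝ τ y u = frameForm G Θ y u (T y)
        + Θ y (christoffel G y u (T y) + fderiv ℝ T y u) := by
      rw [hτ, fderiv_clm hd hTd, map_add, frameForm]
      abel
    have h3 : B (fderiv ℝ τ y u) (frameForm G Θ y w v) =
        B (frameForm G Θ y u (T y)) (frameForm G Θ y w v) := by
      rw [h2, map_add, add_apply, hB (Θ y _), h.perp.self_of_nhds, add_zero]
    rw [← h3, h1, fderiv_apply_const hτdd, fderiv_apply_const hd]
    simp only [D, hess, frameForm, map_sub, sub_apply]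
    ring
  have hnb : IsBilin fun u v => fderiv ℝ (fun z => D z u v) y w - D y (christoffel G y w u) v
      - D y u (christoffel G y w v) := by
    have h1 := isBilin_hess hb τ
    have h2 := isBilin_frameForm (Θ := Θ) hb
    simp only [hnabla]
    constructor
    · intro u u' v; simp only [map_add, add_apply, h1.add_right, h2.add_left]; ring
    · intro a u v; simp only [map_smul, smul_apply, h1.smul_right, h2.smul_left, smul_eq_mul]; ring
    · intro u u' v; simp only [map_add, h2.add_right]; ring
    · intro a u v; simp only [map_smul, h2.smul_right, smul_eq_mul]; ring
  have h1 : fderiv ℝ (codiffOneForm G η) y w = - ∑ a, (B (hess G τ y w (e a)) (Θ y (e a))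
      + B (frameForm G Θ y (e a) (T y)) (frameForm G Θ y w (e a))) := by
    have hev : codiffOneForm G η =ᶠ[𝓝 y] fun z => - metricTrace (G z) (D z) := by
      filter_upwards [hC] with z hz
      rw [codiffOneForm]
      congr 2
      funext u v
      exact hz u v
    rw [hev.fderiv_eq, fderiv_fun_neg, neg_apply,
      h.metric.fderiv_metricTrace hDd (hDb y), metricTrace_eq he hnb]
    simp only [hnabla]
  -- `dη` is the antisymmetrisation of `∇η`, the connection being torsion-free.
  have hext : ∀ u v, (fun z => extDerivOneForm η z u v) =ᶠ[𝓝 y] fun z => D z u v - D z v u := by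
    intro u v
    filter_upwards [hC, h.metric.eventually] with z hz hGz
    have e1 := hz u v
    have e2 := hz v u
    rw [covDerivOneForm] at e1 e2
    rw [hGz.christoffel_symm v u] at e2
    simp only [extDerivOneForm, D]
    linarith
  have hcov : ∀ u v, covDerivTwoForm G (extDerivOneForm η) y u v w =
      (B (hess G τ y u v) (Θ y w) + B (frameForm G Θ y v (T y)) (frameForm G Θ y u w))
      - (B (hess G τ y u w) (Θ y v) + B (frameForm G Θ y w (T y)) (frameForm G Θ y u v)) := by
    intro u v
    rw [covDerivTwoForm, (hext v w).fderiv_eq, fderiv_fun_sub (hDd _ _) (hDd _ _), sub_apply,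
      ← hnabla, ← hnabla]
    have e1 : extDerivOneForm η y (christoffel G y u v) w = _ := (hext _ _).self_of_nhds
    have e2 : extDerivOneForm η y v (christoffel G y u w) = _ := (hext _ _).self_of_nhds
    rw [e1, e2]
    ring
  have hnb2 : IsBilin fun u v => covDerivTwoForm G (extDerivOneForm η) y u v w := by
    have h1 := isBilin_hess hb τ
    have h2 := isBilin_frameForm (Θ := Θ) hb
    simp only [hcov]
    constructor
    · intro u u' v; simp only [map_add, add_apply, h1.add_left, h2.add_left]; ring
    · intro a u v; simp only [map_smul, smul_apply, h1.smul_left, h2.smul_left, smul_eq_mul]; ring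
    · intro u u' v; simp only [map_add, add_apply, h1.add_right, h2.add_right, h2.add_left]; ring
    · intro a u v
      simp only [map_smul, smul_apply, h1.smul_right, h2.smul_right, h2.smul_left, smul_eq_mul]
      ring
  have h2 : codiffTwoForm G (extDerivOneForm η) y w = - ∑ a,
      ((B (hess G τ y (e a) (e a)) (Θ y w)
        + B (frameForm G Θ y (e a) (T y)) (frameForm G Θ y (e a) w))
      - (B (hess G τ y (e a) w) (Θ y (e a))
        + B (frameForm G Θ y w (T y)) (frameForm G Θ y (e a) (e a)))) := by
    rw [codiffTwoForm, metricTrace_eq he hnb2]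
    simp only [hcov]
  -- The only place where the vanishing trace of the second fundamental form is used.
  have h3 : ∑ a, B (frameForm G Θ y w (T y)) (frameForm G Θ y (e a) (e a)) = 0 := by
    rw [← map_sum, htr, map_zero]
  rw [hodgeLaplacianOneForm, h1, h2] at hharm
  -- The terms `⟨Hess τ(w, e_a), Θe_a⟩` from `dδ` and `⟨Hess τ(e_a, w), Θe_a⟩` from `δd` cancel by
  -- symmetry of the Hessian. No separate Ricci term arises, since `τ` has values in a flat bundle.
  simp only [hess_symm h.metric hτs w] at hharm
  simp only [Finset.sum_add_distrib, Finset.sum_sub_distrib, h3] at hharm ⊢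
  linarith

end Frames

end TraceFormula
end

noncomputable section

namespace TraceFormula

/-! ### The trace identity in coordinates -/

section LocalTrace

variable {n : ℕ} {V : Type*} [NormedAddCommGroup V] [NormedSpace ℝ V]
  {B : V →L[ℝ] V →L[ℝ] ℝ} {G : E n → E n →L[ℝ] E n →L[ℝ] ℝ} {Θ : E n → E n →L[ℝ] V}
  {y : E n}

lemma laplacian_eq_sum_hess (hb : IsInner (G y)) {e : Module.Basis (Fin n) ℝ (E n)}
    (he : IsOrthonormalFor (G y) e) (φ : E n → ℝ) :
    laplacian G φ y = ∑ a, hess G φ y (e a) (e a) :=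
  metricTrace_eq he (isBilin_hess hb φ)

/-- The second-order Leibniz rule. Smoothness is asked near `y` because the first-order rule is
itself differentiated. -/
lemma hess_bilin {V' F : Type*} [NormedAddCommGroup V'] [NormedSpace ℝ V'] [NormedAddCommGroup F]
    [NormedSpace ℝ F] (κ : V →L[ℝ] V' →L[ℝ] F) {a : E n → V} {c : E n → V'}
    (ha : ∀ᶠ z in 𝓝 y, ContDiffAt ℝ ∞ a z) (hc : ∀ᶠ z in 𝓝 y, ContDiffAt ℝ ∞ c z) (u v : E n) :
    hess G (fun z => κ (a z) (c z)) y u v =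
      κ (hess G a y u v) (c y) + κ (fderiv ℝ a y u) (fderiv ℝ c y v)
        + κ (fderiv ℝ a y v) (fderiv ℝ c y u) + κ (a y) (hess G c y u v) := by
  have had : ∀ᶠ z in 𝓝 y, DifferentiableAt ℝ a z := ha.mono fun z h => h.differentiableAt (by simp)
  have hcd : ∀ᶠ z in 𝓝 y, DifferentiableAt ℝ c z := hc.mono fun z h => h.differentiableAt (by simp)
  have hadd := differentiableAt_fderiv ha.self_of_nhds
  have hcdd := differentiableAt_fderiv hc.self_of_nhds
  have hfd : ∀ w, fderiv ℝ (fun z => κ (a z) (c z)) y w = _ :=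
    fderiv_bilin κ had.self_of_nhds hcd.self_of_nhds
  have hsm : ContDiffAt ℝ ∞ (fun z => κ (a z) (c z)) y :=
    (contDiffAt_const.clm_apply ha.self_of_nhds).clm_apply hc.self_of_nhds
  have hev : (fun z => fderiv ℝ (fun z => κ (a z) (c z)) z v) =ᶠ[𝓝 y]
      fun z => κ (fderiv ℝ a z v) (c z) + κ (a z) (fderiv ℝ c z v) := by
    filter_upwards [had, hcd] with z h1 h2
    exact fderiv_bilin κ h1 h2 v
  have hav := hadd.clm_apply (differentiableAt_const v)
  have hcv := hcdd.clm_apply (differentiableAt_const v)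
  have hD : ∀ {p : E n → V} {q : E n → V'}, DifferentiableAt ℝ p y → DifferentiableAt ℝ q y →
      DifferentiableAt ℝ (fun z => κ (p z) (q z)) y := fun hp hq =>
    (κ.differentiableAt.comp y hp).clm_apply hq
  rw [hess, ← fderiv_apply_const (differentiableAt_fderiv hsm), hev.fderiv_eq, hfd,
    fderiv_fun_add (hD hav hcd.self_of_nhds) (hD had.self_of_nhds hcv), add_apply,
    fderiv_bilin κ hav hcd.self_of_nhds, fderiv_bilin κ had.self_of_nhds hcv,
    fderiv_apply_const hadd, fderiv_apply_const hcdd]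
  simp only [hess, map_sub, sub_apply]
  abel

/-- A unit normal field of an isometric frame. -/
structure IsNormalFrame (B : V →L[ℝ] V →L[ℝ] ℝ) (Θ : E n → E n →L[ℝ] V) (N : E n → V) (y : E n) :
    Prop where
  smooth : ∀ᶠ z in 𝓝 y, ContDiffAt ℝ ∞ N z
  unit : ∀ᶠ z in 𝓝 y, B (N z) (N z) = 1
  perp : ∀ᶠ z in 𝓝 y, ∀ w, B (N z) (Θ z w) = 0

variable {N : E n → V}

/-- First derivative of `|N|² = 1`; the next lemma takes the second one. -/
lemma IsNormalFrame.fderiv_perp_self (hB : ∀ x x', B x x' = B x' x) (hN : IsNormalFrame B Θ N y) :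
    ∀ᶠ z in 𝓝 y, ∀ w, B (N z) (fderiv ℝ N z w) = 0 := by
  filter_upwards [hN.smooth, eventually_eventually_nhds.2 hN.unit] with z hs hu w
  have hd : DifferentiableAt ℝ N z := hs.differentiableAt (by simp)
  have he : (fun x => B (N x) (N x)) =ᶠ[𝓝 z] fun _ => 1 := hu
  have := fderiv_bilin B hd hd w
  rw [he.fderiv_eq, hB (fderiv ℝ N z w)] at this
  simp at this
  linarith

lemma IsNormalFrame.hess_perp (hB : ∀ x x', B x x' = B x' x) (hN : IsNormalFrame B Θ N y)
    (u : E n) : B (N y) (hess G N y u u) = - B (fderiv ℝ N y u) (fderiv ℝ N y u) := by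
  have he : (fun x => B (N x) (N x)) =ᶠ[𝓝 y] fun _ => 1 := hN.unit
  have h1 := hess_bilin (G := G) B hN.smooth hN.smooth u u
  have h2 : hess G (fun x => B (N x) (N x)) y u u = 0 := by
    rw [hess, he.fderiv_eq, (he.fderiv).fderiv_eq]
    simp
  rw [h2, hB (hess G N y u u)] at h1
  linarith

/-- The Weingarten relation: differentiate `⟨N, Θv⟩ = 0`. -/
lemma IsNormalFrame.inner_fderiv (hΘ : DifferentiableAt ℝ Θ y) (hN : IsNormalFrame B Θ N y)
    (u v : E n) : B (fderiv ℝ N y u) (Θ y v) = - B (N y) (frameForm G Θ y u v) := by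
  have hd : DifferentiableAt ℝ N y := hN.smooth.self_of_nhds.differentiableAt (by simp)
  have he : (fun x => B (N x) (Θ x v)) =ᶠ[𝓝 y] fun _ => 0 := hN.perp.mono fun z hz => hz v
  have := fderiv_bilin B hd (hΘ.clm_apply (differentiableAt_const v)) u
  rw [he.fderiv_eq, fderiv_apply_const hΘ] at this
  rw [frameForm, map_sub, hN.perp.self_of_nhds]
  simp at this ⊢
  linarith

/-- The trace identity in local coordinates. -/
lemma local_trace_identity (hB : ∀ x x', B x x' = B x' x)
    (h : IsIsometricFrame B G Θ y) (hN : IsNormalFrame B Θ N y) {η : E n → E n →L[ℝ] ℝ}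
    {T : E n → E n} (hT : ∀ᶠ z in 𝓝 y, ContDiffAt ℝ ∞ T z)
    (hηT : ∀ᶠ z in 𝓝 y, ∀ w, η z w = G z (T z) w) (hη : ∀ᶠ z in 𝓝 y, ContDiffAt ℝ ∞ η z)
    (hharm : ∀ w, hodgeLaplacianOneForm G η y w = 0)
    {e : Module.Basis (Fin n) ℝ (E n)} (he : IsOrthonormalFor (G y) e)
    {A : E n → E n → ℝ} {ρ : E n → E n → V}
    (hII : ∀ u v, frameForm G Θ y u v = A u v • N y + ρ u v)
    (hA : ∀ u v, A u v = A v u) (hρ : ∀ u v, ρ u v = - ρ v u) (hρN : ∀ u v, B (ρ u v) (N y) = 0)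
    (htr : ∑ a, A (e a) (e a) = 0)
    {ι : Type*} [Fintype ι] (κ : ι → V →L[ℝ] V →L[ℝ] ℝ)
    (hκ : ∀ x x' z z', ∑ i, κ i x x' * κ i z z' = B x z * B x' z' - B x z' * B x' z) :
    ∑ i, (laplacian G (fun z => κ i (N z) (Θ z (T z))) y
      + (∑ a, B (fderiv ℝ N y (e a)) (fderiv ℝ N y (e a))) * κ i (N y) (Θ y (T y)))
        * κ i (N y) (Θ y (T y)) = 0 := by
  set τ : E n → V := fun x => Θ x (T x) with hτ
  have hb := h.metric.isInner
  have hd : DifferentiableAt ℝ Θ y := h.smooth.self_of_nhds.differentiableAt (by simp)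
  have hTd : DifferentiableAt ℝ T y := hT.self_of_nhds.differentiableAt (by simp)
  have hτs : ∀ᶠ z in 𝓝 y, ContDiffAt ℝ ∞ τ z := by
    filter_upwards [h.smooth, hT] with z h1 h2 using h1.clm_apply h2
  have hunit := hN.unit.self_of_nhds
  have hρ0 : ∀ u, ρ u u = 0 := fun u => by
    have := hρ u u
    rwa [eq_neg_iff_add_eq_zero, ← two_smul ℝ, smul_eq_zero_iff_right two_ne_zero] at this
  have htr' : ∑ a, frameForm G Θ y (e a) (e a) = 0 := by
    simp only [hII, hρ0, add_zero]
    rw [← Finset.sum_smul, htr, zero_smul]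
  have hNII : ∀ u v, B (N y) (frameForm G Θ y u v) = A u v := fun u v => by
    rw [hII, map_add, map_smul, hunit, hB (N y) (ρ u v), hρN]; simp
  have h1 := h.laplacian_of_harmonic hB hT hηT hη he htr' (T y) (hharm _)
  have h2 : ∀ u v w z, B (frameForm G Θ y u v) (frameForm G Θ y w z) =
      A u v * A w z + B (ρ u v) (ρ w z) := fun u v w z => by
    rw [hII u v, map_add, add_apply, map_smul, smul_apply, hNII, hII w z, map_add, map_smul, hρN]
    simp
  -- The two products of second fundamental forms differ by a swap of arguments: the symmetric part
  -- `A` doubles, while the skew part `ρ` cancels.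
  have h3 : ∑ a, B (hess G τ y (e a) (e a)) (τ y) = - (2 * ∑ a, A (e a) (T y) ^ 2) := by
    rw [h1, Finset.mul_sum]
    congr 1
    refine Finset.sum_congr rfl fun a _ => ?_
    rw [h2, h2, hA (T y), hρ (T y) (e a), map_neg]
    ring
  have hNτ : B (N y) (τ y) = 0 := hN.perp.self_of_nhds _
  have hτN : B (τ y) (N y) = 0 := by rw [hB]; exact hNτ
  have hτdN : ∀ u, B (τ y) (fderiv ℝ N y u) = - A u (T y) := fun u => by
    rw [hB, hτ, hN.inner_fderiv (G := G) hd, hNII]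
  have hNdτ : ∀ u, B (N y) (fderiv ℝ τ y u) = A u (T y) := fun u => by
    have h4 : fderiv ℝ τ y u = frameForm G Θ y u (T y)
        + Θ y (christoffel G y u (T y) + fderiv ℝ T y u) := by
      rw [hτ, fderiv_clm hd hTd, map_add, frameForm]
      abel
    rw [h4, map_add, hN.perp.self_of_nhds, hNII, add_zero]
  have hNdN : ∀ u, B (N y) (fderiv ℝ N y u) = 0 := (hN.fderiv_perp_self hB).self_of_nhds
  -- Leibniz for `N ∧ τ`, with each sum over `i` evaluated as a 2 × 2 determinant. In the cross term
  -- `⟨N, ∂N⟩ = 0`, and `-⟨N, ∂τ⟩⟨τ, ∂N⟩` is `A(e_a, T)²`.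
  have key : ∀ a, ∑ i, hess G (fun z => κ i (N z) (τ z)) y (e a) (e a) * κ i (N y) (τ y) =
      - B (fderiv ℝ N y (e a)) (fderiv ℝ N y (e a)) * B (τ y) (τ y) + 2 * A (e a) (T y) ^ 2
        + B (hess G τ y (e a) (e a)) (τ y) := by
    intro a
    have h5 : ∀ i, hess G (fun z => κ i (N z) (τ z)) y (e a) (e a) * κ i (N y) (τ y) =
        κ i (N y) (τ y) * κ i (hess G N y (e a) (e a)) (τ y)
        + 2 * (κ i (N y) (τ y) * κ i (fderiv ℝ N y (e a)) (fderiv ℝ τ y (e a)))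
        + κ i (N y) (τ y) * κ i (N y) (hess G τ y (e a) (e a)) := fun i => by
      rw [hess_bilin (κ i) hN.smooth hτs]; ring
    simp only [h5, Finset.sum_add_distrib, ← Finset.mul_sum, hκ]
    rw [hN.hess_perp hB, hNτ, hτN, hNdN, hNdτ, hτdN, hunit, hB (τ y) (hess G τ y _ _)]
    ring
  have hsq : ∑ i, κ i (N y) (τ y) * κ i (N y) (τ y) = B (τ y) (τ y) := by
    rw [hκ, hunit, hNτ]; ring
  -- After summation over `a`, the cross term `2 ∑ A(e_a, T)²` is cancelled by `h3`.
  have hsum : ∑ i, laplacian G (fun z => κ i (N z) (τ z)) y * κ i (N y) (τ y) =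
      - (∑ a, B (fderiv ℝ N y (e a)) (fderiv ℝ N y (e a))) * B (τ y) (τ y) := by
    simp only [laplacian_eq_sum_hess hb he, Finset.sum_mul]
    rw [Finset.sum_comm, Finset.sum_congr rfl fun a _ => key a]
    simp only [Finset.sum_add_distrib, h3, ← Finset.mul_sum, ← Finset.sum_mul,
      Finset.sum_neg_distrib]
    ring
  change ∑ i, (laplacian G (fun z => κ i (N z) (τ z)) y + _ * κ i (N y) (τ y)) * κ i (N y) (τ y) = 0
  simp only [add_mul, Finset.sum_add_distrib, mul_assoc, ← Finset.mul_sum]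
  rw [hsum, hsq]
  ring

end LocalTrace

end TraceFormula
end

noncomputable section

namespace TraceFormula

/-! ### Pulling frames back along isometric immersions -/

section Pullback

variable {m n : ℕ} {V : Type*} [NormedAddCommGroup V] [NormedSpace ℝ V]
  {B : V →L[ℝ] V →L[ℝ] ℝ} {G : E m → E m →L[ℝ] E m →L[ℝ] ℝ} {G' : E n → E n →L[ℝ] E n →L[ℝ] ℝ}
  {Θ : E n → E n →L[ℝ] V} {f : E m → E n} {y : E m}

/-- `f` is an isometric immersion near `y`. -/
structure IsLocalIsometry (G : E m → E m →L[ℝ] E m →L[ℝ] ℝ) (G' : E n → E n →L[ℝ] E n →L[ℝ] ℝ)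
    (f : E m → E n) (y : E m) : Prop where
  smooth : ∀ᶠ z in 𝓝 y, ContDiffAt ℝ ∞ f z
  isom : ∀ᶠ z in 𝓝 y, ∀ u v, G' (f z) (fderiv ℝ f z u) (fderiv ℝ f z v) = G z u v

/-- The second derivative `D²f(u, v) + Γ'(Df u, Df v)` of a map into a Riemannian manifold. -/
def covSecondDeriv (G' : E n → E n →L[ℝ] E n →L[ℝ] ℝ) (f : E m → E n) (y u v : E m) : E n :=
  fderiv ℝ (fderiv ℝ f) y u v + christoffel G' (f y) (fderiv ℝ f y u) (fderiv ℝ f y v)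

/-- The bundle map obtained from `Θ` by composition with the derivative of `f`. -/
def pullFrame (Θ : E n → E n →L[ℝ] V) (f : E m → E n) (z : E m) : E m →L[ℝ] V :=
  (Θ (f z)).comp (fderiv ℝ f z)

lemma pullFrame_apply (z w : E m) : pullFrame Θ f z w = Θ (f z) (fderiv ℝ f z w) := rfl

/-- The chain rule, with the Christoffel term of `G'` added and subtracted; hence no condition on
`G'` is needed. -/
lemma fderiv_pullFrame {z : E m} (hf : ContDiffAt ℝ ∞ f z) (hΘ : ContDiffAt ℝ ∞ Θ (f z))
    (u v : E m) :
    fderiv ℝ (pullFrame Θ f) z u v = frameForm G' Θ (f z) (fderiv ℝ f z u) (fderiv ℝ f z v)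
      + Θ (f z) (covSecondDeriv G' f z u v) := by
  have hfd : DifferentiableAt ℝ f z := hf.differentiableAt (by simp)
  have hfdd := differentiableAt_fderiv hf
  have hΘd : DifferentiableAt ℝ Θ (f z) := hΘ.differentiableAt (by simp)
  have h1 : DifferentiableAt ℝ (pullFrame Θ f) z := (hΘd.comp z hfd).clm_comp hfdd
  rw [← fderiv_apply_const h1]
  have h2 : (fun x => pullFrame Θ f x v) = fun x => (Θ ∘ f) x (fderiv ℝ f x v) := rfl
  rw [h2, fderiv_clm (hΘd.comp z hfd) (hfdd.clm_apply (differentiableAt_const v)),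
    fderiv_apply_const hfdd, fderiv_comp z hΘd hfd]
  simp only [frameForm, covSecondDeriv, map_add, Function.comp_apply,
    ContinuousLinearMap.comp_apply]
  abel

/-- An isometric frame pulls back to an isometric frame under an isometric immersion. -/
lemma IsIsometricFrame.pullback (hB : ∀ x x', B x x' = B x' x)
    (h : IsIsometricFrame B G' Θ (f y)) (hf : IsLocalIsometry G G' f y) (hG : IsMetricNear G y) :
    IsIsometricFrame B G (pullFrame Θ f) y := by
  have hc : ContinuousAt f y := hf.smooth.self_of_nhds.continuousAt
  have hs := hc.eventually h.smooth
  have hi := hc.eventually h.isom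
  have hp := hc.eventually h.perp
  have hm := hc.eventually h.metric.eventually
  -- For the torsion condition, the frame form of `Θ` is orthogonal to the image, and the second
  -- derivative of `f` is symmetric.
  refine IsIsometricFrame.of_torsion hB hG ?_ ?_ ?_
  · filter_upwards [hf.smooth, hs] with z h1 h2
    exact (h2.comp z h1).clm_comp (h1.fderiv_right (by simp))
  · filter_upwards [hi, hf.isom] with z h1 h2 u v
    rw [pullFrame_apply, pullFrame_apply, h1, h2]
  · filter_upwards [hf.smooth, hs, hp, hm] with z h1 h2 h3 h4 u v w
    rw [fderiv_pullFrame (G' := G') h1 h2, fderiv_pullFrame (G' := G') h1 h2, pullFrame_apply]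
    simp only [map_add, add_apply, h3, covSecondDeriv]
    rw [fderiv_fderiv_comm h1, h4.christoffel_symm]

lemma frameForm_pullFrame (hf : ContDiffAt ℝ ∞ f y) (hΘ : ContDiffAt ℝ ∞ Θ (f y)) (u v : E m) :
    frameForm G (pullFrame Θ f) y u v = frameForm G' Θ (f y) (fderiv ℝ f y u) (fderiv ℝ f y v)
      + Θ (f y) (covSecondDeriv G' f y u v - fderiv ℝ f y (christoffel G y u v)) := by
  rw [frameForm, fderiv_pullFrame (G' := G') hf hΘ, map_sub, pullFrame_apply]
  abel

/-- The Gauss formula: the tangential part of the second derivative. -/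
lemma IsIsometricFrame.gauss_formula (hB : ∀ x x', B x x' = B x' x)
    (h : IsIsometricFrame B G' Θ (f y)) (hf : IsLocalIsometry G G' f y) (hG : IsMetricNear G y)
    (u v w : E m) :
    G' (f y) (covSecondDeriv G' f y u v - fderiv ℝ f y (christoffel G y u v)) (fderiv ℝ f y w)
      = 0 := by
  have h1 := (h.pullback hB hf hG).perp.self_of_nhds u v w
  rw [frameForm_pullFrame (G' := G') hf.smooth.self_of_nhds h.smooth.self_of_nhds, pullFrame_apply, map_add,
    add_apply, h.perp.self_of_nhds, h.isom.self_of_nhds, zero_add] at h1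
  exact h1

/-- The frame form of a totally geodesic immersion. -/
lemma IsIsometricFrame.frameForm_of_totallyGeodesic (hB : ∀ x x', B x x' = B x' x)
    (h : IsIsometricFrame B G' Θ (f y)) (hf : IsLocalIsometry G G' f y) (hG : IsMetricNear G y)
    (htg : ∀ ξ, (∀ w, G' (f y) ξ (fderiv ℝ f y w) = 0) →
      ∀ u v, G' (f y) (covSecondDeriv G' f y u v) ξ = 0) (u v : E m) :
    frameForm G (pullFrame Θ f) y u v =
      frameForm G' Θ (f y) (fderiv ℝ f y u) (fderiv ℝ f y v) := by
  have hb := h.metric.isInner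
  have h1 := h.gauss_formula hB hf hG u v
  set k := covSecondDeriv G' f y u v - fderiv ℝ f y (christoffel G y u v) with hk
  -- `k` is normal by the Gauss formula, so it can serve as its own test vector; the outcome is `⟨k,
  -- k⟩ = 0`.
  have h2 := htg k h1 u v
  have h3 : k = 0 := by
    apply hb.eq_zero
    have h4 : G' (f y) k k = G' (f y) k (covSecondDeriv G' f y u v)
        - G' (f y) k (fderiv ℝ f y (christoffel G y u v)) := by rw [← map_sub]
    rw [h4, hb.symm k, h2, h1, sub_self]
  rw [frameForm_pullFrame (G' := G') hf.smooth.self_of_nhds h.smooth.self_of_nhds, ← hk, h3,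
    map_zero, add_zero]

end Pullback

/-! ### Hypersurfaces and the energy of the unit normal -/

section Hypersurface

variable {m : ℕ} {V : Type*} [NormedAddCommGroup V] [NormedSpace ℝ V]
  {B : V →L[ℝ] V →L[ℝ] ℝ} {G : E m → E m →L[ℝ] E m →L[ℝ] ℝ}
  {G' : E (m + 1) → E (m + 1) →L[ℝ] E (m + 1) →L[ℝ] ℝ}
  {Θ : E (m + 1) → E (m + 1) →L[ℝ] V} {f ν : E m → E (m + 1)} {y : E m}

/-- `ν` is a smooth unit normal field of the hypersurface `f` near `y`. -/
structure IsLocalNormal (G' : E (m + 1) → E (m + 1) →L[ℝ] E (m + 1) →L[ℝ] ℝ)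
    (f ν : E m → E (m + 1)) (y : E m) : Prop where
  smooth : ∀ᶠ z in 𝓝 y, ContDiffAt ℝ ∞ ν z
  unit : ∀ᶠ z in 𝓝 y, G' (f z) (ν z) (ν z) = 1
  perp : ∀ᶠ z in 𝓝 y, ∀ w, G' (f z) (ν z) (fderiv ℝ f z w) = 0

lemma IsIsometricFrame.isNormalFrame (h : IsIsometricFrame B G' Θ (f y))
    (hf : IsLocalIsometry G G' f y) (hν : IsLocalNormal G' f ν y) :
    IsNormalFrame B (pullFrame Θ f) (fun z => Θ (f z) (ν z)) y := by
  have hc : ContinuousAt f y := hf.smooth.self_of_nhds.continuousAt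
  have hs := hc.eventually h.smooth
  have hi := hc.eventually h.isom
  refine ⟨?_, ?_, ?_⟩
  · filter_upwards [hf.smooth, hs, hν.smooth] with z h1 h2 h3
    exact (h2.comp z h1).clm_apply h3
  · filter_upwards [hi, hν.unit] with z h1 h2
    rw [h1, h2]
  · filter_upwards [hi, hν.perp] with z h1 h2 w
    rw [pullFrame_apply, h1, h2]

/-- An orthonormal family of the right size is a basis. -/
lemma exists_basis_of_orthonormal {n : ℕ} {b : E n →L[ℝ] E n →L[ℝ] ℝ} (v : Fin n → E n)
    (hv : ∀ i j, b (v i) (v j) = if i = j then 1 else 0) :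
    ∃ e : Module.Basis (Fin n) ℝ (E n), IsOrthonormalFor b e ∧ ∀ i, e i = v i := by
  have hli : LinearIndependent ℝ v := by
    rw [Fintype.linearIndependent_iff]
    intro g hg i
    have := congrArg (b (v i)) hg
    simpa [hv] using this
  refine ⟨basisOfLinearIndependentOfCardEqFinrank' v hli (by simp), ?_, fun i => by simp⟩
  intro i j
  simpa using hv i j

/-- Codimension one enters here: a tangent orthonormal basis and one unit normal already make `m +
1` orthonormal vectors. -/
lemma exists_adapted_basis {G₁ : E (m + 1) →L[ℝ] E (m + 1) →L[ℝ] ℝ}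
    {G₀ : E m →L[ℝ] E m →L[ℝ] ℝ} (h₁ : IsInner G₁) (D : E m →L[ℝ] E (m + 1))
    (hD : ∀ u v, G₁ (D u) (D v) = G₀ u v)
    {ξ : E (m + 1)} (hξ : G₁ ξ ξ = 1) (hξD : ∀ w, G₁ ξ (D w) = 0)
    {e : Module.Basis (Fin m) ℝ (E m)} (he : IsOrthonormalFor G₀ e) :
    ∃ e' : Module.Basis (Fin (m + 1)) ℝ (E (m + 1)), IsOrthonormalFor G₁ e' ∧ e' 0 = ξ ∧
      ∀ a : Fin m, e' a.succ = D (e a) := by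
  obtain ⟨e', h1, h2⟩ := exists_basis_of_orthonormal (b := G₁)
    (Fin.cons ξ fun a => D (e a) : Fin (m + 1) → E (m + 1)) (by
      intro i j
      refine Fin.cases ?_ (fun i => ?_) i <;> refine Fin.cases ?_ (fun j => ?_) j
      · simpa using hξ
      · simpa [hξD] using (Fin.succ_ne_zero j).symm
      · simp [h₁.symm _ ξ, hξD]
      · simp [hD, he i j])
  exact ⟨e', h1, by simp [h2], fun a => by simp [h2]⟩

/-- The Ricci curvature as a trace over an orthonormal basis. -/
lemma ricci_eq {n : ℕ} {G : E n → E n →L[ℝ] E n →L[ℝ] ℝ} {y : E n} {e : Module.Basis (Fin n) ℝ (E n)}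
    (he : IsOrthonormalFor (G y) e) (hb : IsInner (G y)) (v w : E n)
    (L : E n →ₗ[ℝ] E n) (hL : ∀ u, L u = curvature G y u v w) :
    ricci G y v w = ∑ a, G y (curvature G y (e a) v w) (e a) := by
  -- Both sides are the trace of `L`, computed in the standard basis and in `e`.
  have h1 : LinearMap.trace ℝ (E n) L = ricci G y v w := by
    rw [LinearMap.trace_eq_matrix_trace ℝ (EuclideanSpace.basisFun (Fin n) ℝ).toBasis]
    simp [Matrix.trace, LinearMap.toMatrix_apply, ricci, hL, stdVec]
  rw [← h1, LinearMap.trace_eq_matrix_trace ℝ e]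
  simp only [Matrix.trace, Matrix.diag_apply, LinearMap.toMatrix_apply]
  refine Finset.sum_congr rfl fun a _ => ?_
  rw [hL]
  set x := curvature G y (e a) v w
  conv_rhs => rw [hb.symm, ← e.sum_repr x]
  simp only [map_sum, map_smul, he a]
  simp

/-- Linearity in `u` is read off from the Gauss equation, whose right-hand side is visibly linear.
-/
lemma IsIsometricFrame.exists_curvature_linear {n : ℕ} {G : E n → E n →L[ℝ] E n →L[ℝ] ℝ} {y : E n}
    {Θ : E n → E n →L[ℝ] V} (h : IsIsometricFrame B G Θ y) (v w : E n) :
    ∃ L : E n →ₗ[ℝ] E n, ∀ u, L u = curvature G y u v w := by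
  have hb := h.metric.isInner
  have h2 := isBilin_frameForm (Θ := Θ) hb
  refine ⟨{ toFun := fun u => curvature G y u v w, map_add' := fun a c => ?_,
            map_smul' := fun a c => ?_ }, fun u => rfl⟩
  · refine hb.ext fun z => ?_
    simp only [map_add, add_apply, h.gauss, h2.add_left]; ring
  · refine hb.ext fun z => ?_
    simp only [map_smul, smul_apply, h.gauss, h2.smul_left, RingHom.id_apply, smul_eq_mul]; ring

/-- The frame form of a hypersurface. -/
lemma IsIsometricFrame.frameForm_hypersurface (hB : ∀ x x', B x x' = B x' x)
    (h : IsIsometricFrame B G' Θ (f y)) (hf : IsLocalIsometry G G' f y) (hG : IsMetricNear G y)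
    (hν : IsLocalNormal G' f ν y) (u v : E m) :
    frameForm G (pullFrame Θ f) y u v =
      G' (f y) (covSecondDeriv G' f y u v) (ν y) • Θ (f y) (ν y)
        + frameForm G' Θ (f y) (fderiv ℝ f y u) (fderiv ℝ f y v) := by
  have hb := h.metric.isInner
  have h1 := h.gauss_formula hB hf hG u v
  obtain ⟨e, he⟩ := hG.isInner.exists_orthonormal
  obtain ⟨e', he', h0, hs⟩ := exists_adapted_basis hb (fderiv ℝ f y) hf.isom.self_of_nhds
    hν.unit.self_of_nhds hν.perp.self_of_nhds he
  rw [frameForm_pullFrame (G' := G') hf.smooth.self_of_nhds h.smooth.self_of_nhds, add_comm]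
  congr 1
  rw [← map_smul]
  congr 1
  set k := covSecondDeriv G' f y u v - fderiv ℝ f y (christoffel G y u v) with hk
  -- The tangential coefficients of `k` vanish by the Gauss formula; the coefficient along `ν`
  -- survives.
  rw [he'.repr k, Fin.sum_univ_succ, h0]
  simp only [hs, hb.symm _ k, h1]
  rw [hk, map_sub, sub_apply, hb.symm (fderiv ℝ f y _), hν.perp.self_of_nhds]
  simp

/-- The energy density of the unit normal, as a map to the trivial bundle, is
`Ric(ν, ν) + |A|²`. -/
lemma IsIsometricFrame.energy_normal (hB : ∀ x x', B x x' = B x' x)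
    (h : IsIsometricFrame B G' Θ (f y)) (hf : IsLocalIsometry G G' f y) (hG : IsMetricNear G y)
    (hν : IsLocalNormal G' f ν y)
    (hskew : ∀ u v, frameForm G' Θ (f y) u v = - frameForm G' Θ (f y) v u)
    {e : Module.Basis (Fin m) ℝ (E m)} (he : IsOrthonormalFor (G y) e) :
    ∑ a, B (fderiv ℝ (fun z => Θ (f z) (ν z)) y (e a)) (fderiv ℝ (fun z => Θ (f z) (ν z)) y (e a))
      = ricci G' (f y) (ν y) (ν y)
        + ∑ a, ∑ c, G' (f y) (covSecondDeriv G' f y (e a) (e c)) (ν y) ^ 2 := by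
  have hb := h.metric.isInner
  obtain ⟨e', he', h0, hs⟩ := exists_adapted_basis hb (fderiv ℝ f y) hf.isom.self_of_nhds
    hν.unit.self_of_nhds hν.perp.self_of_nhds he
  have hN := h.isNormalFrame hf hν
  have hS := h.pullback hB hf hG
  set N : E m → V := fun z => Θ (f z) (ν z) with hNdef
  have hfd : DifferentiableAt ℝ f y := hf.smooth.self_of_nhds.differentiableAt (by simp)
  have hΘd : DifferentiableAt ℝ Θ (f y) := h.smooth.self_of_nhds.differentiableAt (by simp)
  have hνd : DifferentiableAt ℝ ν y := hν.smooth.self_of_nhds.differentiableAt (by simp)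
  have hSd : DifferentiableAt ℝ (pullFrame Θ f) y :=
    hS.smooth.self_of_nhds.differentiableAt (by simp)
  -- `j u` is `∇_u ν` in the ambient manifold; `∂_u N` then splits into a part orthogonal to the
  -- image of `Θ` and `Θ(j u)`.
  obtain ⟨j, hj⟩ : ∃ j : E m → E (m + 1), ∀ u,
      j u = christoffel G' (f y) (fderiv ℝ f y u) (ν y) + fderiv ℝ ν y u := ⟨_, fun _ => rfl⟩
  have hdN : ∀ u, fderiv ℝ N y u = frameForm G' Θ (f y) (fderiv ℝ f y u) (ν y) + Θ (f y) (j u) := by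
    intro u
    rw [show N = fun z => (Θ ∘ f) z (ν z) from rfl, fderiv_clm (hΘd.comp y hfd) hνd,
      fderiv_comp y hΘd hfd]
    simp only [frameForm, hj, map_add, Function.comp_apply, ContinuousLinearMap.comp_apply]
    abel
  have hperp := h.perp.self_of_nhds
  have hjν : ∀ u, G' (f y) (j u) (ν y) = 0 := by
    intro u
    have := (hN.fderiv_perp_self hB).self_of_nhds u
    rw [hB, hdN, map_add, add_apply, hperp, h.isom.self_of_nhds, zero_add] at this
    exact this
  have hΘν : ∀ u v, B (Θ (f y) (ν y)) (frameForm G' Θ (f y) u v) = 0 := fun u v => by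
    rw [hB, hperp]
  have hjf : ∀ u v, G' (f y) (j u) (fderiv ℝ f y v)
      = - G' (f y) (covSecondDeriv G' f y u v) (ν y) := by
    intro u v
    have h1 : B (N y) (frameForm G (pullFrame Θ f) y u v)
        = G' (f y) (covSecondDeriv G' f y u v) (ν y) := by
      rw [h.frameForm_hypersurface hB hf hG hν, map_add, hΘν, map_smul, hN.unit.self_of_nhds]
      simp
    rw [← h1, ← hN.inner_fderiv (G := G) hSd u v, hdN, pullFrame_apply, map_add, add_apply, hperp,
      h.isom.self_of_nhds, zero_add]
  -- `∇_u ν` is tangent to the hypersurface with components `-A(u, e_c)`, which yields the `|A|²`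
  -- part of the energy.
  have hjj : ∀ u, G' (f y) (j u) (j u)
      = ∑ c, G' (f y) (covSecondDeriv G' f y u (e c)) (ν y) ^ 2 := by
    intro u
    have h1 := he'.repr (j u)
    rw [Fin.sum_univ_succ, h0] at h1
    simp only [hs, hb.symm _ (j u), hjν, hjf, zero_smul, zero_add] at h1
    conv_lhs => rw [show G' (f y) (j u) (j u) = G' (f y) (j u)
      (∑ c, -G' (f y) (covSecondDeriv G' f y u (e c)) (ν y) • fderiv ℝ f y (e c)) from
        congrArg _ h1]
    simp only [map_sum, map_smul, hjf, smul_eq_mul]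
    exact Finset.sum_congr rfl fun c _ => by ring
  have hsk0 : ∀ u, frameForm G' Θ (f y) u u = 0 := fun u => by
    have := hskew u u
    rwa [eq_neg_iff_add_eq_zero, ← two_smul ℝ, smul_eq_zero_iff_right two_ne_zero] at this
  -- With a skew frame form the Gauss equation reads `⟨R(u,ν)ν, u⟩ = |II(u,ν)|²`, so the part of
  -- `∂N` orthogonal to the image contributes `Ric(ν,ν)`.
  have hR : ∀ u, G' (f y) (curvature G' (f y) u (ν y) (ν y)) u =
      B (frameForm G' Θ (f y) u (ν y)) (frameForm G' Θ (f y) u (ν y)) := by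
    intro u
    rw [h.gauss, hsk0, hskew (ν y) u]
    simp
  obtain ⟨L, hL⟩ := h.exists_curvature_linear (ν y) (ν y)
  rw [ricci_eq he' hb _ _ L hL, Fin.sum_univ_succ, h0, ← Finset.sum_congr rfl fun a _ => hjj (e a)]
  simp only [hR, hs, hsk0, map_zero, zero_add]
  rw [← Finset.sum_add_distrib]
  refine Finset.sum_congr rfl fun a _ => ?_
  rw [hdN]
  simp only [map_add, add_apply, hperp, h.isom.self_of_nhds, hB (Θ (f y) (j (e a))) (frameForm _ _ _ _ _)]
  ring

end Hypersurface

end TraceFormula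
end

noncomputable section

namespace TraceFormula

/-! ### Killing fields as an isometric frame -/

section KillingFrame

variable {r : ℕ} {V : Type*} [NormedAddCommGroup V] [NormedSpace ℝ V]
  {B : V →L[ℝ] V →L[ℝ] ℝ} {G : E r → E r →L[ℝ] E r →L[ℝ] ℝ} {X : E r → V →L[ℝ] E r}
  {L : E r → E r →L[ℝ] V} {x : E r}

/-- The data, near `x`, of a family `X` of Killing fields parametrised by `(V, B)` together with a
dual family of lifts `L` of tangent vectors. -/
structure IsKillingFrame (B : V →L[ℝ] V →L[ℝ] ℝ) (G : E r → E r →L[ℝ] E r →L[ℝ] ℝ)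
    (X : E r → V →L[ℝ] E r) (L : E r → E r →L[ℝ] V) (x : E r) : Prop where
  metric : IsMetricNear G x
  smooth_field : ∀ᶠ z in 𝓝 x, ContDiffAt ℝ ∞ X z
  smooth_lift : ∀ᶠ z in 𝓝 x, ContDiffAt ℝ ∞ L z
  dual : ∀ᶠ z in 𝓝 x, ∀ u c, B (L z u) c = G z u (X z c)
  lift : ∀ᶠ z in 𝓝 x, ∀ u, X z (L z u) = u
  killing : ∀ᶠ z in 𝓝 x, ∀ c v w,
    fderiv ℝ G z (X z c) v w + G z (fderiv ℝ X z v c) w + G z v (fderiv ℝ X z w c) = 0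
  bracket : ∀ᶠ z in 𝓝 x, ∀ u v, fderiv ℝ X z u (L z v) = fderiv ℝ X z v (L z u)

lemma IsKillingFrame.eventually (h : IsKillingFrame B G X L x) :
    ∀ᶠ z in 𝓝 x, IsKillingFrame B G X L z := by
  filter_upwards [h.metric.eventually, eventually_eventually_nhds.2 h.smooth_field,
    eventually_eventually_nhds.2 h.smooth_lift, eventually_eventually_nhds.2 h.dual,
    eventually_eventually_nhds.2 h.lift, eventually_eventually_nhds.2 h.killing,
    eventually_eventually_nhds.2 h.bracket] with z h1 h2 h3 h4 h5 h6 h7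
  exact ⟨h1, h2, h3, h4, h5, h6, h7⟩

/-- Differentiate the duality `⟨Lv, c⟩ = ⟨v, X_c⟩`. Invariantly, the right-hand side is `⟨v, ∇_u
X_c⟩`. -/
lemma IsKillingFrame.inner_frameForm (h : IsKillingFrame B G X L x) (u v : E r) (c : V) :
    B (frameForm G L x u v) c = G x v (fderiv ℝ X x u c + christoffel G x u (X x c)) := by
  have hLd : DifferentiableAt ℝ L x := h.smooth_lift.self_of_nhds.differentiableAt (by simp)
  have hXd : DifferentiableAt ℝ X x := h.smooth_field.self_of_nhds.differentiableAt (by simp)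
  have he : (fun z => B (L z v) c) =ᶠ[𝓝 x] fun z => G z v (X z c) := h.dual.mono fun z hz => hz v c
  have h1 := fderiv_bilin B (hLd.clm_apply (differentiableAt_const v)) (differentiableAt_const c) u
  have h2 := fderiv_clm (h.metric.differentiableAt.clm_apply (differentiableAt_const v))
    (hXd.clm_apply (differentiableAt_const c)) u
  rw [he.fderiv_eq, h2, fderiv_apply_const h.metric.differentiableAt, fderiv_apply_const hXd,
    fderiv_apply_const hLd, h.metric.fderiv_metric] at h1
  simp only [fderiv_fun_const, Pi.zero_apply, zero_apply, map_zero, add_zero] at h1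
  rw [frameForm, map_sub, sub_apply, ← h1, h.dual.self_of_nhds, map_add]
  ring

/-- The Killing equation with the derivative of `G` expressed by Christoffel symbols: `∇X_c` is
skew. -/
lemma IsKillingFrame.skew_aux (h : IsKillingFrame B G X L x) (u v : E r) (c : V) :
    G x v (fderiv ℝ X x u c + christoffel G x u (X x c)) =
      - G x u (fderiv ℝ X x v c + christoffel G x v (X x c)) := by
  have h1 := h.killing.self_of_nhds c u v
  rw [h.metric.fderiv_metric] at h1
  rw [h.metric.christoffel_symm u, h.metric.christoffel_symm v, map_add, map_add]
  rw [h.metric.isInner.symm v, h.metric.isInner.symm v]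
  linarith

lemma IsKillingFrame.frameForm_skew (h : IsKillingFrame B G X L x)
    (hnd : ∀ a, (∀ c, B a c = 0) → a = 0) (u v : E r) :
    frameForm G L x u v = - frameForm G L x v u := by
  rw [← sub_eq_zero, sub_neg_eq_add]
  refine hnd _ fun c => ?_
  rw [map_add, add_apply, h.inner_frameForm, h.inner_frameForm, h.skew_aux u v]
  ring

/-- The tensor `t u w v = ⟨∇_u X_{Lw}, v⟩` is symmetric in `u, w`, by the bracket condition, and
skew in `u, v`, by the Killing equation. Alternating the two symmetries around the three slots gives
`t = -t`. -/
lemma IsKillingFrame.frameForm_perp (h : IsKillingFrame B G X L x) (u v w : E r) :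
    B (frameForm G L x u v) (L x w) = 0 := by
  have hl := h.lift.self_of_nhds
  let t : E r → E r → E r → ℝ := fun u w v =>
    G x v (fderiv ℝ X x u (L x w) + christoffel G x u w)
  have hs : ∀ u w v, t u w v = t w u v := fun u w v => by
    simp only [t]
    rw [h.bracket.self_of_nhds, h.metric.christoffel_symm]
  have ha : ∀ u w v, t u w v = - t v w u := fun u w v => by
    have := h.skew_aux u v (L x w)
    rwa [hl] at this
  have h0 : t u w v = 0 := by
    have := ha u w v
    have e2 := hs v w u
    have e3 := ha w v u
    have e4 := hs u v w
    have e5 := ha v u w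
    have e6 := hs w u v
    linarith
  rw [h.inner_frameForm, hl]
  exact h0

lemma IsKillingFrame.isIsometricFrame (h : IsKillingFrame B G X L x) : IsIsometricFrame B G L x where
  metric := h.metric
  smooth := h.smooth_lift
  isom := by
    filter_upwards [h.dual, h.lift] with z h1 h2 u v
    rw [h1, h2]
  perp := h.eventually.mono fun z hz => hz.frameForm_perp

end KillingFrame

end TraceFormula
end

noncomputable section

namespace TraceFormula

/-! ### Smooth vector fields along maps -/

section TangentVectors

variable {n : ℕ}

/-- Smoothness of `f` is required only on an open set, so that charts and their inverses are
allowed. -/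
lemma contMDiffAt_mfderiv_apply {H EP : Type*} [NormedAddCommGroup EP] [NormedSpace ℝ EP]
    [TopologicalSpace H] {I : ModelWithCorners ℝ EP H}
    {P : Type*} [TopologicalSpace P] [ChartedSpace H P]
    {H₁ E₁ : Type*} [NormedAddCommGroup E₁] [NormedSpace ℝ E₁] [TopologicalSpace H₁]
    {I₁ : ModelWithCorners ℝ E₁ H₁} {S : Type*} [TopologicalSpace S] [ChartedSpace H₁ S]
    [IsManifold I₁ ∞ S]
    {H₂ E₂ : Type*} [NormedAddCommGroup E₂] [NormedSpace ℝ E₂] [TopologicalSpace H₂]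
    {I₂ : ModelWithCorners ℝ E₂ H₂} {M : Type*} [TopologicalSpace M] [ChartedSpace H₂ M]
    [IsManifold I₂ ∞ M]
    {f : S → M} {U : Set S} (hU : IsOpen U) (hf : ContMDiffOn I₁ I₂ ∞ f U)
    {h : P → S} {W : ∀ q, TangentSpace I₁ (h q)} {q₀ : P} (hq : h q₀ ∈ U)
    (hW : ContMDiffAt I I₁.tangent ∞ (fun q => (⟨h q, W q⟩ : TangentBundle I₁ S)) q₀) :
    ContMDiffAt I I₂.tangent ∞
      (fun q => (⟨f (h q), mfderiv I₁ I₂ f (h q) (W q)⟩ : TangentBundle I₂ M)) q₀ := by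
  have h1 : IsManifold I₁ 1 S := IsManifold.of_le (n := ∞) (by exact_mod_cast le_top)
  have h2 : IsManifold I₂ 1 M := IsManifold.of_le (n := ∞) (by exact_mod_cast le_top)
  have hT := hf.contMDiffOn_tangentMapWithin (m := ∞) (by simp) hU.uniqueMDiffOn
  have hopen : IsOpen (TotalSpace.proj ⁻¹' U : Set (TangentBundle I₁ S)) :=
    hU.preimage (FiberBundle.continuous_proj E₁ (TangentSpace I₁))
  have hTa := (hT ⟨h q₀, W q₀⟩ hq).contMDiffAt (hopen.mem_nhds hq)
  have hc := hTa.comp q₀ hW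
  have hh : ContinuousAt h q₀ :=
    ((FiberBundle.continuous_proj E₁ (TangentSpace I₁)).continuousAt.comp hW.continuousAt :)
  refine hc.congr_of_eventuallyEq ?_
  filter_upwards [hh.preimage_mem_nhds (hU.mem_nhds hq)] with q hq'
  simp only [Function.comp_apply, tangentMapWithin]
  rw [mfderivWithin_of_isOpen hU hq']

lemma contMDiffAt_snd {H EP : Type*} [NormedAddCommGroup EP] [NormedSpace ℝ EP]
    [TopologicalSpace H] {I : ModelWithCorners ℝ EP H}
    {P : Type*} [TopologicalSpace P] [ChartedSpace H P] {h : P → E n} {W : P → E n} {q₀ : P}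
    (hW : ContMDiffAt I (𝓘(ℝ, E n)).tangent ∞
      (fun q => (⟨h q, W q⟩ : TangentBundle 𝓘(ℝ, E n) (E n))) q₀) :
    ContMDiffAt I 𝓘(ℝ, E n) ∞ W q₀ :=
  (contMDiff_snd_tangentBundle_modelSpace (E n) 𝓘(ℝ, E n)).contMDiffAt.comp q₀ hW

end TangentVectors

/-! ### Metrics, forms and vectors in the preferred charts -/

section Charts

variable {n : ℕ} {M : Type*} [TopologicalSpace M] [ChartedSpace (E n) M] [IsManifold (𝓡 n) ∞ M]

lemma isManifold_one : IsManifold (𝓡 n) 1 M :=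
  IsManifold.of_le (n := ∞) (by exact_mod_cast le_top)

/-- The coordinates, in the preferred chart at `p`, of a tangent vector at `x`. -/
def coordVec (p : M) (x : M) (v : TangentSpace (𝓡 n) x) : E n :=
  mfderiv (𝓡 n) 𝓘(ℝ, E n) (extChartAt (𝓡 n) p) x v

variable {p : M} {y : E n}

lemma chartFrame_eq (p : M) (y : E n) : chartFrame p y =
    mfderivWithin 𝓘(ℝ, E n) (𝓡 n) (extChartAt (𝓡 n) p).symm (Set.range (𝓡 n)) y := by
  rw [chartFrame, ModelWithCorners.range_eq_univ, mfderivWithin_univ]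

lemma isInvertible_chartFrame (hy : y ∈ (extChartAt (𝓡 n) p).target) :
    (chartFrame p y).IsInvertible := by
  have := isManifold_one (n := n) (M := M)
  rw [chartFrame_eq]
  exact isInvertible_mfderivWithin_extChartAt_symm hy

lemma coordVec_chartFrame (hy : y ∈ (extChartAt (𝓡 n) p).target) (v : E n) :
    coordVec p ((extChartAt (𝓡 n) p).symm y) (chartFrame p y v) = v := by
  have := isManifold_one (n := n) (M := M)
  have h := mfderiv_extChartAt_comp_mfderivWithin_extChartAt_symm hy
  rw [← chartFrame_eq] at h
  exact congrArg (fun l => l v) h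

lemma chartFrame_coordVec (hy : y ∈ (extChartAt (𝓡 n) p).target)
    (v : TangentSpace (𝓡 n) ((extChartAt (𝓡 n) p).symm y)) :
    chartFrame p y (coordVec p _ v) = v := by
  have := isManifold_one (n := n) (M := M)
  have h := mfderivWithin_extChartAt_symm_comp_mfderiv_extChartAt hy
  rw [← chartFrame_eq] at h
  exact congrArg (fun l => l v) h

/-- The tangent space at `p` is the model space, identified through the preferred chart at `p`. At
the centre of its chart a tangent vector is thus its own coordinate vector, which lets pointwise
definitions be compared with coordinate formulas. -/
lemma chartFrame_self (p : M) (v : E n) : (chartFrame p (extChartAt (𝓡 n) p p) v : E n) = v := by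
  have := isManifold_one (n := n) (M := M)
  rw [chartFrame_eq, mfderivWithin_range_extChartAt_symm]
  rfl

lemma coordVec_self (p : M) (v : TangentSpace (𝓡 n) p) : coordVec p p v = v := by
  have := isManifold_one (n := n) (M := M)
  rw [coordVec, mfderiv_extChartAt_self]
  rfl

lemma contMDiffOn_chart_symm (p : M) : ContMDiffOn 𝓘(ℝ, E n) (𝓡 n) ∞ (extChartAt (𝓡 n) p).symm
    (extChartAt (𝓡 n) p).target := contMDiffOn_extChartAt_symm p

lemma contMDiffAt_chart_symm (hy : y ∈ (extChartAt (𝓡 n) p).target) :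
    ContMDiffAt 𝓘(ℝ, E n) (𝓡 n) ∞ (extChartAt (𝓡 n) p).symm y :=
  (contMDiffOn_chart_symm p y hy).contMDiffAt ((isOpen_extChartAt_target p).mem_nhds hy)

lemma contMDiffAt_chartFrame (hy : y ∈ (extChartAt (𝓡 n) p).target) (v : E n) :
    ContMDiffAt 𝓘(ℝ, E n) (𝓡 n).tangent ∞
      (fun z => (⟨(extChartAt (𝓡 n) p).symm z, chartFrame p z v⟩ : TangentBundle (𝓡 n) M)) y := by
  have hconst : ContMDiffAt 𝓘(ℝ, E n) (𝓘(ℝ, E n)).tangent ∞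
      (fun z : E n => (⟨z, v⟩ : TangentBundle 𝓘(ℝ, E n) (E n))) y :=
    contMDiffAt_vectorSpace_iff_contDiffAt.2 contDiffAt_const
  exact contMDiffAt_mfderiv_apply (h := fun z : E n => z) (W := fun _ => v)
    (isOpen_extChartAt_target p) (contMDiffOn_chart_symm p) hy hconst

variable {H EP : Type*} [NormedAddCommGroup EP] [NormedSpace ℝ EP]
    [TopologicalSpace H] {I : ModelWithCorners ℝ EP H}
    {P : Type*} [TopologicalSpace P] [ChartedSpace H P]

/-- The coordinates of a smooth vector field along a map are smooth. -/
lemma contMDiffAt_coordVec {h : P → M} {W : ∀ q, TangentSpace (𝓡 n) (h q)} {q₀ : P}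
    (hq : h q₀ ∈ (extChartAt (𝓡 n) p).source)
    (hW : ContMDiffAt I (𝓡 n).tangent ∞ (fun q => (⟨h q, W q⟩ : TangentBundle (𝓡 n) M)) q₀) :
    ContMDiffAt I 𝓘(ℝ, E n) ∞ (fun q => coordVec p (h q) (W q)) q₀ := by
  have hf : ContMDiffOn (𝓡 n) 𝓘(ℝ, E n) ∞ (extChartAt (𝓡 n) p) (extChartAt (𝓡 n) p).source := by
    rw [extChartAt_source]
    exact contMDiffOn_extChartAt
  exact contMDiffAt_snd (contMDiffAt_mfderiv_apply (isOpen_extChartAt_source p) hf hq hW)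

variable (g : Metric n M)

/-- The inner product of smooth vector fields along a map is smooth. -/
lemma contMDiffAt_inner {h : P → M} {W W' : ∀ q, TangentSpace (𝓡 n) (h q)} {q₀ : P}
    (hW : ContMDiffAt I (𝓡 n).tangent ∞ (fun q => (⟨h q, W q⟩ : TangentBundle (𝓡 n) M)) q₀)
    (hW' : ContMDiffAt I (𝓡 n).tangent ∞ (fun q => (⟨h q, W' q⟩ : TangentBundle (𝓡 n) M)) q₀) :
    ContMDiffAt I 𝓘(ℝ, ℝ) ∞ (fun q => g.inner (h q) (W q) (W' q)) q₀ := by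
  have hh : ContMDiffAt I (𝓡 n) ∞ h q₀ :=
    ((Bundle.contMDiff_proj (TangentSpace (𝓡 n))).contMDiffAt.comp q₀ hW :)
  have hg := (g.contMDiff (h q₀)).comp q₀ hh
  have := ContMDiffAt.clm_bundle_apply₂ (F₁ := E n) (F₂ := E n) (F₃ := ℝ)
    (E₁ := fun x : M => TangentSpace (𝓡 n) x) (E₂ := fun x : M => TangentSpace (𝓡 n) x)
    (E₃ := Bundle.Trivial M ℝ) (b := h) hg hW hW'
  rw [contMDiffAt_totalSpace] at this
  exact this.2

lemma chartMetric_apply (p : M) (y u v : E n) : chartMetric g p y u v =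
    g.inner ((extChartAt (𝓡 n) p).symm y) (chartFrame p y u) (chartFrame p y v) := rfl

lemma isInner_inner (x : M) : IsInner (n := n) (g.inner x) := ⟨g.symm x, g.pos x⟩

lemma isInner_chartMetric (hy : y ∈ (extChartAt (𝓡 n) p).target) :
    IsInner (chartMetric g p y) := by
  refine ⟨fun u v => ?_, fun v hv => ?_⟩
  · rw [chartMetric_apply, chartMetric_apply]
    exact g.symm _ _ _
  · rw [chartMetric_apply]
    refine g.pos _ _ fun h => hv ?_
    rw [← coordVec_chartFrame hy v, h, coordVec]
    exact map_zero _

lemma contDiffAt_chartMetric (hy : y ∈ (extChartAt (𝓡 n) p).target) :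
    ContDiffAt ℝ ∞ (chartMetric g p) y := by
  have h1 : ContDiffOn ℝ ∞ (chartMetric g p) (extChartAt (𝓡 n) p).target := by
    rw [contDiffOn_clm_apply]
    intro u
    rw [contDiffOn_clm_apply]
    intro v z hz
    exact (contMDiffAt_inner g (contMDiffAt_chartFrame hz u)
      (contMDiffAt_chartFrame hz v)).contDiffAt.contDiffWithinAt
  exact (h1 y hy).contDiffAt ((isOpen_extChartAt_target p).mem_nhds hy)

lemma isMetricNear_chartMetric (hy : y ∈ (extChartAt (𝓡 n) p).target) :
    IsMetricNear (chartMetric g p) y := by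
  filter_upwards [(isOpen_extChartAt_target p).mem_nhds hy] with z hz
  exact ⟨isInner_chartMetric g hz, contDiffAt_chartMetric g hz⟩

lemma chartMetric_coordVec {x : M} (hx : x ∈ (extChartAt (𝓡 n) p).source)
    (u v : TangentSpace (𝓡 n) x) :
    chartMetric g p (extChartAt (𝓡 n) p x) (coordVec p x u) (coordVec p x v) = g.inner x u v := by
  obtain ⟨y, hy, rfl⟩ : ∃ y ∈ (extChartAt (𝓡 n) p).target, (extChartAt (𝓡 n) p).symm y = x :=
    ⟨_, (extChartAt (𝓡 n) p).map_source hx, (extChartAt (𝓡 n) p).left_inv hx⟩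
  rw [(extChartAt (𝓡 n) p).right_inv hy, chartMetric_apply, chartFrame_coordVec hy,
    chartFrame_coordVec hy]

lemma chartMetric_self (p : M) (u v : TangentSpace (𝓡 n) p) :
    chartMetric g p (extChartAt (𝓡 n) p p) u v = g.inner p u v := by
  have := chartMetric_coordVec g (mem_extChartAt_source (I := 𝓡 n) p) u v
  rwa [coordVec_self, coordVec_self] at this

/-- A smooth `1`-form has smooth coordinate expressions. -/
lemma contDiffAt_chartOneForm {η : ∀ x : M, TangentSpace (𝓡 n) x →L[ℝ] ℝ}
    (hη : ContMDiff (𝓡 n) ((𝓡 n).prod 𝓘(ℝ, E n →L[ℝ] ℝ)) ∞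
      (fun x => TotalSpace.mk' (E n →L[ℝ] ℝ) (E := fun x : M => TangentSpace (𝓡 n) x →L[ℝ] ℝ)
        x (η x))) (hy : y ∈ (extChartAt (𝓡 n) p).target) :
    ContDiffAt ℝ ∞ (chartOneForm η p) y := by
  have h1 : ContDiffOn ℝ ∞ (chartOneForm η p) (extChartAt (𝓡 n) p).target := by
    rw [contDiffOn_clm_apply]
    intro v z hz
    have := ContMDiffAt.clm_bundle_apply (F₁ := E n) (F₂ := ℝ)
      (E₁ := fun x : M => TangentSpace (𝓡 n) x)
      (E₂ := Bundle.Trivial M ℝ) (b := (extChartAt (𝓡 n) p).symm)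
      ((hη _).comp z (contMDiffAt_chart_symm hz)) (contMDiffAt_chartFrame hz v)
    rw [contMDiffAt_totalSpace] at this
    exact this.2.contDiffAt.contDiffWithinAt
  exact (h1 y hy).contDiffAt ((isOpen_extChartAt_target p).mem_nhds hy)

end Charts

end TraceFormula
end

noncomputable section

namespace TraceFormula

/-! ### Maps and second fundamental forms in charts -/

section Maps

variable {m n : ℕ}
  {S : Type*} [TopologicalSpace S] [ChartedSpace (E m) S] [IsManifold (𝓡 m) ∞ S]
  {M : Type*} [TopologicalSpace M] [ChartedSpace (E n) M] [IsManifold (𝓡 n) ∞ M]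

/-- The map `f` in the preferred charts at `p` and `f p`. -/
def localMap (f : S → M) (p : S) (y : E m) : E n :=
  extChartAt (𝓡 n) (f p) (f ((extChartAt (𝓡 m) p).symm y))

variable {f : S → M} {p : S}

lemma localMap_chart {x : S} (hx : x ∈ (extChartAt (𝓡 m) p).source) :
    localMap f p (extChartAt (𝓡 m) p x) = extChartAt (𝓡 n) (f p) (f x) := by
  rw [localMap, (extChartAt (𝓡 m) p).left_inv hx]

lemma localMap_self : localMap f p (extChartAt (𝓡 m) p p) = extChartAt (𝓡 n) (f p) (f p) :=
  localMap_chart (mem_extChartAt_source p)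

/-- The points of the chart at `p` which `f` maps to the chart at `f p`. -/
def goodSet (n : ℕ) {M : Type*} [TopologicalSpace M] [ChartedSpace (E n) M] (f : S → M) (p : S) : Set (E m) :=
  (extChartAt (𝓡 m) p).target ∩
    (extChartAt (𝓡 m) p).symm ⁻¹' (f ⁻¹' (extChartAt (𝓡 n) (f p)).source)

lemma goodSet_mem_nhds (hf : Continuous f) {y : E m} (hy : y ∈ goodSet n f p) :
    goodSet n f p ∈ 𝓝 y := by
  refine ContinuousOn.isOpen_inter_preimage (continuousOn_extChartAt_symm p)
    (isOpen_extChartAt_target p) ((isOpen_extChartAt_source (f p)).preimage hf) |>.mem_nhds hy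

lemma self_mem_goodSet : extChartAt (𝓡 m) p p ∈ goodSet n f p :=
  ⟨mem_extChartAt_target p, by simp⟩

lemma contDiffAt_localMap (hf : ContMDiff (𝓡 m) (𝓡 n) ∞ f) {y : E m} (hy : y ∈ goodSet n f p) :
    ContDiffAt ℝ ∞ (localMap (n := n) f p) y := by
  have h1 : ContMDiffAt (𝓡 n) 𝓘(ℝ, E n) ∞ (extChartAt (𝓡 n) (f p))
      (f ((extChartAt (𝓡 m) p).symm y)) :=
    contMDiffAt_extChartAt' (by simpa using hy.2)
  have h2 := (hf _).comp y (contMDiffAt_chart_symm hy.1)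
  exact (ContMDiffAt.comp y h1 h2).contDiffAt

lemma fderiv_localMap (hf : ContMDiff (𝓡 m) (𝓡 n) ∞ f) {y : E m} (hy : y ∈ goodSet n f p) (v : E m) :
    fderiv ℝ (localMap f p) y v = coordVec (f p) (f ((extChartAt (𝓡 m) p).symm y))
      (mfderiv (𝓡 m) (𝓡 n) f ((extChartAt (𝓡 m) p).symm y) (chartFrame p y v)) := by
  have h1 : MDifferentiableAt (𝓡 n) 𝓘(ℝ, E n) (extChartAt (𝓡 n) (f p))
      (f ((extChartAt (𝓡 m) p).symm y)) :=
    ContMDiffAt.mdifferentiableAt (n := ∞) (contMDiffAt_extChartAt' (by simpa using hy.2)) (by simp)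
  have h2 : MDifferentiableAt (𝓡 m) (𝓡 n) f ((extChartAt (𝓡 m) p).symm y) :=
    (hf _).mdifferentiableAt (by simp)
  have h3 : MDifferentiableAt 𝓘(ℝ, E m) (𝓡 m) (extChartAt (𝓡 m) p).symm y :=
    (contMDiffAt_chart_symm hy.1).mdifferentiableAt (by simp)
  rw [← mfderiv_eq_fderiv]
  have h4 : localMap f p = (extChartAt (𝓡 n) (f p)) ∘ (f ∘ (extChartAt (𝓡 m) p).symm) := rfl
  rw [h4, mfderiv_comp (I' := 𝓡 n) y h1 (h2.comp y h3), mfderiv_comp (I' := 𝓡 m) y h2 h3]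
  rfl

lemma fderiv_localMap_coordVec (hf : ContMDiff (𝓡 m) (𝓡 n) ∞ f) {x : S}
    (hx : x ∈ (extChartAt (𝓡 m) p).source) (hfx : f x ∈ (extChartAt (𝓡 n) (f p)).source)
    (v : TangentSpace (𝓡 m) x) :
    fderiv ℝ (localMap f p) (extChartAt (𝓡 m) p x) (coordVec p x v) =
      coordVec (f p) (f x) (mfderiv (𝓡 m) (𝓡 n) f x v) := by
  obtain ⟨y, hy, rfl⟩ : ∃ y ∈ (extChartAt (𝓡 m) p).target, (extChartAt (𝓡 m) p).symm y = x :=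
    ⟨_, (extChartAt (𝓡 m) p).map_source hx, (extChartAt (𝓡 m) p).left_inv hx⟩
  rw [(extChartAt (𝓡 m) p).right_inv hy, fderiv_localMap hf ⟨hy, hfx⟩, chartFrame_coordVec hy]

lemma fderiv_localMap_self (hf : ContMDiff (𝓡 m) (𝓡 n) ∞ f) (v : TangentSpace (𝓡 m) p) :
    fderiv ℝ (localMap f p) (extChartAt (𝓡 m) p p) v = mfderiv (𝓡 m) (𝓡 n) f p v := by
  have := fderiv_localMap_coordVec hf (mem_extChartAt_source (I := 𝓡 m) p)
    (mem_extChartAt_source (I := 𝓡 n) (f p)) v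
  rwa [coordVec_self, coordVec_self] at this

lemma IsIsometricImmersion.isLocalIsometry {gS : Metric m S} {gM : Metric n M}
    (hf : IsIsometricImmersion gS gM f) {y : E m} (hy : y ∈ goodSet n f p) :
    IsLocalIsometry (chartMetric gS p) (chartMetric gM (f p)) (localMap f p) y where
  smooth := by
    filter_upwards [goodSet_mem_nhds hf.1.continuous hy] with y hy
    exact contDiffAt_localMap hf.1 hy
  isom := by
    filter_upwards [goodSet_mem_nhds hf.1.continuous hy] with y hy u v
    rw [fderiv_localMap hf.1 hy, fderiv_localMap hf.1 hy, localMap, chartMetric_coordVec gM hy.2,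
      hf.2]
    rfl

/-- The derivative of a vector valued function in the chart at `p`. -/
lemma mvfderiv_eq_fderiv {F : Type*} [NormedAddCommGroup F] [NormedSpace ℝ F] {h : S → F}
    {k : E m → F} (hk : DifferentiableAt ℝ k (extChartAt (𝓡 m) p p))
    (hhk : ∀ᶠ q in 𝓝 p, h q = k (extChartAt (𝓡 m) p q)) (v : TangentSpace (𝓡 m) p) :
    mvfderiv (𝓡 m) h p v = fderiv ℝ k (extChartAt (𝓡 m) p p) v := by
  have h1 : MDifferentiableAt (𝓡 m) 𝓘(ℝ, E m) (extChartAt (𝓡 m) p) p :=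
    ContMDiffAt.mdifferentiableAt (n := ∞) contMDiffAt_extChartAt (by simp)
  have h2 : mfderiv (𝓡 m) 𝓘(ℝ, F) h p =
      mfderiv (𝓡 m) 𝓘(ℝ, F) (k ∘ extChartAt (𝓡 m) p) p := Filter.EventuallyEq.mfderiv_eq hhk
  have h3 : mfderiv (𝓡 m) 𝓘(ℝ, F) (k ∘ extChartAt (𝓡 m) p) p = _ :=
    mfderiv_comp (I' := 𝓘(ℝ, E m)) p hk.mdifferentiableAt h1
  have h4 : (mfderiv (𝓡 m) 𝓘(ℝ, F) h p v : F) =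
      fderiv ℝ k (extChartAt (𝓡 m) p p) (coordVec p p v) := by
    rw [h2, h3, mfderiv_eq_fderiv]
    rfl
  rw [coordVec_self] at h4
  exact h4

lemma mfderiv_coordField (hf : ContMDiff (𝓡 m) (𝓡 n) ∞ f) (w : E m) :
    ∀ᶠ q in 𝓝 p, coordVec (f p) (f q) (mfderiv (𝓡 m) (𝓡 n) f q (coordField p w q)) =
      fderiv ℝ (localMap (n := n) f p) (extChartAt (𝓡 m) p q) w := by
  have h2 : ∀ᶠ q in 𝓝 p, q ∈ (extChartAt (𝓡 m) p).source :=
    (isOpen_extChartAt_source p).mem_nhds (mem_extChartAt_source p)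
  have h3 : ∀ᶠ q in 𝓝 p, f q ∈ (extChartAt (𝓡 n) (f p)).source :=
    hf.continuous.continuousAt.eventually
      ((isOpen_extChartAt_source (f p)).mem_nhds (mem_extChartAt_source (f p)))
  filter_upwards [h2, h3] with q hq hfq
  obtain ⟨y, hy, rfl⟩ : ∃ y ∈ (extChartAt (𝓡 m) p).target,
      (extChartAt (𝓡 m) p).symm y = q :=
    ⟨_, (extChartAt (𝓡 m) p).map_source hq, (extChartAt (𝓡 m) p).left_inv hq⟩
  rw [(extChartAt (𝓡 m) p).right_inv hy, fderiv_localMap hf ⟨hy, hfq⟩, coordField,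
    (extChartAt (𝓡 m) p).right_inv hy]

lemma covDerivAlong_coordField (gM : Metric n M) (hf : ContMDiff (𝓡 m) (𝓡 n) ∞ f) (v w : E m) :
    (covDerivAlong gM f (fun q => mfderiv (𝓡 m) (𝓡 n) f q (coordField p w q)) p v : E n) =
      covSecondDeriv (chartMetric gM (f p)) (localMap f p) (extChartAt (𝓡 m) p p) v w := by
  have hd := differentiableAt_fderiv
    (contDiffAt_localMap hf (self_mem_goodSet (n := n) (f := f) (p := p)))
  have h1 := mvfderiv_eq_fderiv (hd.clm_apply (differentiableAt_const w))
    (mfderiv_coordField hf w) v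
  have h5 : (mfderiv (𝓡 m) (𝓡 n) f p (coordField p w p) : E n) =
      fderiv ℝ (localMap f p) (extChartAt (𝓡 m) p p) w :=
    (congrArg (mfderiv (𝓡 m) (𝓡 n) f p) (chartFrame_self p w)).trans
      (fderiv_localMap_self hf w).symm
  have h6 : (mfderiv (𝓡 m) (𝓡 n) f p v : E n) =
      fderiv ℝ (localMap f p) (extChartAt (𝓡 m) p p) v := (fderiv_localMap_self hf v).symm
  rw [covSecondDeriv, ← fderiv_apply_const hd, ← h1, ← h5, localMap_self, ← h6]
  rfl

lemma secondFundamentalForm_eq (gM : Metric n M) (hf : ContMDiff (𝓡 m) (𝓡 n) ∞ f)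
    (ξ : TangentSpace (𝓡 n) (f p)) (v w : E m) :
    secondFundamentalForm (m := m) gM f p ξ v w =
      chartMetric gM (f p) (localMap f p (extChartAt (𝓡 m) p p))
        (covSecondDeriv (chartMetric gM (f p)) (localMap f p) (extChartAt (𝓡 m) p p) v w) ξ := by
  rw [← covDerivAlong_coordField gM hf, localMap_self]
  exact (chartMetric_self gM (f p) _ _).symm

end Maps

end TraceFormula
end

noncomputable section

namespace TraceFormula

/-! ### Normal fields and dual fields in charts -/

section LocalFields

variable {m n : ℕ}
  {S : Type*} [TopologicalSpace S] [ChartedSpace (E m) S] [IsManifold (𝓡 m) ∞ S]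
  {M : Type*} [TopologicalSpace M] [ChartedSpace (E n) M] [IsManifold (𝓡 n) ∞ M]

/-- A vector field along `f` in the preferred charts at `p` and `f p`. -/
def localField (f : S → M) (ν : ∀ q : S, TangentSpace (𝓡 n) (f q)) (p : S) (y : E m) : E n :=
  coordVec (f p) (f ((extChartAt (𝓡 m) p).symm y)) (ν ((extChartAt (𝓡 m) p).symm y))

lemma localField_self (f : S → M) (ν : ∀ q : S, TangentSpace (𝓡 n) (f q)) (p : S) :
    localField f ν p (extChartAt (𝓡 m) p p) = ν p := by
  rw [localField, extChartAt_to_inv p]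
  exact coordVec_self (f p) (ν p)

lemma IsUnitNormalField.isLocalNormal {M : Type*} [TopologicalSpace M]
    [ChartedSpace (E (m + 1)) M] [IsManifold (𝓡 (m + 1)) ∞ M] {gM : Metric (m + 1) M} {f : S → M}
    (hf : ContMDiff (𝓡 m) (𝓡 (m + 1)) ∞ f)
    {ν : ∀ q : S, TangentSpace (𝓡 (m + 1)) (f q)} (hν : IsUnitNormalField m gM f ν) {p : S}
    {y : E m} (hy : y ∈ goodSet (m + 1) f p) :
    IsLocalNormal (chartMetric gM (f p)) (localMap f p) (localField f ν p) y where
  smooth := by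
    filter_upwards [goodSet_mem_nhds hf.continuous hy] with z hz
    have h1 := (hν.1 _).comp z (contMDiffAt_chart_symm hz.1)
    exact (contMDiffAt_coordVec (p := f p) (h := fun z => f ((extChartAt (𝓡 m) p).symm z))
      (W := fun z => ν ((extChartAt (𝓡 m) p).symm z)) hz.2 h1).contDiffAt
  unit := by
    filter_upwards [goodSet_mem_nhds hf.continuous hy] with z hz
    rw [localMap, localField, chartMetric_coordVec gM hz.2, (hν.2 _).2]
  perp := by
    filter_upwards [goodSet_mem_nhds hf.continuous hy] with z hz w
    rw [fderiv_localMap hf hz, localMap, localField, chartMetric_coordVec gM hz.2, (hν.2 _).1]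

/-- The metric dual of a `1`-form in the preferred chart at `p`. -/
def localSharp (g : Metric m S) (η : ∀ x : S, TangentSpace (𝓡 m) x →L[ℝ] ℝ) (p : S) (y : E m) :
    E m := sharp (chartMetric g p y) (chartOneForm η p y)

lemma contDiffAt_localSharp (g : Metric m S) {η : ∀ x : S, TangentSpace (𝓡 m) x →L[ℝ] ℝ}
    (hη : IsHarmonicOneForm g η) {p : S} {y : E m} (hy : y ∈ (extChartAt (𝓡 m) p).target) :
    ContDiffAt ℝ ∞ (localSharp g η p) y := by
  refine (isMetricNear_chartMetric g hy).contDiffAt_sharp fun w => ?_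
  exact (contDiffAt_chartOneForm hη.1 hy).clm_apply contDiffAt_const

lemma inner_localSharp (g : Metric m S) (η : ∀ x : S, TangentSpace (𝓡 m) x →L[ℝ] ℝ) {p : S}
    {y : E m} (hy : y ∈ (extChartAt (𝓡 m) p).target) (w : E m) :
    chartMetric g p y (localSharp g η p y) w = chartOneForm η p y w :=
  inner_sharp (isInner_chartMetric g hy) (chartOneForm η p y).toLinearMap w

lemma inner_oneFormSharp (g : Metric m S) (η : ∀ x : S, TangentSpace (𝓡 m) x →L[ℝ] ℝ) (x : S)
    (w : TangentSpace (𝓡 m) x) : g.inner x (oneFormSharp g η x) w = η x w :=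
  inner_sharp (n := m) (isInner_inner g x) (η x).toLinearMap w

/-- The two sides apply `sharp` in different charts, but both are determined by their pairing with
tangent vectors, which does not depend on the chart. -/
lemma chartFrame_localSharp (g : Metric m S) (η : ∀ x : S, TangentSpace (𝓡 m) x →L[ℝ] ℝ) {p : S}
    {y : E m} (hy : y ∈ (extChartAt (𝓡 m) p).target) :
    chartFrame p y (localSharp g η p y) = oneFormSharp g η ((extChartAt (𝓡 m) p).symm y) := by
  refine (isInner_inner g ((extChartAt (𝓡 m) p).symm y)).ext fun w => ?_
  obtain ⟨w', rfl⟩ : ∃ w' : E m, (chartFrame p y w' : E m) = w :=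
    ⟨_, chartFrame_coordVec hy w⟩
  exact (inner_localSharp g η hy w').trans (inner_oneFormSharp g η _ (chartFrame p y w')).symm

end LocalFields

end TraceFormula
end

noncomputable section

namespace TraceFormula

/-! ### The form induced on `∧²V` -/

section Wedge

variable {V : Type*} [AddCommGroup V] [Module ℝ V] (b : V →ₗ[ℝ] V →ₗ[ℝ] ℝ)

lemma wedgeForm_wedge_wedge (x y z w : V) :
    wedgeForm b (wedge x y) (wedge z w) = b x z * b y w - b x w * b y z := by
  rw [wedgeForm, wedge, wedge, LinearMap.comp_apply, exteriorPower.map_apply_ιMulti]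
  have := exteriorPower.pairingDual_ιMulti_ιMulti (R := ℝ) (⇑b ∘ ![x, y]) ![z, w]
  refine this.trans ?_
  rw [Matrix.det_fin_two]
  simp
  ring

/-- The wedge product as a bilinear map. -/
def wedgeLin (V : Type*) [AddCommGroup V] [Module ℝ V] : V →ₗ[ℝ] V →ₗ[ℝ] ⋀[ℝ]^2 V :=
  have e₀ : ∀ x y z : V, Function.update ![x, y] 0 z = ![z, y] := fun x y z => by
    ext i; fin_cases i <;> rfl
  have e₁ : ∀ x y z : V, Function.update ![x, y] 1 z = ![x, z] := fun x y z => by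
    ext i; fin_cases i <;> rfl
  LinearMap.mk₂ ℝ wedge
    (fun x x' y => by
      have := (exteriorPower.ιMulti ℝ 2 (M := V)).map_update_add ![x, y] 0 x x'
      rwa [e₀, e₀, e₀] at this)
    (fun c x y => by
      have := (exteriorPower.ιMulti ℝ 2 (M := V)).map_update_smul ![x, y] 0 c x
      rwa [e₀, e₀] at this)
    (fun x y y' => by
      have := (exteriorPower.ιMulti ℝ 2 (M := V)).map_update_add ![x, y] 1 y y'
      rwa [e₁, e₁, e₁] at this)
    (fun c x y => by
      have := (exteriorPower.ιMulti ℝ 2 (M := V)).map_update_smul ![x, y] 1 c y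
      rwa [e₁, e₁] at this)

lemma linearMap_ext_wedge {F : Type*} [AddCommGroup F] [Module ℝ F] {φ ψ : ⋀[ℝ]^2 V →ₗ[ℝ] F}
    (h : ∀ x y, φ (wedge x y) = ψ (wedge x y)) : φ = ψ := by
  apply exteriorPower.linearMap_ext
  ext v
  have : v = ![v 0, v 1] := by ext i; fin_cases i <;> rfl
  rw [this]
  exact h _ _

/-- An adjunction, to be used with `φ` the evaluation of Killing fields at a point and `x', y'` the
lifts of `x, y` to `𝔤`. -/
lemma wedgeForm_comp {W : Type*} [AddCommGroup W] [Module ℝ W] (c : W →ₗ[ℝ] W →ₗ[ℝ] ℝ)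
    (φ : V →ₗ[ℝ] W) {x y : W} {x' y' : V} (hx : ∀ z, c x (φ z) = b x' z)
    (hy : ∀ z, c y (φ z) = b y' z) (v : ⋀[ℝ]^2 V) :
    wedgeForm c (wedge x y) (exteriorPower.map 2 φ v) = wedgeForm b (wedge x' y') v := by
  have : (wedgeForm c (wedge x y)).comp (exteriorPower.map 2 φ) = wedgeForm b (wedge x' y') := by
    refine linearMap_ext_wedge fun z w => ?_
    have h1 : exteriorPower.map 2 φ (wedge z w) = wedge (φ z) (φ w) := by
      rw [wedge, wedge, exteriorPower.map_apply_ιMulti]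
      congr 1
      ext i; fin_cases i <;> rfl
    rw [LinearMap.comp_apply, h1, wedgeForm_wedge_wedge, wedgeForm_wedge_wedge, hx, hx, hy, hy]
  exact congrArg (fun l => l v) this

variable {b} {ι : Type*} [Fintype ι] [DecidableEq ι] (β : Module.Basis ι ℝ (⋀[ℝ]^2 V))

lemma wedgeForm_basis
    (hβ : ∀ i j, wedgeForm b (β i) (β j) = if i = j then 1 else 0)
    (u : ⋀[ℝ]^2 V) (i : ι) : wedgeForm b u (β i) = β.repr u i := by
  conv_lhs => rw [← β.sum_repr u]
  simp only [map_sum, map_smul, LinearMap.sum_apply, LinearMap.smul_apply, hβ, smul_eq_mul,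
    mul_ite, mul_one, mul_zero, Finset.sum_ite_eq', Finset.mem_univ, if_true]

/-- Parseval's identity; orthonormality of the basis suffices, without assuming positivity of `b`.
-/
lemma wedgeForm_eq_sum
    (hβ : ∀ i j, wedgeForm b (β i) (β j) = if i = j then 1 else 0)
    (u v : ⋀[ℝ]^2 V) :
    wedgeForm b u v = ∑ i, wedgeForm b u (β i) * wedgeForm b v (β i) := by
  conv_lhs => rw [← β.sum_repr v]
  simp only [map_sum, map_smul, wedgeForm_basis β hβ, smul_eq_mul]
  exact Finset.sum_congr rfl fun i _ => mul_comm _ _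

lemma form_ne_zero [Nonempty ι]
    (hβ : ∀ i j, wedgeForm b (β i) (β j) = if i = j then 1 else 0) : b ≠ 0 := by
  rintro rfl
  obtain ⟨i⟩ := ‹Nonempty ι›
  have h0 : wedgeForm (0 : V →ₗ[ℝ] V →ₗ[ℝ] ℝ) = 0 := by
    refine linearMap_ext_wedge fun x y => linearMap_ext_wedge fun z w => ?_
    simp [wedgeForm_wedge_wedge]
  have := hβ i i
  simp [h0] at this

/-- A bilinear form for which `∧²V` has an orthonormal basis is nondegenerate. -/
lemma form_nondegenerate [Nonempty ι]
    (hβ : ∀ i j, wedgeForm b (β i) (β j) = if i = j then 1 else 0)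
    {x : V} (hx : ∀ y, b x y = 0) :
    x = 0 := by
  by_contra hne
  -- For `x` in the radical, all coefficients of `x ∧ y` in the orthonormal basis vanish.
  have h1 : ∀ y, wedge x y = 0 := by
    intro y
    have h2 : wedgeForm b (wedge x y) = 0 := linearMap_ext_wedge fun z w => by
      simp [wedgeForm_wedge_wedge, hx]
    rw [← β.sum_repr (wedge x y)]
    refine Finset.sum_eq_zero fun i _ => ?_
    rw [← wedgeForm_basis β hβ, h2]
    simp
  -- Otherwise functionals dual to the independent pair `x, y` would detect `x ∧ y ≠ 0`. So `x`
  -- spans `V`, and `b` vanishes identically.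
  have h4 : ∀ y, ∃ c : ℝ, c • x = y := by
    intro y
    by_contra! hy
    have hli : LinearIndependent ℝ ![x, y] := by
      rw [LinearIndependent.pair_iff' hne]
      exact hy
    obtain ⟨φ, hφ⟩ : ∃ φ : Fin 2 → Module.Dual ℝ V, ∀ i j, φ i (![x, y] j) = if i = j then 1 else 0 := by
      obtain ⟨l, hl⟩ := LinearMap.exists_leftInverse_of_injective
        (Finsupp.linearCombination ℝ ![x, y]) (linearIndependent_iff_ker.1 hli)
      refine ⟨fun i => (Finsupp.lapply i).comp l, fun i j => ?_⟩
      have h6 := congrArg (fun k => k (Finsupp.single j 1) i) hl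
      simpa [Finsupp.single_apply, eq_comm] using h6
    have h5 : exteriorPower.pairingDual ℝ V 2 (wedge (φ 0) (φ 1)) (wedge x y) = 1 := by
      refine (exteriorPower.pairingDual_ιMulti_ιMulti (R := ℝ) ![φ 0, φ 1] ![x, y]).trans ?_
      rw [Matrix.det_fin_two]
      have h00 := hφ 0 0
      have h01 := hφ 0 1
      have h10 := hφ 1 0
      have h11 := hφ 1 1
      simp at h00 h01 h10 h11 ⊢
      rw [h00, h01, h10, h11]
      ring
    rw [h1, map_zero] at h5
    exact zero_ne_one h5
  refine form_ne_zero β hβ ?_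
  ext y z
  obtain ⟨c, rfl⟩ := h4 y
  simp [hx]

end Wedge

end TraceFormula
end

noncomputable section

namespace TraceFormula

/-! ### The symmetry at a point and its involution of the isometry algebra -/

section Involution

open VectorField

variable {r : ℕ} {N : Type*} [TopologicalSpace N] [ChartedSpace (E r) N] [IsManifold (𝓡 r) ∞ N]
  {g : Metric r N} {σ : N → N}

lemma mfderiv_involutive (hσ : ContMDiff (𝓡 r) (𝓡 r) ∞ σ) (hinv : Function.Involutive σ) (q : N)
    (v : E r) : (mfderiv (𝓡 r) (𝓡 r) σ (σ q) (mfderiv (𝓡 r) (𝓡 r) σ q v) : E r) = v := by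
  have h1 : ∀ q, MDifferentiableAt (𝓡 r) (𝓡 r) σ q := fun q => (hσ q).mdifferentiableAt (by simp)
  have h2 := mfderiv_comp (I' := 𝓡 r) q (h1 (σ q)) (h1 q)
  have h3 : σ ∘ σ = id := funext hinv
  rw [h3, mfderiv_id] at h2
  exact (congrArg (fun l : E r →L[ℝ] E r => l v) h2).symm

lemma isInvertible_mfderiv_involutive (hσ : ContMDiff (𝓡 r) (𝓡 r) ∞ σ)
    (hinv : Function.Involutive σ) (q : N) : (mfderiv (𝓡 r) (𝓡 r) σ q).IsInvertible := by
  refine ContinuousLinearMap.IsInvertible.of_inverse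
    (g := (mfderiv (𝓡 r) (𝓡 r) σ (σ q) : E r →L[ℝ] E r)) ?_ ?_
  · ext1 v
    have := mfderiv_involutive hσ hinv (σ q) v
    rw [hinv q] at this
    exact this
  · ext1 v
    exact mfderiv_involutive hσ hinv q v

lemma mfderiv_mpullback (hσ : ContMDiff (𝓡 r) (𝓡 r) ∞ σ) (hinv : Function.Involutive σ)
    (Y : ∀ x : N, TangentSpace (𝓡 r) x) (q : N) :
    mfderiv (𝓡 r) (𝓡 r) σ q (mpullback (𝓡 r) (𝓡 r) σ Y q) = Y (σ q) := by
  rw [mpullback_apply]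
  exact (isInvertible_mfderiv_involutive hσ hinv q).self_apply_inverse _

lemma mpullback_eq_iff (hσ : ContMDiff (𝓡 r) (𝓡 r) ∞ σ) (hinv : Function.Involutive σ)
    (Y : ∀ x : N, TangentSpace (𝓡 r) x) (q : N) (v : TangentSpace (𝓡 r) q) :
    mpullback (𝓡 r) (𝓡 r) σ Y q = v ↔ mfderiv (𝓡 r) (𝓡 r) σ q v = Y (σ q) := by
  have hi := isInvertible_mfderiv_involutive hσ hinv q
  refine ⟨fun h => ?_, fun h => ?_⟩
  · rw [← h, mfderiv_mpullback hσ hinv]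
  · exact hi.injective (by rw [mfderiv_mpullback hσ hinv, h])

lemma mpullback_mpullback (hσ : ContMDiff (𝓡 r) (𝓡 r) ∞ σ) (hinv : Function.Involutive σ)
    (Y : ∀ x : N, TangentSpace (𝓡 r) x) :
    mpullback (𝓡 r) (𝓡 r) σ (mpullback (𝓡 r) (𝓡 r) σ Y) = Y := by
  funext q
  rw [mpullback_eq_iff hσ hinv, eq_comm, mpullback_eq_iff hσ hinv]
  have := mfderiv_involutive hσ hinv q (Y q)
  refine this.trans ?_
  congr 1
  rw [hinv q]

lemma isSmoothField_mpullback (hσ : ContMDiff (𝓡 r) (𝓡 r) ∞ σ) (hinv : Function.Involutive σ)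
    {Y : ∀ x : N, TangentSpace (𝓡 r) x} (hY : IsSmoothField Y) :
    IsSmoothField (mpullback (𝓡 r) (𝓡 r) σ Y) := by
  have := isManifold_minSmoothness (r := r) (N := N) 2
  exact ContMDiff.mpullback_vectorField (n := ∞) hY hσ (isInvertible_mfderiv_involutive hσ hinv)
    (by simp)

lemma inner_mpullback (hσ : IsIsometricImmersion g g σ) (hinv : Function.Involutive σ)
    (Y Z : ∀ x : N, TangentSpace (𝓡 r) x) (q : N) :
    g.inner q (mpullback (𝓡 r) (𝓡 r) σ Y q) (mpullback (𝓡 r) (𝓡 r) σ Z q) =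
      g.inner (σ q) (Y (σ q)) (Z (σ q)) := by
  rw [← hσ.2, mfderiv_mpullback hσ.1 hinv, mfderiv_mpullback hσ.1 hinv]

lemma mpullback_mlieBracket_involutive (hσ : ContMDiff (𝓡 r) (𝓡 r) ∞ σ)
    {Y Z : ∀ x : N, TangentSpace (𝓡 r) x} (hY : IsSmoothField Y) (hZ : IsSmoothField Z) (q : N) :
    mpullback (𝓡 r) (𝓡 r) σ (mlieBracket (𝓡 r) Y Z) q =
      mlieBracket (𝓡 r) (mpullback (𝓡 r) (𝓡 r) σ Y) (mpullback (𝓡 r) (𝓡 r) σ Z) q := by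
  have := isManifold_minSmoothness (r := r) (N := N) 2
  have := isManifold_minSmoothness (r := r) (N := N) 3
  exact mpullback_mlieBracket (n := ∞) (hY.mdiffAt _) (hZ.mdiffAt _) (hσ q) minSmoothness_two_le

/-- Killing fields are mapped to Killing fields by an involutive isometry. -/
lemma IsKillingField.mpullback (hσ : IsIsometricImmersion g g σ) (hinv : Function.Involutive σ)
    {X : ∀ x : N, TangentSpace (𝓡 r) x} (hX : IsKillingField g X) :
    IsKillingField g (mpullback (𝓡 r) (𝓡 r) σ X) := by
  refine ⟨isSmoothField_mpullback hσ.1 hinv hX.1, fun Y Z hY hZ x => ?_⟩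
  -- The test fields are pullbacks of `Y'` and `Z'`, so the identity sought at `x` is the Killing
  -- identity of `X` at `σ x` for `Y', Z'`.
  set Y' := VectorField.mpullback (𝓡 r) (𝓡 r) σ Y with hY'
  set Z' := VectorField.mpullback (𝓡 r) (𝓡 r) σ Z with hZ'
  have eY : Y = VectorField.mpullback (𝓡 r) (𝓡 r) σ Y' := (mpullback_mpullback hσ.1 hinv Y).symm
  have eZ : Z = VectorField.mpullback (𝓡 r) (𝓡 r) σ Z' := (mpullback_mpullback hσ.1 hinv Z).symm
  have sY : IsSmoothField Y' := isSmoothField_mpullback hσ.1 hinv hY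
  have sZ : IsSmoothField Z' := isSmoothField_mpullback hσ.1 hinv hZ
  have h1 : (fun q => g.inner q (Y q) (Z q)) = (fun q => g.inner q (Y' q) (Z' q)) ∘ σ := by
    funext q
    rw [eY, eZ]
    exact inner_mpullback hσ hinv Y' Z' q
  have h2 : mvfderiv (𝓡 r) (fun q => g.inner q (Y q) (Z q)) x
      (VectorField.mpullback (𝓡 r) (𝓡 r) σ X x) =
      mvfderiv (𝓡 r) (fun q => g.inner q (Y' q) (Z' q)) (σ x) (X (σ x)) := by
    rw [h1]
    have h3 := mfderiv_comp (I' := 𝓡 r) x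
      ((smooth_inner g sY sZ (σ x)).mdifferentiableAt (by simp))
      ((hσ.1 x).mdifferentiableAt (by simp))
    have h4 := congrArg (fun l => l (VectorField.mpullback (𝓡 r) (𝓡 r) σ X x)) h3
    refine h4.trans ?_
    exact congrArg (mfderiv (𝓡 r) 𝓘(ℝ, ℝ) (fun q => g.inner q (Y' q) (Z' q)) (σ x))
      (mfderiv_mpullback hσ.1 hinv X x)
  rw [h2, hX.2 Y' Z' sY sZ (σ x), ← inner_mpullback hσ hinv, ← inner_mpullback hσ hinv,
    mpullback_mlieBracket_involutive hσ.1 hX.1 sY, mpullback_mlieBracket_involutive hσ.1 hX.1 sZ,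
    ← eY, ← eZ]

/-- The involution of the isometry algebra induced by an involutive isometry. -/
def inducedInvolution (hσ : IsIsometricImmersion g g σ) (hinv : Function.Involutive σ) :
    IsometryAlgebra g ≃ₗ⁅ℝ⁆ IsometryAlgebra g where
  toFun X := ⟨VectorField.mpullback (𝓡 r) (𝓡 r) σ (fun q => IsometryAlgebra.eval g q X),
    X.isKillingField.mpullback hσ hinv⟩
  map_add' X Y := IsometryAlgebra.ext fun p => by
    exact mpullback_add_apply (V := fun q => IsometryAlgebra.eval g q X)
      (V₁ := fun q => IsometryAlgebra.eval g q Y)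
  map_smul' c X := IsometryAlgebra.ext fun p => by
    exact mpullback_const_smul_apply (V := fun q => IsometryAlgebra.eval g q X)
  map_lie' {X Y} := IsometryAlgebra.ext fun p => by
    have h := mpullback_mlieBracket_involutive hσ.1 X.isKillingField.1 Y.isKillingField.1 p
    refine Eq.trans ?_ (congrArg Neg.neg h)
    exact mpullback_neg_apply
  invFun X := ⟨VectorField.mpullback (𝓡 r) (𝓡 r) σ (fun q => IsometryAlgebra.eval g q X),
    X.isKillingField.mpullback hσ hinv⟩
  left_inv X := IsometryAlgebra.ext fun p =>
    congrFun (mpullback_mpullback hσ.1 hinv fun q => IsometryAlgebra.eval g q X) p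
  right_inv X := IsometryAlgebra.ext fun p =>
    congrFun (mpullback_mpullback hσ.1 hinv fun q => IsometryAlgebra.eval g q X) p

lemma eval_inducedInvolution (hσ : IsIsometricImmersion g g σ) (hinv : Function.Involutive σ)
    (X : IsometryAlgebra g) (q : N) : IsometryAlgebra.eval g q (inducedInvolution hσ hinv X) =
      VectorField.mpullback (𝓡 r) (𝓡 r) σ (fun q => IsometryAlgebra.eval g q X) q := rfl

lemma inducedInvolution_involutive (hσ : IsIsometricImmersion g g σ)
    (hinv : Function.Involutive σ) (X : IsometryAlgebra g) :
    inducedInvolution hσ hinv (inducedInvolution hσ hinv X) = X :=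
  (inducedInvolution hσ hinv).left_inv X

lemma algebraForm_inducedInvolution (hσ : IsIsometricImmersion g g σ)
    (hinv : Function.Involutive σ) (X Y : IsometryAlgebra g) :
    algebraForm g (inducedInvolution hσ hinv X) (inducedInvolution hσ hinv Y) =
      algebraForm g X Y := by
  rw [algebraForm, LinearMap.neg_apply, LinearMap.neg_apply, LinearMap.neg_apply,
    LinearMap.neg_apply, LieAlgebra.killingForm_of_equiv_apply]

variable {s : N → N → N} {p : N}

/-- Since `s p` is its own inverse, pullback and push-forward along it agree. -/
lemma mem_minusSpace_iff (hs : IsSymmetryAt g p (s p)) (X : IsometryAlgebra g) :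
    X ∈ minusSpace g s p ↔ inducedInvolution hs.isometry hs.involutive X = -X := by
  have h : ∀ q : N, (IsometryAlgebra.eval g q (inducedInvolution hs.isometry hs.involutive X) =
      IsometryAlgebra.eval g q (-X) ↔ mfderiv (𝓡 r) (𝓡 r) (s p) q (IsometryAlgebra.eval g q X)
    = -IsometryAlgebra.eval g (s p q) X) := fun q => by
    rw [eval_inducedInvolution, mpullback_eq_iff hs.isometry.1 hs.involutive, map_neg, map_neg,
      neg_eq_iff_eq_neg]
  refine ⟨fun hX => IsometryAlgebra.ext fun q => (h q).2 (hX q), fun hX q => (h q).1 (by rw [hX])⟩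

/-- The difference of `Y` and its image lies in the `(-1)`-eigenspace and vanishes at `p`, so it is
zero. Thus the isotropy algebra lies in the `(+1)`-eigenspace. -/
lemma inducedInvolution_eq_self (hs : IsSymmetryAt g p (s p))
    (hinj : ∀ X ∈ minusSpace g s p, IsometryAlgebra.eval g p X = 0 → X = 0)
    {Y : IsometryAlgebra g} (hY : IsometryAlgebra.eval g p Y = 0) :
    inducedInvolution hs.isometry hs.involutive Y = Y := by
  rw [← sub_eq_zero]
  refine hinj _ ?_ ?_
  · rw [mem_minusSpace_iff hs, map_sub, inducedInvolution_involutive, neg_sub]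
  · rw [map_sub, hY, sub_zero, eval_inducedInvolution, mpullback_eq_iff hs.isometry.1 hs.involutive,
      map_zero, hs.fixed]
    exact hY.symm

/-- `X` and `Y` lie in opposite eigenspaces of an involution that preserves the form. -/
lemma algebraForm_eq_zero (hs : IsSymmetryAt g p (s p))
    (hinj : ∀ X ∈ minusSpace g s p, IsometryAlgebra.eval g p X = 0 → X = 0)
    {X Y : IsometryAlgebra g} (hX : X ∈ minusSpace g s p) (hY : IsometryAlgebra.eval g p Y = 0) :
    algebraForm g X Y = 0 := by
  have h := algebraForm_inducedInvolution hs.isometry hs.involutive X Y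
  rw [(mem_minusSpace_iff hs X).1 hX, inducedInvolution_eq_self hs hinj hY, map_neg,
    LinearMap.neg_apply] at h
  linarith

/-- The horizontal lift of tangent vectors to the isometry algebra. -/
lemma exists_lift (hs : IsSymmetryAt g p (s p)) (hcan : IsCanonicalMetric g s)
    (u : TangentSpace (𝓡 r) p) : ∃ X ∈ minusSpace g s p, IsometryAlgebra.eval g p X = u ∧
      ∀ Y, algebraForm g X Y = g.inner p u (IsometryAlgebra.eval g p Y) := by
  obtain ⟨e, he, hg⟩ := hcan p
  have hinj : ∀ X ∈ minusSpace g s p, IsometryAlgebra.eval g p X = 0 → X = 0 := by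
    intro X hX h0
    have h1 : e ⟨X, hX⟩ = 0 := by rw [he]; exact h0
    exact congrArg Subtype.val (e.map_eq_zero_iff.1 h1)
  have heu : ∀ u, IsometryAlgebra.eval g p (e.symm u) = u := fun u => by
    rw [← he, e.apply_symm_apply]
  refine ⟨e.symm u, (e.symm u).2, heu u, fun Y => ?_⟩
  set v := IsometryAlgebra.eval g p Y with hv
  -- `Y` differs from the lift of its value at `p` by a field vanishing at `p`, which is orthogonal
  -- to `𝔫_p`.
  have h1 : algebraForm g (e.symm u) (Y - e.symm v) = 0 :=
    algebraForm_eq_zero hs hinj (e.symm u).2 (by rw [map_sub, heu, ← hv, sub_self])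
  rw [map_sub, sub_eq_zero] at h1
  rw [h1, ← hg, e.apply_symm_apply, e.apply_symm_apply]

/-- The involution fixes the bracket, while the differential of `s p` is `-1` on `T_pN` because
`𝔫_p` fills the tangent space. The value at `p` is therefore its own negative. -/
lemma eval_lie_eq_zero (hs : IsSymmetryAt g p (s p)) (hcan : IsCanonicalMetric g s)
    {X Y : IsometryAlgebra g} (hX : X ∈ minusSpace g s p) (hY : Y ∈ minusSpace g s p) :
    IsometryAlgebra.eval g p ⁅X, Y⁆ = 0 := by
  have h1 : ∀ u : E r, (mfderiv (𝓡 r) (𝓡 r) (s p) p u : E r) = -u := by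
    intro u
    obtain ⟨Z, hZ, hu, -⟩ := exists_lift hs hcan u
    have h2 := hZ p
    rw [hu] at h2
    refine h2.trans ?_
    rw [hs.fixed, hu]
    rfl
  have h3 : inducedInvolution hs.isometry hs.involutive ⁅X, Y⁆ = ⁅X, Y⁆ := by
    rw [LieEquiv.map_lie, (mem_minusSpace_iff hs X).1 hX, (mem_minusSpace_iff hs Y).1 hY]
    simp
  have h4 : IsometryAlgebra.eval g p (inducedInvolution hs.isometry hs.involutive ⁅X, Y⁆) =
    IsometryAlgebra.eval g p ⁅X, Y⁆ := by rw [h3]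
  rw [eval_inducedInvolution, mpullback_eq_iff hs.isometry.1 hs.involutive] at h4
  have h5 : (IsometryAlgebra.eval g (s p p) ⁅X, Y⁆ : E r) = IsometryAlgebra.eval g p ⁅X, Y⁆ := by
    rw [hs.fixed]
  have h6 : -(IsometryAlgebra.eval g p ⁅X, Y⁆ : E r) = IsometryAlgebra.eval g p ⁅X, Y⁆ :=
    (h1 _).symm.trans (h4.trans h5)
  have h7 : ∀ v : E r, -v = v → v = 0 := fun v h => by
    ext i
    have := congrArg (fun w : E r => w i) h
    simp only [PiLp.neg_apply] at this
    exact self_eq_neg.1 this.symm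
  exact h7 _ h6

end Involution

end TraceFormula
end

noncomputable section

namespace TraceFormula

/-! ### The Killing fields of a symmetric space in a chart -/

section KillingChart

open VectorField

variable {r : ℕ} {N : Type*} [TopologicalSpace N] [ChartedSpace (E r) N] [IsManifold (𝓡 r) ∞ N]
  {g : Metric r N} {p : N}

/-- The coordinates of a vector field in the preferred chart at `p`. -/
def chartField (p : N) (Y : ∀ x : N, TangentSpace (𝓡 r) x) (z : E r) : E r :=
  coordVec p ((extChartAt (𝓡 r) p).symm z) (Y ((extChartAt (𝓡 r) p).symm z))

lemma chartFrame_chartField {z : E r} (hz : z ∈ (extChartAt (𝓡 r) p).target)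
    (Y : ∀ x : N, TangentSpace (𝓡 r) x) :
    chartFrame p z (chartField p Y z) = Y ((extChartAt (𝓡 r) p).symm z) :=
  chartFrame_coordVec hz _

lemma chartMetric_chartField {z : E r} (hz : z ∈ (extChartAt (𝓡 r) p).target)
    (Y Z : ∀ x : N, TangentSpace (𝓡 r) x) :
    chartMetric g p z (chartField p Y z) (chartField p Z z) =
      g.inner ((extChartAt (𝓡 r) p).symm z) (Y ((extChartAt (𝓡 r) p).symm z))
        (Z ((extChartAt (𝓡 r) p).symm z)) := by
  rw [chartMetric_apply, chartFrame_chartField hz, chartFrame_chartField hz]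

lemma contDiffAt_chartField {Y : ∀ x : N, TangentSpace (𝓡 r) x} (hY : IsSmoothField Y) {z : E r}
    (hz : z ∈ (extChartAt (𝓡 r) p).target) : ContDiffAt ℝ ∞ (chartField p Y) z := by
  have h1 := (hY _).comp z (contMDiffAt_chart_symm hz)
  exact (contMDiffAt_coordVec (p := p) (h := fun z => (extChartAt (𝓡 r) p).symm z)
      (W := fun z => Y ((extChartAt (𝓡 r) p).symm z)) ((extChartAt (𝓡 r) p).map_target hz)
      h1).contDiffAt

lemma chartField_eq_mpullback {z : E r} (hz : z ∈ (extChartAt (𝓡 r) p).target)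
    (Y : ∀ x : N, TangentSpace (𝓡 r) x) :
    mpullback 𝓘(ℝ, E r) (𝓡 r) (extChartAt (𝓡 r) p).symm Y z = chartField p Y z := by
  have hi := isInvertible_chartFrame hz
  refine hi.injective ?_
  rw [mpullback_apply]
  refine (hi.self_apply_inverse _).trans (chartFrame_chartField hz Y).symm

lemma chartField_mlieBracket {Y Z : ∀ x : N, TangentSpace (𝓡 r) x} (hY : IsSmoothField Y)
    (hZ : IsSmoothField Z) {z : E r} (hz : z ∈ (extChartAt (𝓡 r) p).target) :
    chartField p (mlieBracket (𝓡 r) Y Z) z =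
      fderiv ℝ (chartField p Z) z (chartField p Y z)
        - fderiv ℝ (chartField p Y) z (chartField p Z z) := by
  have := isManifold_minSmoothness (r := r) (N := N) 2
  have := isManifold_minSmoothness (r := r) (N := N) 3
  have h1 := mpullback_mlieBracket (n := ∞) (hY.mdiffAt _) (hZ.mdiffAt _)
    (contMDiffAt_chart_symm hz) minSmoothness_two_le
  have h2 : ∀ Y : (∀ x : N, TangentSpace (𝓡 r) x),
      mpullback 𝓘(ℝ, E r) (𝓡 r) (extChartAt (𝓡 r) p).symm Y =ᶠ[𝓝 z] chartField p Y := fun Y => by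
    filter_upwards [(isOpen_extChartAt_target p).mem_nhds hz] with z hz
    exact chartField_eq_mpullback hz Y
  rw [chartField_eq_mpullback hz, Filter.EventuallyEq.mlieBracket_vectorField_eq (h2 Y) (h2 Z)] at h1
  have h3 := congrFun (mlieBracketWithin_eq_lieBracketWithin (𝕜 := ℝ) (V := chartField p Y)
    (W := chartField p Z) (s := Set.univ)) z
  rw [lieBracketWithin_univ] at h3
  exact h1.trans h3

lemma fderiv_chart_inner {Y Z : ∀ x : N, TangentSpace (𝓡 r) x} (hY : IsSmoothField Y)
    (hZ : IsSmoothField Z) {z : E r} (hz : z ∈ (extChartAt (𝓡 r) p).target) (v : E r) :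
    fderiv ℝ (fun z => chartMetric g p z (chartField p Y z) (chartField p Z z)) z v =
      mvfderiv (𝓡 r) (fun q => g.inner q (Y q) (Z q)) ((extChartAt (𝓡 r) p).symm z)
        (chartFrame p z v) := by
  have h1 : (fun z => chartMetric g p z (chartField p Y z) (chartField p Z z)) =ᶠ[𝓝 z]
      (fun q => g.inner q (Y q) (Z q)) ∘ (extChartAt (𝓡 r) p).symm := by
    filter_upwards [(isOpen_extChartAt_target p).mem_nhds hz] with z hz
    exact chartMetric_chartField hz Y Z
  have h2 := mfderiv_comp (I' := 𝓡 r) z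
    ((smooth_inner g hY hZ ((extChartAt (𝓡 r) p).symm z)).mdifferentiableAt (by simp))
    ((contMDiffAt_chart_symm hz).mdifferentiableAt (by simp))
  rw [h1.fderiv_eq, ← mfderiv_eq_fderiv, h2]
  rfl

/-- The Killing equation in a chart. -/
lemma IsKillingField.chart {X Y Z : ∀ x : N, TangentSpace (𝓡 r) x} (hX : IsKillingField g X)
    (hY : IsSmoothField Y) (hZ : IsSmoothField Z) {z : E r}
    (hz : z ∈ (extChartAt (𝓡 r) p).target) :
    fderiv ℝ (chartMetric g p) z (chartField p X z) (chartField p Y z) (chartField p Z z)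
      + chartMetric g p z (fderiv ℝ (chartField p X) z (chartField p Y z)) (chartField p Z z)
      + chartMetric g p z (chartField p Y z) (fderiv ℝ (chartField p X) z (chartField p Z z))
      = 0 := by
  have hd : ∀ {Y : ∀ x : N, TangentSpace (𝓡 r) x}, IsSmoothField Y →
      DifferentiableAt ℝ (chartField p Y) z :=
    fun hY => (contDiffAt_chartField hY hz).differentiableAt (by simp)
  have hG : DifferentiableAt ℝ (chartMetric g p) z :=
    (contDiffAt_chartMetric g hz).differentiableAt (by simp)
  have h1 := hX.2 Y Z hY hZ ((extChartAt (𝓡 r) p).symm z)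
  rw [← chartFrame_chartField hz X, ← fderiv_chart_inner hY hZ hz] at h1
  have h2 := chartMetric_chartField (g := g) hz (VectorField.mlieBracket (𝓡 r) X Y) Z
  have h3 := chartMetric_chartField (g := g) hz Y (VectorField.mlieBracket (𝓡 r) X Z)
  rw [← h2, ← h3, chartField_mlieBracket hX.1 hY hz,
    chartField_mlieBracket hX.1 hZ hz, fderiv_clm (hG.clm_apply (hd hY)) (hd hZ),
    fderiv_clm hG (hd hY)] at h1
  simp only [map_sub, sub_apply, add_apply] at h1
  linarith

variable {d : ℕ} (κ : E d ≃ₗ[ℝ] IsometryAlgebra g)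

/-- The Killing fields in the preferred chart at `p`, parametrised by `ℝᵈ`. -/
def killingChart (p : N) (z : E r) : E d →L[ℝ] E r :=
  LinearMap.toContinuousLinearMap
    ((mfderiv (𝓡 r) 𝓘(ℝ, E r) (extChartAt (𝓡 r) p) ((extChartAt (𝓡 r) p).symm z)).toLinearMap.comp
      ((IsometryAlgebra.eval g ((extChartAt (𝓡 r) p).symm z)).comp κ.toLinearMap))

lemma killingChart_apply (p : N) (z : E r) (c : E d) :
    killingChart κ p z c = chartField p (fun q => IsometryAlgebra.eval g q (κ c)) z := rfl

lemma contDiffAt_killingChart {z : E r} (hz : z ∈ (extChartAt (𝓡 r) p).target) :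
    ContDiffAt ℝ ∞ (killingChart κ p) z := by
  have h1 : ContDiffOn ℝ ∞ (killingChart κ p) (extChartAt (𝓡 r) p).target := by
    rw [contDiffOn_clm_apply]
    intro c z hz
    exact (contDiffAt_chartField (κ c).isKillingField.1 hz).contDiffWithinAt
  exact (h1 z hz).contDiffAt ((isOpen_extChartAt_target p).mem_nhds hz)

lemma fderiv_killingChart {z : E r} (hz : z ∈ (extChartAt (𝓡 r) p).target) (u : E r) (c : E d) :
    fderiv ℝ (killingChart κ p) z u c =
      fderiv ℝ (chartField p fun q => IsometryAlgebra.eval g q (κ c)) z u := by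
  have := fderiv_apply_const ((contDiffAt_killingChart κ hz).differentiableAt (by simp)) c u
  exact this.symm

/-- The form `⟨ , ⟩_𝔤` on `ℝᵈ`. -/
def paramForm : E d →L[ℝ] E d →L[ℝ] ℝ :=
  LinearMap.toContinuousBilinearMap ((algebraForm g).compl₁₂ κ.toLinearMap κ.toLinearMap)

lemma paramForm_apply (x y : E d) : paramForm κ x y = algebraForm g (κ x) (κ y) := rfl

lemma paramForm_symm (x y : E d) : paramForm κ x y = paramForm κ y x := by
  rw [paramForm_apply, paramForm_apply, algebraForm, LinearMap.neg_apply, LinearMap.neg_apply,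
    LinearMap.neg_apply, LinearMap.neg_apply, LieModule.traceForm_comm]

/-- Raising the index by a fixed linear map makes the lift a smooth function of the point by
construction. -/
lemma exists_raise {B : E d →L[ℝ] E d →L[ℝ] ℝ} (hB : ∀ x, (∀ y, B x y = 0) → x = 0) :
    ∃ R : (E d →L[ℝ] ℝ) →L[ℝ] E d, ∀ α c, B (R α) c = α c := by
  have hinj : Function.Injective B.toLinearMap :=
    (injective_iff_map_eq_zero _).2 fun x hx => hB x fun y => by
      have := congrArg (fun l => l y) hx
      simpa using this
  have hfr : Module.finrank ℝ (E d) = Module.finrank ℝ (E d →L[ℝ] ℝ) := by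
    rw [(LinearMap.toContinuousLinearMap (𝕜 := ℝ) (E := E d) (F' := ℝ)).symm.finrank_eq]
    exact (Subspace.dual_finrank_eq (K := ℝ) (V := E d)).symm
  let e := LinearEquiv.ofInjectiveOfFinrankEq B.toLinearMap hinj hfr
  refine ⟨LinearMap.toContinuousLinearMap e.symm.toLinearMap, fun α c => ?_⟩
  have : e (e.symm α) = α := e.apply_symm_apply α
  exact congrArg (fun l => l c) this

/-- The lift of tangent vectors to `ℝᵈ` determined by `B(Lu, c) = ⟨u, X_c⟩`. -/
def liftChart (R : (E d →L[ℝ] ℝ) →L[ℝ] E d) (p : N) (z : E r) : E r →L[ℝ] E d :=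
  (R.comp ((ContinuousLinearMap.compL ℝ (E d) (E r) ℝ).flip (killingChart κ p z))).comp
    (chartMetric g p z)

lemma liftChart_dual {R : (E d →L[ℝ] ℝ) →L[ℝ] E d} (hR : ∀ α c, paramForm κ (R α) c = α c)
    (z u : E r) (c : E d) :
    paramForm κ (liftChart κ R p z u) c = chartMetric g p z u (killingChart κ p z c) := by
  rw [liftChart, ContinuousLinearMap.comp_apply, ContinuousLinearMap.comp_apply, hR]
  rfl

lemma contDiffAt_liftChart (R : (E d →L[ℝ] ℝ) →L[ℝ] E d) {z : E r}
    (hz : z ∈ (extChartAt (𝓡 r) p).target) : ContDiffAt ℝ ∞ (liftChart κ R p) z := by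
  have h1 : ContDiffOn ℝ ∞ (liftChart κ R p) (extChartAt (𝓡 r) p).target := by
    rw [contDiffOn_clm_apply]
    intro u z hz
    have h2 : ContDiffAt ℝ ∞ (fun z => (chartMetric g p z u).comp (killingChart κ p z)) z :=
      ((contDiffAt_chartMetric g hz).clm_apply contDiffAt_const).clm_comp
        (contDiffAt_killingChart κ hz)
    exact (contDiffAt_const.clm_apply h2 : ContDiffAt ℝ ∞ (fun z => R
      ((chartMetric g p z u).comp (killingChart κ p z))) z).contDiffWithinAt
  exact (h1 z hz).contDiffAt ((isOpen_extChartAt_target p).mem_nhds hz)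

variable {s : N → N → N}

/-- By nondegeneracy the lift defined by duality, whose smoothness is clear, equals the horizontal
lift of `exists_lift`, whose membership in `𝔫` is clear. -/
lemma liftChart_mem (hs : ∀ p, IsSymmetryAt g p (s p)) (hcan : IsCanonicalMetric g s)
    (hnd : ∀ x, (∀ y, paramForm κ x y = 0) → x = 0)
    {R : (E d →L[ℝ] ℝ) →L[ℝ] E d} (hR : ∀ α c, paramForm κ (R α) c = α c)
    {z : E r} (hz : z ∈ (extChartAt (𝓡 r) p).target) (u : E r) :
    κ (liftChart κ R p z u) ∈ minusSpace g s ((extChartAt (𝓡 r) p).symm z) ∧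
      killingChart κ p z (liftChart κ R p z u) = u := by
  obtain ⟨X, hX, hXu, hd⟩ := exists_lift (hs _) hcan (chartFrame p z u)
  have h1 : liftChart κ R p z u = κ.symm X := by
    rw [← sub_eq_zero]
    refine hnd _ fun c => ?_
    rw [map_sub, sub_apply, liftChart_dual κ hR, paramForm_apply κ (κ.symm X),
      κ.apply_symm_apply, hd, chartMetric_apply, killingChart_apply, chartFrame_chartField hz,
      sub_self]
  rw [h1, κ.apply_symm_apply]
  refine ⟨hX, ?_⟩
  rw [killingChart_apply, κ.apply_symm_apply, chartField, hXu, coordVec_chartFrame hz]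

/-- The Killing fields of a symmetric space with its canonical metric form a Killing frame. -/
lemma isKillingFrame (hs : ∀ p, IsSymmetryAt g p (s p)) (hcan : IsCanonicalMetric g s)
    (hnd : ∀ x, (∀ y, paramForm κ x y = 0) → x = 0)
    {R : (E d →L[ℝ] ℝ) →L[ℝ] E d} (hR : ∀ α c, paramForm κ (R α) c = α c)
    {z : E r} (hz : z ∈ (extChartAt (𝓡 r) p).target) :
    IsKillingFrame (paramForm κ) (chartMetric g p) (killingChart κ p) (liftChart κ R p) z := by
  have hnhds := (isOpen_extChartAt_target (I := 𝓡 r) p).mem_nhds hz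
  refine ⟨isMetricNear_chartMetric g hz, ?_, ?_, ?_, ?_, ?_, ?_⟩
  · filter_upwards [hnhds] with z hz
    exact contDiffAt_killingChart κ hz
  · filter_upwards [hnhds] with z hz
    exact contDiffAt_liftChart κ R hz
  · exact Filter.Eventually.of_forall fun z u c => liftChart_dual κ hR z u c
  · filter_upwards [hnhds] with z hz u
    exact (liftChart_mem κ hs hcan hnd hR hz u).2
  · filter_upwards [hnhds] with z hz c v w
    -- The Killing equation is stated for global test fields; the Killing fields of the lifts take
    -- the prescribed values `v, w` at the point.
    have h1 := (κ c).isKillingField.chart (κ (liftChart κ R p z v)).isKillingField.1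
      (κ (liftChart κ R p z w)).isKillingField.1 hz
    rw [← killingChart_apply, ← killingChart_apply, ← killingChart_apply,
      (liftChart_mem κ hs hcan hnd hR hz v).2, (liftChart_mem κ hs hcan hnd hR hz w).2] at h1
    rw [fderiv_killingChart κ hz, fderiv_killingChart κ hz]
    exact h1
  · filter_upwards [hnhds] with z hz u v
    obtain ⟨hu, hu'⟩ := liftChart_mem κ hs hcan hnd hR hz u
    obtain ⟨hv, hv'⟩ := liftChart_mem κ hs hcan hnd hR hz v
    -- The bracket of the two lifted fields vanishes at this point, and in coordinates it is the
    -- difference of the two derivatives.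
    have h1 := eval_lie_eq_zero (hs _) hcan hu hv
    rw [IsometryAlgebra.eval_lie, neg_eq_zero] at h1
    have h2 := chartField_mlieBracket (κ (liftChart κ R p z u)).isKillingField.1
      (κ (liftChart κ R p z v)).isKillingField.1 hz
    rw [chartField, h1, ← killingChart_apply, ← killingChart_apply, hu', hv', coordVec, map_zero] at h2
    rw [fderiv_killingChart κ hz, fderiv_killingChart κ hz]
    exact (sub_eq_zero.1 h2.symm)

end KillingChart

end TraceFormula
end

noncomputable section

namespace TraceFormula

/-! ### Norm of the second fundamental form and energy in coordinates -/

section Coordinates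

variable {n : ℕ} {V : Type*} [NormedAddCommGroup V] [NormedSpace ℝ V]
  {G : E n → E n →L[ℝ] E n →L[ℝ] ℝ} {y : E n}

lemma laplacian_congr {φ ψ : E n → ℝ} (h : φ =ᶠ[𝓝 y] ψ) : laplacian G φ y = laplacian G ψ y := by
  have h1 := h.fderiv (𝕜 := ℝ)
  rw [laplacian, laplacian]
  congr 1
  funext u v
  rw [covDerivOneForm, covDerivOneForm, h1.fderiv_eq, h1.self_of_nhds]

lemma metricNormSq_eq {b : E n →L[ℝ] E n →L[ℝ] ℝ} {e : Module.Basis (Fin n) ℝ (E n)}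
    (he : IsOrthonormalFor b e) {A : E n → E n → ℝ} (hA : IsBilin A) :
    metricNormSq b A = ∑ a, ∑ c, A (e a) (e c) ^ 2 := by
  have h1 : ∀ u v, metricTrace b (fun u' v' => A u u' * A v v') = ∑ c, A u (e c) * A v (e c) :=
    fun u v => metricTrace_eq he
      ⟨fun _ _ _ => by rw [hA.add_right]; ring, fun _ _ _ => by
        rw [hA.smul_right]; simp only [smul_eq_mul]; ring, fun _ _ _ => by rw [hA.add_right]; ring,
        fun _ _ _ => by rw [hA.smul_right]; simp only [smul_eq_mul]; ring⟩
  rw [metricNormSq]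
  simp only [h1]
  rw [metricTrace_eq he]
  · exact Finset.sum_congr rfl fun a _ => Finset.sum_congr rfl fun c _ => (sq _).symm
  · constructor
    · intro u u' v
      rw [← Finset.sum_add_distrib]
      exact Finset.sum_congr rfl fun c _ => by rw [hA.add_left]; ring
    · intro a u v
      rw [Finset.smul_sum]
      exact Finset.sum_congr rfl fun c _ => by rw [hA.smul_left]; simp only [smul_eq_mul]; ring
    · intro u v v'
      rw [← Finset.sum_add_distrib]
      exact Finset.sum_congr rfl fun c _ => by rw [hA.add_left]; ring
    · intro a u v
      rw [Finset.smul_sum]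
      exact Finset.sum_congr rfl fun c _ => by rw [hA.smul_left]; simp only [smul_eq_mul]; ring

lemma isBilin_inner_covSecondDeriv {m : ℕ} {f : E m → E n} {z : E m} (hb : IsInner (G (f z)))
    (ξ : E n) : IsBilin fun u v => G (f z) (covSecondDeriv G f z u v) ξ := by
  have h := isBilin_christoffel hb
  constructor
  · intro u u' v; simp only [covSecondDeriv, map_add, add_apply, h.add_left]; ring
  · intro a u v; simp only [covSecondDeriv, map_add, map_smul, add_apply, smul_apply, h.smul_left,
      smul_eq_mul]; ring
  · intro u v v'; simp only [covSecondDeriv, map_add, add_apply, h.add_right]; ring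
  · intro a u v; simp only [covSecondDeriv, map_add, map_smul, add_apply, smul_apply, h.smul_right,
      smul_eq_mul]; ring

lemma covSecondDeriv_symm {m : ℕ} {f : E m → E n} {z : E m} (hG : IsMetricNear G (f z))
    (hf : ContDiffAt ℝ ∞ f z) (u v : E m) :
    covSecondDeriv G f z u v = covSecondDeriv G f z v u := by
  rw [covSecondDeriv, covSecondDeriv, fderiv_fderiv_comm hf, hG.christoffel_symm]

/-- The energy density of a unit normal field in terms of the Laplacian of its components. -/
lemma IsNormalFrame.energy_eq {d : ℕ} {B : E d →L[ℝ] E d →L[ℝ] ℝ} {Θ : E n → E n →L[ℝ] E d}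
    {N : E n → E d} (hB : ∀ x x', B x x' = B x' x) (hb : IsInner (G y))
    (hN : IsNormalFrame B Θ N y) {e : Module.Basis (Fin n) ℝ (E n)} (he : IsOrthonormalFor (G y) e) :
    ∑ a, B (fderiv ℝ N y (e a)) (fderiv ℝ N y (e a)) =
      -∑ k, B (N y) (stdVec k) * laplacian G (fun z => N z k) y := by
  have h1 : ∀ (k : Fin d) u v, hess G (fun z => N z k) y u v = hess G N y u v k := by
    intro k u v
    let ℓ : E d →L[ℝ] ℝ := EuclideanSpace.proj k
    have h2 := hess_bilin (G := G) (ContinuousLinearMap.id ℝ (E d →L[ℝ] ℝ))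
      (a := fun _ : E n => ℓ) (Filter.Eventually.of_forall fun _ => contDiffAt_const) hN.smooth u v
    have h3 : hess G (fun _ : E n => ℓ) y u v = 0 := by simp [hess]
    rw [h3] at h2
    simp only [fderiv_fun_const, Pi.zero_apply, zero_apply, map_zero, zero_add] at h2
    exact h2
  have h4 : ∀ u, B (N y) (hess G N y u u) =
      ∑ k, B (N y) (stdVec k) * hess G (fun z => N z k) y u u := by
    intro u
    conv_lhs => rw [stdVec_repr (hess G N y u u)]
    simp only [map_sum, map_smul, smul_eq_mul, h1]
    exact Finset.sum_congr rfl fun k _ => mul_comm _ _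
  have h5 : ∀ u, B (fderiv ℝ N y u) (fderiv ℝ N y u) =
      -∑ k, B (N y) (stdVec k) * hess G (fun z => N z k) y u u := fun u => by
    rw [← h4, hN.hess_perp hB, neg_neg]
  simp only [h5, laplacian_eq_sum_hess hb he, Finset.mul_sum]
  rw [Finset.sum_neg_distrib, Finset.sum_comm]

end Coordinates

/-! ### Lifts of tangent vectors to `ℝᵈ` and coefficients of bivectors -/

section Lift

variable {r d : ℕ} {N : Type*} [TopologicalSpace N] [ChartedSpace (E r) N] [IsManifold (𝓡 r) ∞ N]
  {g : Metric r N} (κ : E d ≃ₗ[ℝ] IsometryAlgebra g) (R : (E d →L[ℝ] ℝ) →L[ℝ] E d)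

/-- The lift of a tangent vector of `N` to `ℝᵈ`. -/
def liftVec (q : N) (u : TangentSpace (𝓡 r) q) : E d :=
  R (LinearMap.toContinuousLinearMap
    ((tangentForm g q u).comp ((IsometryAlgebra.eval g q).comp κ.toLinearMap)))

variable {R} in
lemma liftVec_dual (hR : ∀ α c, paramForm κ (R α) c = α c) (q : N) (u : TangentSpace (𝓡 r) q)
    (c : E d) : paramForm κ (liftVec κ R q u) c =
      g.inner q u (IsometryAlgebra.eval g q (κ c)) := by
  rw [liftVec, hR]
  rfl

lemma liftChart_coordVec {p x : N} (hx : x ∈ (extChartAt (𝓡 r) p).source)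
    (u : TangentSpace (𝓡 r) x) :
    liftChart κ R p (extChartAt (𝓡 r) p x) (coordVec p x u) = liftVec κ R x u := by
  rw [liftChart, liftVec, ContinuousLinearMap.comp_apply, ContinuousLinearMap.comp_apply]
  congr 1
  ext c
  have := chartMetric_coordVec g hx u (IsometryAlgebra.eval g x (κ c))
  refine Eq.trans ?_ this
  simp only [ContinuousLinearMap.flip_apply, ContinuousLinearMap.compL_apply,
    ContinuousLinearMap.comp_apply, killingChart_apply, chartField]
  rw [(extChartAt (𝓡 r) p).left_inv hx]

/-- The coefficient `⟨x ∧ y, v⟩` as a bilinear form. -/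
def wedgeCoeff (v : ⋀[ℝ]^2 (IsometryAlgebra g)) : E d →L[ℝ] E d →L[ℝ] ℝ :=
  LinearMap.toContinuousBilinearMap
    (((wedgeLin (IsometryAlgebra g)).compr₂ ((wedgeForm (algebraForm g)).flip v)).compl₁₂
      κ.toLinearMap κ.toLinearMap)

lemma wedgeCoeff_apply (v : ⋀[ℝ]^2 (IsometryAlgebra g)) (x y : E d) :
    wedgeCoeff κ v x y = wedgeForm (algebraForm g) (wedge (κ x) (κ y)) v := rfl

/-- Provides the hypothesis on `κ` in `local_trace_identity`: Parseval on `∧²𝔤`, then the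
determinant formula. -/
lemma sum_wedgeCoeff {ι : Type*} [Fintype ι] [DecidableEq ι]
    {β : Module.Basis ι ℝ (⋀[ℝ]^2 (IsometryAlgebra g))}
    (hβ : ∀ i j, wedgeForm (algebraForm g) (β i) (β j) = if i = j then 1 else 0) (x x' z z' : E d) :
    ∑ i, wedgeCoeff κ (β i) x x' * wedgeCoeff κ (β i) z z' =
      paramForm κ x z * paramForm κ x' z' - paramForm κ x z' * paramForm κ x' z := by
  simp only [wedgeCoeff_apply, paramForm_apply]
  rw [← wedgeForm_wedge_wedge, ← wedgeForm_eq_sum β hβ]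

end Lift

/-! ### The test functions through lifts, and the frames of `M` and `Σ` -/

section Hypersurface

variable {m r d : ℕ}
  {N : Type*} [TopologicalSpace N] [ChartedSpace (E r) N] [IsManifold (𝓡 r) ∞ N]
  {M : Type*} [TopologicalSpace M] [ChartedSpace (E (m + 1)) M] [IsManifold (𝓡 (m + 1)) ∞ M]
  {S : Type*} [TopologicalSpace S] [ChartedSpace (E m) S] [IsManifold (𝓡 m) ∞ S]
  {gN : Metric r N} {gM : Metric (m + 1) M} {gS : Metric m S}
  (κ : E d ≃ₗ[ℝ] IsometryAlgebra gN) (R : (E d →L[ℝ] ℝ) →L[ℝ] E d)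
  (F : M → N) (f : S → M) (ν : ∀ q : S, TangentSpace (𝓡 (m + 1)) (f q))
  (T : ∀ q : S, TangentSpace (𝓡 m) q)

/-- The lift of a vector field along `f` to `ℝᵈ`. -/
def fieldLift (q : S) : E d := liftVec κ R (F (f q)) (mfderiv (𝓡 (m + 1)) (𝓡 r) F (f q) (ν q))

-- Lifting is adjoint to evaluation, so the dependence on the point moves entirely into the lifts of
-- `ν` and `T`, and `v` is paired as a constant bivector.
variable {R} in
lemma testFunction_eq (hR : ∀ α c, paramForm κ (R α) c = α c)
    (v : ⋀[ℝ]^2 (IsometryAlgebra gN)) (q : S) :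
    testFunction gN F f ν T v q = wedgeCoeff κ v (fieldLift κ R F f ν q)
      (fieldLift κ R F f (fun q => mfderiv (𝓡 m) (𝓡 (m + 1)) f q (T q)) q) := by
  rw [testFunction, wedgeCoeff_apply]
  refine wedgeForm_comp _ _ _ (fun z => ?_) (fun z => ?_) v
  · obtain ⟨c, rfl⟩ := κ.surjective z
    exact (liftVec_dual κ hR _ _ c).symm
  · obtain ⟨c, rfl⟩ := κ.surjective z
    exact (liftVec_dual κ hR _ _ c).symm

/-- The frame of `M` induced by the immersion into `N`, in the preferred chart at `x`. -/
def ambientFrame (x : M) : E (m + 1) → E (m + 1) →L[ℝ] E d :=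
  pullFrame (liftChart κ R (F x)) (localMap F x)

variable {F f}

lemma ambientFrame_coordVec (hF : ContMDiff (𝓡 (m + 1)) (𝓡 r) ∞ F) {x x' : M}
    (hx : x' ∈ (extChartAt (𝓡 (m + 1)) x).source) (hFx : F x' ∈ (extChartAt (𝓡 r) (F x)).source)
    (u : TangentSpace (𝓡 (m + 1)) x') :
    ambientFrame κ R F x (extChartAt (𝓡 (m + 1)) x x') (coordVec x x' u) =
      liftVec κ R (F x') (mfderiv (𝓡 (m + 1)) (𝓡 r) F x' u) := by
  rw [ambientFrame, pullFrame_apply, fderiv_localMap_coordVec hF hx hFx, localMap_chart hx,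
    liftChart_coordVec κ R hFx]

/-- The points of the chart at `p` which are mapped to the charts at `f p` and `F (f p)`. -/
def goodSet₂ (r : ℕ) {N : Type*} [TopologicalSpace N] [ChartedSpace (E r) N] (F : M → N) (f : S → M)
    (p : S) : Set (E m) :=
  goodSet (m + 1) f p ∩
    localMap (m := m) (n := m + 1) f p ⁻¹' goodSet (m := m + 1) r F (f p)

lemma goodSet₂_mem_nhds (hF : Continuous F) (hf : ContMDiff (𝓡 m) (𝓡 (m + 1)) ∞ f) {p : S} {y : E m}
    (hy : y ∈ goodSet₂ r F f p) : goodSet₂ r F f p ∈ 𝓝 y :=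
  Filter.inter_mem (goodSet_mem_nhds hf.continuous hy.1)
    ((contDiffAt_localMap hf hy.1).continuousAt.preimage_mem_nhds (goodSet_mem_nhds hF hy.2))

lemma self_mem_goodSet₂ {p : S} : extChartAt (𝓡 m) p p ∈ goodSet₂ r F f p := by
  refine ⟨self_mem_goodSet, ?_⟩
  rw [Set.mem_preimage, localMap_self]
  exact self_mem_goodSet

lemma mem_source_of_mem_goodSet₂ {p : S} {y : E m} (hy : y ∈ goodSet₂ r F f p) :
    F (f ((extChartAt (𝓡 m) p).symm y)) ∈ (extChartAt (𝓡 r) (F (f p))).source := by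
  have := hy.2.2
  rwa [Set.mem_preimage, Set.mem_preimage, localMap,
    (extChartAt (𝓡 (m + 1)) (f p)).left_inv hy.1.2] at this

lemma ambientFrame_localField (hF : ContMDiff (𝓡 (m + 1)) (𝓡 r) ∞ F) {p : S} {y : E m}
    (hy : y ∈ goodSet₂ r F f p) :
    ambientFrame κ R F (f p) (localMap f p y) (localField f ν p y) =
      fieldLift κ R F f ν ((extChartAt (𝓡 m) p).symm y) :=
  ambientFrame_coordVec κ R hF hy.1.2 (mem_source_of_mem_goodSet₂ hy) _

lemma pullFrame_ambientFrame (hF : ContMDiff (𝓡 (m + 1)) (𝓡 r) ∞ F)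
    (hf : ContMDiff (𝓡 m) (𝓡 (m + 1)) ∞ f) {p : S} {y : E m}
    (hy : y ∈ goodSet₂ r F f p) {u : E m}
    (hu : chartFrame p y u = T ((extChartAt (𝓡 m) p).symm y)) :
    pullFrame (ambientFrame (m := m) κ R F (f p)) (localMap f p) y u =
      fieldLift κ R F f (fun q => mfderiv (𝓡 m) (𝓡 (m + 1)) f q (T q))
        ((extChartAt (𝓡 m) p).symm y) := by
  rw [pullFrame_apply, fderiv_localMap hf hy.1, hu]
  exact ambientFrame_coordVec κ R hF hy.1.2 (mem_source_of_mem_goodSet₂ hy) _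

variable {R} {s : N → N → N}

lemma isIsometricFrame_ambient (hs : ∀ p, IsSymmetryAt gN p (s p)) (hcan : IsCanonicalMetric gN s)
    (hnd : ∀ x, (∀ y, paramForm κ x y = 0) → x = 0) (hR : ∀ α c, paramForm κ (R α) c = α c)
    (hF : IsIsometricImmersion gM gN F) {x : M} {y : E (m + 1)} (hy : y ∈ goodSet r F x) :
    IsIsometricFrame (paramForm κ) (chartMetric gM x) (ambientFrame κ R F x) y :=
  (isKillingFrame κ hs hcan hnd hR
    ((extChartAt (𝓡 r) (F x)).map_source hy.2)).isIsometricFrame.pullback (paramForm_symm κ)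
    (hF.isLocalIsometry hy) (isMetricNear_chartMetric gM hy.1)

lemma isIsometricFrame_hypersurface (hs : ∀ p, IsSymmetryAt gN p (s p))
    (hcan : IsCanonicalMetric gN s)
    (hnd : ∀ x, (∀ y, paramForm κ x y = 0) → x = 0) (hR : ∀ α c, paramForm κ (R α) c = α c)
    (hF : IsIsometricImmersion gM gN F) (hf : IsIsometricImmersion gS gM f) {p : S} {y : E m}
    (hy : y ∈ goodSet₂ r F f p) :
    IsIsometricFrame (paramForm κ) (chartMetric gS p)
      (pullFrame (ambientFrame (m := m) κ R F (f p)) (localMap f p)) y :=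
  (isIsometricFrame_ambient κ hs hcan hnd hR hF hy.2).pullback (paramForm_symm κ)
    (hf.isLocalIsometry hy.1) (isMetricNear_chartMetric gS hy.1.1)

/-- For a totally geodesic immersion the frame form of `M` is the restriction of that of `N`, which
is skew. The centre of the chart is enough for the pointwise identities. -/
lemma frameForm_ambientFrame_skew (hs : ∀ p, IsSymmetryAt gN p (s p))
    (hcan : IsCanonicalMetric gN s)
    (hnd : ∀ x, (∀ y, paramForm κ x y = 0) → x = 0) (hR : ∀ α c, paramForm κ (R α) c = α c)
    (hF : IsIsometricImmersion gM gN F) (hFgeo : IsTotallyGeodesic (m + 1) gN F) (x : M)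
    (u v : E (m + 1)) :
    frameForm (chartMetric gM x) (ambientFrame κ R F x) (extChartAt (𝓡 (m + 1)) x x) u v =
      -frameForm (chartMetric gM x) (ambientFrame κ R F x) (extChartAt (𝓡 (m + 1)) x x) v u := by
  have hy : extChartAt (𝓡 (m + 1)) x x ∈ goodSet r F x := self_mem_goodSet
  have hK := isKillingFrame κ hs hcan hnd hR ((extChartAt (𝓡 r) (F x)).map_source hy.2)
  have htg : ∀ ξ : E r, (∀ w, chartMetric gN (F x) (localMap F x (extChartAt (𝓡 (m + 1)) x x)) ξ
      (fderiv ℝ (localMap F x) (extChartAt (𝓡 (m + 1)) x x) w) = 0) → ∀ u v,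
      chartMetric gN (F x) (localMap F x (extChartAt (𝓡 (m + 1)) x x))
        (covSecondDeriv (chartMetric gN (F x)) (localMap F x) (extChartAt (𝓡 (m + 1)) x x) u v) ξ
        = 0 := by
    intro ξ hξ u v
    refine (secondFundamentalForm_eq gN hF.1 ξ u v).symm.trans (hFgeo x ξ (fun w => ?_) u v)
    have h2 := hξ w
    have h3 : (mfderiv (𝓡 (m + 1)) (𝓡 r) F x w : E r) =
      fderiv ℝ (localMap F x) (extChartAt (𝓡 (m + 1)) x x) w := (fderiv_localMap_self hF.1 w).symm
    rw [localMap_self, ← h3] at h2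
    exact (chartMetric_self gN (F x) _ _).symm.trans h2
  have h1 := fun u v => hK.isIsometricFrame.frameForm_of_totallyGeodesic (paramForm_symm κ)
    (hF.isLocalIsometry hy) (isMetricNear_chartMetric gM hy.1) htg u v
  rw [ambientFrame, h1, h1]
  exact hK.frameForm_skew hnd _ _

end Hypersurface

end TraceFormula
end

noncomputable section

namespace TraceFormula

/-! ### The pointwise trace identity on `Σ` -/

section Pointwise

variable {m r d : ℕ}
  {N : Type*} [TopologicalSpace N] [ChartedSpace (E r) N] [IsManifold (𝓡 r) ∞ N]
  {M : Type*} [TopologicalSpace M] [ChartedSpace (E (m + 1)) M] [IsManifold (𝓡 (m + 1)) ∞ M]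
  {S : Type*} [TopologicalSpace S] [ChartedSpace (E m) S] [IsManifold (𝓡 m) ∞ S]
  {gN : Metric r N} {gM : Metric (m + 1) M} {gS : Metric m S}
  {κ : E d ≃ₗ[ℝ] IsometryAlgebra gN} {R : (E d →L[ℝ] ℝ) →L[ℝ] E d}
  {F : M → N} {f : S → M} {ν : ∀ q : S, TangentSpace (𝓡 (m + 1)) (f q)} {s : N → N → N}

lemma chartMetric_self_eq (g : Metric m S) (p : S) :
    chartMetric g p (extChartAt (𝓡 m) p p) = g.inner p := by
  ext u v
  exact chartMetric_self g p u v

/-- The second fundamental form in the direction of the normal field, in coordinates. -/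
lemma secondFundamentalForm_normal (gM : Metric (m + 1) M) (hf : ContMDiff (𝓡 m) (𝓡 (m + 1)) ∞ f)
    (ν : ∀ q : S, TangentSpace (𝓡 (m + 1)) (f q)) (p : S) :
    secondFundamentalForm gM f p (ν p) = fun u v : E m =>
      chartMetric gM (f p) (localMap f p (extChartAt (𝓡 m) p p))
        (covSecondDeriv (chartMetric gM (f p)) (localMap f p) (extChartAt (𝓡 m) p p) u v)
        (localField f ν p (extChartAt (𝓡 m) p p)) := by
  funext u v
  rw [localField_self]
  exact secondFundamentalForm_eq gM hf (ν p) u v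

lemma energy_normal_eq (hs : ∀ p, IsSymmetryAt gN p (s p)) (hcan : IsCanonicalMetric gN s)
    (hnd : ∀ x, (∀ y, paramForm κ x y = 0) → x = 0) (hR : ∀ α c, paramForm κ (R α) c = α c)
    (hF : IsIsometricImmersion gM gN F) (hFgeo : IsTotallyGeodesic (m + 1) gN F)
    (hf : IsIsometricImmersion gS gM f) (hν : IsUnitNormalField m gM f ν) (p : S)
    {e : Module.Basis (Fin m) ℝ (E m)}
    (he : IsOrthonormalFor (chartMetric gS p (extChartAt (𝓡 m) p p)) e) :
    ∑ a, paramForm κ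
        (fderiv ℝ (fun z => ambientFrame κ R F (f p) (localMap f p z) (localField f ν p z))
          (extChartAt (𝓡 m) p p) (e a))
        (fderiv ℝ (fun z => ambientFrame κ R F (f p) (localMap f p z) (localField f ν p z))
          (extChartAt (𝓡 m) p p) (e a)) =
      ricciTensor gM (f p) (ν p) (ν p)
        + metricNormSq (gS.inner p) (secondFundamentalForm gM f p (ν p)) := by
  have hy : extChartAt (𝓡 m) p p ∈ goodSet₂ r F f p := self_mem_goodSet₂
  have hA := isIsometricFrame_ambient κ hs hcan hnd hR hF hy.2
  have h1 := hA.energy_normal (paramForm_symm κ) (hf.isLocalIsometry hy.1)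
    (isMetricNear_chartMetric gS hy.1.1) (hν.isLocalNormal hf.1 hy.1)
    (by
      rw [localMap_self]
      exact frameForm_ambientFrame_skew κ hs hcan hnd hR hF hFgeo (f p)) he
  rw [h1, secondFundamentalForm_normal gM hf.1, ← chartMetric_self_eq gS p,
    metricNormSq_eq he (isBilin_inner_covSecondDeriv hA.metric.isInner _), localField_self,
    localMap_self]
  rfl

/-- Serves continuity: `Ric` and `|A|²` are defined in a chart that changes with the point, whereas
the right-hand side involves only Laplacians of globally defined smooth functions. -/
lemma jacobiPotential_eq (hs : ∀ p, IsSymmetryAt gN p (s p)) (hcan : IsCanonicalMetric gN s)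
    (hnd : ∀ x, (∀ y, paramForm κ x y = 0) → x = 0) (hR : ∀ α c, paramForm κ (R α) c = α c)
    (hF : IsIsometricImmersion gM gN F) (hFgeo : IsTotallyGeodesic (m + 1) gN F)
    (hf : IsIsometricImmersion gS gM f) (hν : IsUnitNormalField m gM f ν) (p : S) :
    ricciTensor gM (f p) (ν p) (ν p)
        + metricNormSq (gS.inner p) (secondFundamentalForm gM f p (ν p)) =
      -∑ k, paramForm κ (fieldLift κ R F f ν p) (stdVec k) *
        laplaceBeltrami gS (fun q => fieldLift κ R F f ν q k) p := by
  have hy : extChartAt (𝓡 m) p p ∈ goodSet₂ r F f p := self_mem_goodSet₂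
  have hb := isInner_chartMetric gS (mem_extChartAt_target (I := 𝓡 m) p)
  obtain ⟨e, he⟩ := hb.exists_orthonormal
  have hA := isIsometricFrame_ambient κ hs hcan hnd hR hF hy.2
  have hN := hA.isNormalFrame (hf.isLocalIsometry hy.1) (hν.isLocalNormal hf.1 hy.1)
  have hev : ∀ᶠ z in 𝓝 (extChartAt (𝓡 m) p p), ambientFrame κ R F (f p) (localMap f p z)
      (localField f ν p z) = fieldLift κ R F f ν ((extChartAt (𝓡 m) p).symm z) := by
    filter_upwards [goodSet₂_mem_nhds hF.1.continuous hf.1 hy] with z hz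
    exact ambientFrame_localField κ R ν hF.1 hz
  rw [← energy_normal_eq hs hcan hnd hR hF hFgeo hf hν p he,
    hN.energy_eq (paramForm_symm κ) hb he, hev.self_of_nhds, extChartAt_to_inv p]
  congr 1
  refine Finset.sum_congr rfl fun k _ => ?_
  congr 1
  refine laplacian_congr ?_
  filter_upwards [hev] with z hz
  rw [hz]

/-- The pointwise form of the trace identity. -/
lemma sum_jacobiOperator_mul_eq_zero (hs : ∀ p, IsSymmetryAt gN p (s p))
    (hcan : IsCanonicalMetric gN s)
    (hnd : ∀ x, (∀ y, paramForm κ x y = 0) → x = 0) (hR : ∀ α c, paramForm κ (R α) c = α c)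
    (hF : IsIsometricImmersion gM gN F) (hFgeo : IsTotallyGeodesic (m + 1) gN F)
    (hf : IsIsometricImmersion gS gM f) (hfmin : IsMinimal gS gM f)
    (hν : IsUnitNormalField m gM f ν)
    {η : ∀ x : S, TangentSpace (𝓡 m) x →L[ℝ] ℝ} (hη : IsHarmonicOneForm gS η)
    {ι : Type*} [Fintype ι] [DecidableEq ι]
    {β : Module.Basis ι ℝ (⋀[ℝ]^2 (IsometryAlgebra gN))}
    (hβ : ∀ i j, wedgeForm (algebraForm gN) (β i) (β j) = if i = j then 1 else 0) (p : S) :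
    ∑ i, jacobiOperator gS gM f ν (testFunction gN F f ν (oneFormSharp gS η) (β i)) p
      * testFunction gN F f ν (oneFormSharp gS η) (β i) p = 0 := by
  have hy : extChartAt (𝓡 m) p p ∈ goodSet₂ r F f p := self_mem_goodSet₂
  have hb := isInner_chartMetric gS (mem_extChartAt_target (I := 𝓡 m) p)
  obtain ⟨e, he⟩ := hb.exists_orthonormal
  have hA := isIsometricFrame_ambient κ hs hcan hnd hR hF hy.2
  have hfl := hf.isLocalIsometry hy.1
  have hG := isMetricNear_chartMetric gS hy.1.1
  have hνl := hν.isLocalNormal hf.1 hy.1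
  have hN := hA.isNormalFrame hfl hνl
  have hS := isIsometricFrame_hypersurface κ hs hcan hnd hR hF hf hy
  have htgt := (isOpen_extChartAt_target (I := 𝓡 m) p).mem_nhds hy.1.1
  have hsk := frameForm_ambientFrame_skew κ hs hcan hnd hR hF hFgeo (f p)
  have hbil := isBilin_inner_covSecondDeriv (f := localMap f p) (z := extChartAt (𝓡 m) p p)
    hA.metric.isInner (localField f ν p (extChartAt (𝓡 m) p p))
  have htr := hfmin p (ν p) (hν.2 p).1
  rw [secondFundamentalForm_normal gM hf.1, ← chartMetric_self_eq gS p,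
    metricTrace_eq he hbil] at htr
  have key := local_trace_identity (paramForm_symm κ) hS hN
    (η := chartOneForm η p) (T := localSharp gS η p)
    (by filter_upwards [htgt] with z hz using contDiffAt_localSharp gS hη hz)
    (by filter_upwards [htgt] with z hz w using (inner_localSharp gS η hz w).symm)
    (by filter_upwards [htgt] with z hz using contDiffAt_chartOneForm hη.1 hz)
    (hη.2 p) he
    (fun u v => hA.frameForm_hypersurface (paramForm_symm κ) hfl hG hνl u v)
    (fun u v => by rw [covSecondDeriv_symm hA.metric hfl.smooth.self_of_nhds])
    (fun u v => by rw [localMap_self]; exact hsk _ _)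
    (fun u v => hA.perp.self_of_nhds _ _ _)
    htr (fun i => wedgeCoeff κ (β i)) (sum_wedgeCoeff κ hβ)
  rw [energy_normal_eq hs hcan hnd hR hF hFgeo hf hν p he] at key
  -- Agreement on a neighbourhood is needed, since the Laplacians are compared as well as the
  -- values.
  have hev : ∀ i, ∀ᶠ z in 𝓝 (extChartAt (𝓡 m) p p), wedgeCoeff κ (β i)
      (ambientFrame κ R F (f p) (localMap f p z) (localField f ν p z))
      (pullFrame (ambientFrame (m := m) κ R F (f p)) (localMap f p) z (localSharp gS η p z)) =
      testFunction gN F f ν (oneFormSharp gS η) (β i) ((extChartAt (𝓡 m) p).symm z) := by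
    intro i
    filter_upwards [goodSet₂_mem_nhds hF.1.continuous hf.1 hy] with z hz
    rw [testFunction_eq κ F f ν _ hR, ambientFrame_localField κ R ν hF.1 hz,
      pullFrame_ambientFrame κ R (oneFormSharp gS η) hF.1 hf.1 hz
        (chartFrame_localSharp gS η hz.1.1)]
  have hself : ∀ i, _ := fun i => (hev i).self_of_nhds
  simp only [hself, extChartAt_to_inv p, laplacian_congr (hev _)] at key
  refine Eq.trans (Finset.sum_congr rfl fun i _ => ?_) key
  rw [jacobiOperator, laplaceBeltrami]
  ring

end Pointwise

end TraceFormula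
end

noncomputable section

namespace TraceFormula

/-! ### Invariance of the Laplacian under local isometries -/

section LocalIsometry

variable {m n : ℕ} {G : E m → E m →L[ℝ] E m →L[ℝ] ℝ} {G' : E n → E n →L[ℝ] E n →L[ℝ] ℝ}
  {f : E m → E n} {y : E m}

lemma IsLocalIsometry.fderiv_metric (hf : IsLocalIsometry G G' f y) (hG : IsMetricNear G y)
    (hG' : IsMetricNear G' (f y)) (a u v : E m) :
    fderiv ℝ G y a u v = fderiv ℝ G' (f y) (fderiv ℝ f y a) (fderiv ℝ f y u) (fderiv ℝ f y v)
      + G' (f y) (fderiv ℝ (fderiv ℝ f) y a u) (fderiv ℝ f y v)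
      + G' (f y) (fderiv ℝ f y u) (fderiv ℝ (fderiv ℝ f) y a v) := by
  have hs := hf.smooth.self_of_nhds
  have hfd : DifferentiableAt ℝ f y := hs.differentiableAt (by simp)
  have hfdd := differentiableAt_fderiv hs
  have hGf : DifferentiableAt ℝ (fun z => G' (f z)) y := hG'.differentiableAt.comp y hfd
  have hu := fun u : E m => hfdd.clm_apply (differentiableAt_const u)
  have h1 : (fun z => G z u v) =ᶠ[𝓝 y]
      fun z => G' (f z) (fderiv ℝ f z u) (fderiv ℝ f z v) :=
    hf.isom.mono fun z hz => (hz u v).symm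
  have h2 : fderiv ℝ (fun z => G' (f z)) y = (fderiv ℝ G' (f y)).comp (fderiv ℝ f y) :=
    fderiv_comp y hG'.differentiableAt hfd
  rw [← fderiv_apply_const₂ hG.differentiableAt, h1.fderiv_eq,
    fderiv_clm (hGf.clm_apply (hu u)) (hu v), fderiv_clm hGf (hu u), fderiv_apply_const hfdd,
    fderiv_apply_const hfdd, h2]
  rfl

/-- The Gauss formula without a frame: both Christoffel symbols are expanded by Koszul's formula,
and symmetry of the second derivative of `f` does the rest. -/
lemma IsLocalIsometry.inner_covSecondDeriv (hf : IsLocalIsometry G G' f y) (hG : IsMetricNear G y)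
    (hG' : IsMetricNear G' (f y)) (u v w : E m) :
    G' (f y) (covSecondDeriv G' f y u v) (fderiv ℝ f y w) = G y (christoffel G y u v) w := by
  have hs := hf.smooth.self_of_nhds
  rw [covSecondDeriv, map_add, add_apply, inner_christoffel hG'.isInner,
    inner_christoffel hG.isInner, hf.fderiv_metric hG hG', hf.fderiv_metric hG hG',
    hf.fderiv_metric hG hG', fderiv_fderiv_comm hs w u, fderiv_fderiv_comm hs w v,
    fderiv_fderiv_comm hs v u, hG'.isInner.symm (fderiv ℝ f y v), hG'.isInner.symm (fderiv ℝ f y u)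
      (fderiv ℝ (fderiv ℝ f) y v w)]
  ring

/-- In equal dimensions the derivative of `f` is onto, so no normal component remains. -/
lemma IsLocalIsometry.covSecondDeriv_eq {f : E m → E m} {G' : E m → E m →L[ℝ] E m →L[ℝ] ℝ}
    (hf : IsLocalIsometry G G' f y) (hG : IsMetricNear G y)
    (hG' : IsMetricNear G' (f y)) (u v : E m) :
    covSecondDeriv G' f y u v = fderiv ℝ f y (christoffel G y u v) := by
  obtain ⟨e, he⟩ := hG.isInner.exists_orthonormal
  obtain ⟨e', -, he'⟩ := exists_basis_of_orthonormal (b := G' (f y)) (fun a => fderiv ℝ f y (e a))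
    fun i j => (hf.isom.self_of_nhds _ _).trans (he i j)
  refine hG'.isInner.ext fun w => ?_
  rw [← e'.sum_repr w]
  simp only [map_sum, map_smul, he', hf.inner_covSecondDeriv hG hG', hf.isom.self_of_nhds]

/-- The Laplacian is invariant under local isometries. -/
lemma IsLocalIsometry.laplacian_comp {f : E m → E m} {G' : E m → E m →L[ℝ] E m →L[ℝ] ℝ}
    (hf : IsLocalIsometry G G' f y) (hG : IsMetricNear G y)
    (hG' : IsMetricNear G' (f y)) {φ : E m → ℝ} (hφ : ContDiffAt ℝ ∞ φ (f y)) :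
    laplacian G (fun z => φ (f z)) y = laplacian G' φ (f y) := by
  obtain ⟨e, he⟩ := hG.isInner.exists_orthonormal
  obtain ⟨e', heo, he'⟩ := exists_basis_of_orthonormal (b := G' (f y))
    (fun a => fderiv ℝ f y (e a)) fun i j => (hf.isom.self_of_nhds _ _).trans (he i j)
  have hs := hf.smooth.self_of_nhds
  have hφd : ∀ᶠ z in 𝓝 y, DifferentiableAt ℝ φ (f z) := by
    refine hs.continuousAt.eventually ?_
    have h1 : ContDiffAt ℝ 1 φ (f y) := hφ.of_le (by exact_mod_cast le_top)
    exact (h1.eventually (by simp)).mono fun z hz => hz.differentiableAt (by simp)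
  -- With `Θ = dφ` the frame form is the Hessian of `φ`, so the formula for pulled-back frames gives
  -- the transformation of Hessians.
  have h1 : fderiv ℝ (fun z => φ (f z)) =ᶠ[𝓝 y] pullFrame (fderiv ℝ φ) f := by
    filter_upwards [hf.smooth, hφd] with z hz hz'
    exact fderiv_comp z hz' (hz.differentiableAt (by simp))
  rw [laplacian_eq_sum_hess hG.isInner he, laplacian_eq_sum_hess hG'.isInner heo]
  refine Finset.sum_congr rfl fun a _ => ?_
  rw [he', hess, h1.fderiv_eq, h1.self_of_nhds, fderiv_pullFrame (G' := G') hs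
    (hφ.fderiv_right (by simp)), pullFrame_apply, hf.covSecondDeriv_eq hG hG', add_sub_cancel_right]
  rfl

lemma contDiffAt_laplacian (hG : IsMetricNear G y) {φ : E m → ℝ} (hφ : ContDiffAt ℝ ∞ φ y) :
    ContDiffAt ℝ ∞ (laplacian G φ) y := by
  refine hG.contDiffAt_metricTrace (k := ⊤) fun u v => ?_
  have h1 : ContDiffAt ℝ ∞ (fderiv ℝ φ) y := hφ.fderiv_right (by simp)
  have h2 : ContDiffAt ℝ ∞ (fderiv ℝ (fderiv ℝ φ)) y := h1.fderiv_right (by simp)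
  exact ((h2.clm_apply contDiffAt_const).clm_apply contDiffAt_const).sub
    (h1.clm_apply (hG.contDiffAt_christoffel u v))

end LocalIsometry

/-! ### Changes of chart and continuity of the Laplace-Beltrami operator -/

section Transition

variable {m : ℕ} {S : Type*} [TopologicalSpace S] [ChartedSpace (E m) S] [IsManifold (𝓡 m) ∞ S]
  {p q : S} {y : E m}

/-- The transition map from the preferred chart at `q` to the preferred chart at `p`. -/
def transition (q p : S) (y : E m) : E m :=
  extChartAt (𝓡 m) p ((extChartAt (𝓡 m) q).symm y)

/-- The domain of the transition map. -/
def transitionSource (q p : S) : Set (E m) :=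
  (extChartAt (𝓡 m) q).target ∩ (extChartAt (𝓡 m) q).symm ⁻¹' (extChartAt (𝓡 m) p).source

lemma isOpen_transitionSource (q p : S) : IsOpen (transitionSource (m := m) q p) :=
  ContinuousOn.isOpen_inter_preimage (continuousOn_extChartAt_symm q)
    (isOpen_extChartAt_target q) (isOpen_extChartAt_source p)

lemma contDiffAt_transition (hy : y ∈ transitionSource q p) :
    ContDiffAt ℝ ∞ (transition q p) y :=
  (ContMDiffAt.comp y (contMDiffAt_extChartAt' (by simpa using hy.2))
    (contMDiffAt_chart_symm hy.1)).contDiffAt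

lemma fderiv_transition (hy : y ∈ transitionSource q p) (v : E m) :
    fderiv ℝ (transition q p) y v =
      coordVec p ((extChartAt (𝓡 m) q).symm y) (chartFrame q y v) := by
  have h1 : MDifferentiableAt (𝓡 m) 𝓘(ℝ, E m) (extChartAt (𝓡 m) p)
      ((extChartAt (𝓡 m) q).symm y) :=
    ContMDiffAt.mdifferentiableAt (n := ∞) (contMDiffAt_extChartAt' (by simpa using hy.2)) (by simp)
  have h3 : MDifferentiableAt 𝓘(ℝ, E m) (𝓡 m) (extChartAt (𝓡 m) q).symm y :=
    (contMDiffAt_chart_symm hy.1).mdifferentiableAt (by simp)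
  rw [← mfderiv_eq_fderiv]
  have h4 : transition q p = (extChartAt (𝓡 m) p) ∘ (extChartAt (𝓡 m) q).symm := rfl
  rw [h4, mfderiv_comp (I' := 𝓡 m) y h1 h3]
  rfl

lemma chartMetric_transition (g : Metric m S) (hy : y ∈ transitionSource q p) (u v : E m) :
    chartMetric g p (transition q p y) (fderiv ℝ (transition q p) y u)
      (fderiv ℝ (transition q p) y v) = chartMetric g q y u v := by
  rw [fderiv_transition hy, fderiv_transition hy, transition, chartMetric_coordVec g hy.2]
  rfl

lemma isLocalIsometry_transition (g : Metric m S) (hy : y ∈ transitionSource q p) :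
    IsLocalIsometry (chartMetric g q) (chartMetric g p) (transition q p) y where
  smooth := by
    filter_upwards [(isOpen_transitionSource q p).mem_nhds hy] with z hz
    exact contDiffAt_transition hz
  isom := by
    filter_upwards [(isOpen_transitionSource q p).mem_nhds hy] with z hz u v
    exact chartMetric_transition g hz u v

lemma contDiffAt_comp_chart_symm {u : S → ℝ} (hu : ContMDiff (𝓡 m) 𝓘(ℝ, ℝ) ∞ u)
    (hy : y ∈ (extChartAt (𝓡 m) p).target) :
    ContDiffAt ℝ ∞ (fun z => u ((extChartAt (𝓡 m) p).symm z)) y :=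
  ((hu _).comp y (contMDiffAt_chart_symm hy)).contDiffAt

/-- The Laplace-Beltrami operator can be computed in any of the preferred charts. -/
lemma laplaceBeltrami_eq (g : Metric m S) {u : S → ℝ} (hu : ContMDiff (𝓡 m) 𝓘(ℝ, ℝ) ∞ u)
    (hq : q ∈ (extChartAt (𝓡 m) p).source) :
    laplaceBeltrami g u q = laplacian (chartMetric g p)
      (fun z => u ((extChartAt (𝓡 m) p).symm z)) (extChartAt (𝓡 m) p q) := by
  have hy : extChartAt (𝓡 m) q q ∈ transitionSource q p :=
    ⟨mem_extChartAt_target q, by simpa using hq⟩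
  have h1 : transition q p (extChartAt (𝓡 m) q q) = extChartAt (𝓡 m) p q := by
    rw [transition, extChartAt_to_inv q]
  have hp := (extChartAt (𝓡 m) p).map_source hq
  rw [← h1] at hp ⊢
  rw [← (isLocalIsometry_transition g hy).laplacian_comp (isMetricNear_chartMetric g hy.1)
    (isMetricNear_chartMetric g hp) (contDiffAt_comp_chart_symm hu hp)]
  refine laplacian_congr ?_
  filter_upwards [(isOpen_transitionSource q p).mem_nhds hy] with z hz
  rw [transition, (extChartAt (𝓡 m) p).left_inv hz.2]

/-- The definition uses a new chart at each point; near `p` it can be computed in the single chart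
at `p`, where it is smooth. -/
lemma continuous_laplaceBeltrami (g : Metric m S) {u : S → ℝ}
    (hu : ContMDiff (𝓡 m) 𝓘(ℝ, ℝ) ∞ u) : Continuous (laplaceBeltrami g u) := by
  rw [continuous_iff_continuousAt]
  intro p
  have h1 := (contDiffAt_laplacian (isMetricNear_chartMetric g (mem_extChartAt_target p))
    (contDiffAt_comp_chart_symm hu (mem_extChartAt_target p))).continuousAt
  refine (ContinuousAt.comp (x := p) h1 (continuousAt_extChartAt p)).congr ?_
  filter_upwards [(isOpen_extChartAt_source (I := 𝓡 m) p).mem_nhds (mem_extChartAt_source p)]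
    with q hq
  exact (laplaceBeltrami_eq g hu hq).symm

end Transition

end TraceFormula
end

noncomputable section

namespace TraceFormula

/-! ### Transformation and continuity of the density -/

section Density

variable {m : ℕ}

lemma det_gram_comp {b b' : E m →L[ℝ] E m →L[ℝ] ℝ} {D : E m →L[ℝ] E m}
    (h : ∀ u v, b (D u) (D v) = b' u v) : (gram b').det = D.det ^ 2 * (gram b).det := by
  let J : Matrix (Fin m) (Fin m) ℝ := Matrix.of fun i j => (D (stdVec j)) i
  have h1 : J.det = D.det := by
    have h2 : J = LinearMap.toMatrix (EuclideanSpace.basisFun (Fin m) ℝ).toBasis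
        (EuclideanSpace.basisFun (Fin m) ℝ).toBasis D.toLinearMap := by
      ext i j
      simp [J, LinearMap.toMatrix_apply, stdVec]
    rw [h2, LinearMap.det_toMatrix]
  have h3 : gram b' = J.transpose * gram b * J := by
    ext i j
    rw [gram, Matrix.of_apply, ← h, stdVec_repr (D (stdVec i)), stdVec_repr (D (stdVec j))]
    simp only [map_sum, map_smul, sum_apply, smul_apply, smul_eq_mul, Matrix.mul_apply, gram, J,
      Matrix.of_apply, Matrix.transpose_apply, Finset.sum_mul]
    exact Finset.sum_congr rfl fun k _ => by rw [Finset.mul_sum]; exact Finset.sum_congr rfl fun l _ => by ring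
  rw [h3, Matrix.det_mul, Matrix.det_mul, Matrix.det_transpose, h1]
  ring

lemma continuous_det_gram : Continuous fun b : E m →L[ℝ] E m →L[ℝ] ℝ => (gram b).det := by
  refine Continuous.matrix_det ?_
  refine continuous_pi fun i => continuous_pi fun j => ?_
  exact ((ContinuousLinearMap.apply ℝ ℝ (stdVec j : E m)).comp
    (ContinuousLinearMap.apply ℝ (E m →L[ℝ] ℝ) (stdVec i : E m))).continuous

lemma measurableSet_inter_preimage {X Y : Type*} [TopologicalSpace X] [MeasurableSpace X]
    [BorelSpace X] [TopologicalSpace Y] [MeasurableSpace Y] [BorelSpace Y] {h : X → Y} {t : Set X}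
    (ht : MeasurableSet t) (hh : ContinuousOn h t) {A : Set Y} (hA : MeasurableSet A) :
    MeasurableSet (t ∩ h ⁻¹' A) := by
  have h1 : Measurable (t.domRestrict h) :=
    (continuousOn_iff_continuous_domRestrict.1 hh).measurable
  have h2 := ht.subtype_image (h1 hA)
  have h3 : (Subtype.val '' (t.domRestrict h ⁻¹' A) : Set X) = t ∩ h ⁻¹' A :=
    Subtype.image_preimage_coe t (h ⁻¹' A)
  rwa [h3] at h2

end Density

/-! ### Finiteness of the Riemannian measure -/

section Measure

variable {m : ℕ} {S : Type*} [TopologicalSpace S] [ChartedSpace (E m) S] [IsManifold (𝓡 m) ∞ S]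
  [MeasurableSpace S] [BorelSpace S] (g : Metric m S)

/-- The Riemannian density in the preferred chart at `p`. -/
def chartDensity (p : S) (y : E m) : ℝ≥0∞ :=
  ENNReal.ofReal (Real.sqrt (gram (chartMetric g p y)).det)

/-- The Riemannian measure of the domain of the preferred chart at `p`. -/
def chartMeasure (p : S) : Measure S :=
  ((volume.restrict (extChartAt (𝓡 m) p).target).withDensity (chartDensity g p)).map
    (extChartAt (𝓡 m) p).symm

lemma riemannianMeasure_eq : riemannianMeasure g = ⨆ p : S, chartMeasure g p := rfl

lemma chartMeasure_apply (p : S) {A : Set S} (hA : MeasurableSet A) :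
    chartMeasure g p A =
      ∫⁻ y in (extChartAt (𝓡 m) p).target ∩ (extChartAt (𝓡 m) p).symm ⁻¹' A, chartDensity g p y := by
  have ht := (isOpen_extChartAt_target (I := 𝓡 m) p).measurableSet
  have h1 : AEMeasurable (extChartAt (𝓡 m) p).symm
      ((volume.restrict (extChartAt (𝓡 m) p).target).withDensity (chartDensity g p)) :=
    ((continuousOn_extChartAt_symm p).aemeasurable ht).mono_ac
      (withDensity_absolutelyContinuous _ _)
  rw [chartMeasure, Measure.map_apply_of_aemeasurable h1 hA, withDensity_apply',
    Measure.restrict_restrict' ht, Set.inter_comm]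

/-- On the domain of the chart at `p` the measure of any other chart is at most that of `p`. -/
lemma chartMeasure_le (p q : S) {A : Set S} (hA : MeasurableSet A)
    (hAp : A ⊆ (extChartAt (𝓡 m) p).source) : chartMeasure g q A ≤ chartMeasure g p A := by
  rw [chartMeasure_apply g q hA, chartMeasure_apply g p hA]
  set D := (extChartAt (𝓡 m) q).target ∩ (extChartAt (𝓡 m) q).symm ⁻¹' A with hD
  have hDm : MeasurableSet D := measurableSet_inter_preimage
    (isOpen_extChartAt_target q).measurableSet (continuousOn_extChartAt_symm q) hA
  have hDs : D ⊆ transitionSource q p := fun y hy => ⟨hy.1, hAp hy.2⟩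
  have hinj : Set.InjOn (transition q p) D := by
    intro y hy z hz h
    exact (extChartAt (𝓡 m) q).symm.injOn hy.1 hz.1
      ((extChartAt (𝓡 m) p).injOn (hAp hy.2) (hAp hz.2) h)
  have h1 := lintegral_image_eq_lintegral_abs_det_fderiv_mul volume hDm
    (fun y hy => ((contDiffAt_transition (hDs hy)).differentiableAt
      (by simp)).hasFDerivAt.hasFDerivWithinAt) hinj (chartDensity g p)
  -- The Gram determinant picks up the square of the Jacobian, hence the density its absolute value,
  -- as change of variables requires.
  have h2 : ∫⁻ y in D, chartDensity g q y = ∫⁻ y in D,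
      ENNReal.ofReal |(fderiv ℝ (transition q p) y).det| * chartDensity g p (transition q p y) := by
    refine setLIntegral_congr_fun hDm fun y hy => ?_
    simp only [chartDensity]
    rw [det_gram_comp (chartMetric_transition g (hDs hy)), Real.sqrt_mul (sq_nonneg _),
      Real.sqrt_sq_eq_abs, ENNReal.ofReal_mul (abs_nonneg _)]
  rw [h2, ← h1]
  refine lintegral_mono_set ?_
  rintro _ ⟨y, hy, rfl⟩
  refine ⟨(extChartAt (𝓡 m) p).map_source (hAp hy.2), ?_⟩
  rw [Set.mem_preimage, transition, (extChartAt (𝓡 m) p).left_inv (hAp hy.2)]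
  exact hy.2

/-- By continuity the density is bounded on a small ball about the centre, and the ball has finite
Lebesgue measure. -/
lemma exists_nhds_chartMeasure_lt_top (p : S) : ∃ U ∈ 𝓝 p, MeasurableSet U ∧
    U ⊆ (extChartAt (𝓡 m) p).source ∧ chartMeasure g p U < ⊤ := by
  have hy := mem_extChartAt_target (I := 𝓡 m) p
  have h1 : ContinuousAt (chartDensity g p) (extChartAt (𝓡 m) p p) :=
    ENNReal.continuous_ofReal.continuousAt.comp (Real.continuous_sqrt.continuousAt.comp
      (continuous_det_gram.continuousAt.comp (contDiffAt_chartMetric g hy).continuousAt))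
  obtain ⟨C, hC, hCt⟩ := ENNReal.lt_iff_exists_nnreal_btwn.1
    (show chartDensity g p (extChartAt (𝓡 m) p p) < ⊤ from ENNReal.ofReal_lt_top)
  obtain ⟨ε, hε, hball⟩ := Metric.eventually_nhds_iff_ball.1 (h1.eventually_lt_const hC)
  have hopen : IsOpen ((extChartAt (𝓡 m) p).source ∩
      extChartAt (𝓡 m) p ⁻¹' Metric.ball (extChartAt (𝓡 m) p p) ε) :=
    (continuousOn_extChartAt p).isOpen_inter_preimage (isOpen_extChartAt_source p) Metric.isOpen_ball
  refine ⟨_, hopen.mem_nhds ⟨mem_extChartAt_source p, Metric.mem_ball_self hε⟩,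
    hopen.measurableSet, Set.inter_subset_left, ?_⟩
  rw [chartMeasure_apply g p hopen.measurableSet]
  calc _ ≤ ∫⁻ y in Metric.ball (extChartAt (𝓡 m) p p) ε, chartDensity g p y := by
        refine lintegral_mono_set fun y hy => ?_
        have := hy.2.2
        rwa [Set.mem_preimage, (extChartAt (𝓡 m) p).right_inv hy.1] at this
    _ ≤ ∫⁻ y in Metric.ball (extChartAt (𝓡 m) p p) ε, C :=
        setLIntegral_mono measurable_const fun y hy => (hball y hy).le
    _ < ⊤ := by
        rw [setLIntegral_const]
        exact ENNReal.mul_lt_top hCt measure_ball_lt_top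

/-- The Riemannian measure of a compact manifold is finite. -/
lemma isFiniteMeasure_riemannianMeasure [CompactSpace S] :
    IsFiniteMeasure (riemannianMeasure g) := by
  choose U hU hUm hUs hUt using exists_nhds_chartMeasure_lt_top g
  obtain ⟨t, ht⟩ := CompactSpace.elim_nhds_subcover U hU
  -- One finite sum dominates every chart measure, and therefore their supremum.
  have h1 : riemannianMeasure g ≤ ∑ p ∈ t, (chartMeasure g p).restrict (U p) := by
    rw [riemannianMeasure_eq]
    refine iSup_le fun q => Measure.le_iff.2 fun A hA => ?_
    have h2 : A ⊆ ⋃ p ∈ t, A ∩ U p := by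
      intro x hx
      have : x ∈ ⋃ p ∈ t, U p := by rw [ht]; trivial
      simp only [Set.mem_iUnion] at this ⊢
      obtain ⟨p, hp, hxp⟩ := this
      exact ⟨p, hp, hx, hxp⟩
    calc chartMeasure g q A ≤ chartMeasure g q (⋃ p ∈ t, A ∩ U p) := measure_mono h2
      _ ≤ ∑ p ∈ t, chartMeasure g q (A ∩ U p) := measure_biUnion_finset_le t _
      _ ≤ ∑ p ∈ t, chartMeasure g p (A ∩ U p) := Finset.sum_le_sum fun p _ =>
          chartMeasure_le g p q (hA.inter (hUm p)) (Set.inter_subset_right.trans (hUs p))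
      _ = (∑ p ∈ t, (chartMeasure g p).restrict (U p)) A := by
          rw [Measure.coe_finsetSum, Finset.sum_apply]
          exact Finset.sum_congr rfl fun p _ => (Measure.restrict_apply hA).symm
  refine ⟨(h1 Set.univ).trans_lt ?_⟩
  rw [Measure.coe_finsetSum, Finset.sum_apply]
  refine ENNReal.sum_lt_top.2 fun p _ => ?_
  rw [Measure.restrict_apply_univ]
  exact hUt p

end Measure

end TraceFormula
end

noncomputable section

namespace TraceFormula

/-! ### Smoothness of the test functions and continuity of the integrand -/

section Regularity

variable {m r d : ℕ}
  {N : Type*} [TopologicalSpace N] [ChartedSpace (E r) N] [IsManifold (𝓡 r) ∞ N]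
  {M : Type*} [TopologicalSpace M] [ChartedSpace (E (m + 1)) M] [IsManifold (𝓡 (m + 1)) ∞ M]
  {S : Type*} [TopologicalSpace S] [ChartedSpace (E m) S] [IsManifold (𝓡 m) ∞ S]
  {gN : Metric r N} {gM : Metric (m + 1) M} {gS : Metric m S}
  {κ : E d ≃ₗ[ℝ] IsometryAlgebra gN} {R : (E d →L[ℝ] ℝ) →L[ℝ] E d}
  {F : M → N} {f : S → M} {ν : ∀ q : S, TangentSpace (𝓡 (m + 1)) (f q)} {s : N → N → N}

lemma contMDiffAt_of_chart {V : Type*} [NormedAddCommGroup V] [NormedSpace ℝ V] {u : S → V}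
    {h : E m → V} {p : S} (hh : ContDiffAt ℝ ∞ h (extChartAt (𝓡 m) p p))
    (hu : ∀ᶠ z in 𝓝 (extChartAt (𝓡 m) p p), h z = u ((extChartAt (𝓡 m) p).symm z)) :
    ContMDiffAt (𝓡 m) 𝓘(ℝ, V) ∞ u p := by
  have h1 := ContMDiffAt.comp p hh.contMDiffAt (contMDiffAt_extChartAt (I := 𝓡 m) (n := ∞))
  refine h1.congr_of_eventuallyEq ?_
  filter_upwards [(continuousAt_extChartAt p).eventually hu,
    (isOpen_extChartAt_source (I := 𝓡 m) p).mem_nhds (mem_extChartAt_source p)] with q hq hqs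
  rw [Function.comp_apply, hq, (extChartAt (𝓡 m) p).left_inv hqs]

lemma contMDiff_fieldLift_normal (hs : ∀ p, IsSymmetryAt gN p (s p)) (hcan : IsCanonicalMetric gN s)
    (hnd : ∀ x, (∀ y, paramForm κ x y = 0) → x = 0) (hR : ∀ α c, paramForm κ (R α) c = α c)
    (hF : IsIsometricImmersion gM gN F)
    (hf : IsIsometricImmersion gS gM f) (hν : IsUnitNormalField m gM f ν) :
    ContMDiff (𝓡 m) 𝓘(ℝ, E d) ∞ (fieldLift κ R F f ν) := by
  intro p
  have hy : extChartAt (𝓡 m) p p ∈ goodSet₂ r F f p := self_mem_goodSet₂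
  have hN := (isIsometricFrame_ambient κ hs hcan hnd hR hF hy.2).isNormalFrame
    (hf.isLocalIsometry hy.1) (hν.isLocalNormal hf.1 hy.1)
  refine contMDiffAt_of_chart hN.smooth.self_of_nhds ?_
  filter_upwards [goodSet₂_mem_nhds hF.1.continuous hf.1 hy] with z hz
  exact ambientFrame_localField κ R ν hF.1 hz

lemma contMDiff_fieldLift_sharp (hs : ∀ p, IsSymmetryAt gN p (s p)) (hcan : IsCanonicalMetric gN s)
    (hnd : ∀ x, (∀ y, paramForm κ x y = 0) → x = 0) (hR : ∀ α c, paramForm κ (R α) c = α c)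
    (hF : IsIsometricImmersion gM gN F) (hf : IsIsometricImmersion gS gM f)
    {η : ∀ x : S, TangentSpace (𝓡 m) x →L[ℝ] ℝ} (hη : IsHarmonicOneForm gS η) :
    ContMDiff (𝓡 m) 𝓘(ℝ, E d) ∞ (fieldLift κ R F f
      fun q => mfderiv (𝓡 m) (𝓡 (m + 1)) f q (oneFormSharp gS η q)) := by
  intro p
  have hy : extChartAt (𝓡 m) p p ∈ goodSet₂ r F f p := self_mem_goodSet₂
  have hS := isIsometricFrame_hypersurface κ hs hcan hnd hR hF hf hy
  refine contMDiffAt_of_chart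
    (hS.smooth.self_of_nhds.clm_apply (contDiffAt_localSharp gS hη hy.1.1)) ?_
  filter_upwards [goodSet₂_mem_nhds hF.1.continuous hf.1 hy] with z hz
  exact pullFrame_ambientFrame κ R (oneFormSharp gS η) hF.1 hf.1 hz
    (chartFrame_localSharp gS η hz.1.1)

lemma contMDiff_testFunction (hs : ∀ p, IsSymmetryAt gN p (s p)) (hcan : IsCanonicalMetric gN s)
    (hnd : ∀ x, (∀ y, paramForm κ x y = 0) → x = 0) (hR : ∀ α c, paramForm κ (R α) c = α c)
    (hF : IsIsometricImmersion gM gN F) (hf : IsIsometricImmersion gS gM f)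
    (hν : IsUnitNormalField m gM f ν)
    {η : ∀ x : S, TangentSpace (𝓡 m) x →L[ℝ] ℝ} (hη : IsHarmonicOneForm gS η)
    (v : ⋀[ℝ]^2 (IsometryAlgebra gN)) :
    ContMDiff (𝓡 m) 𝓘(ℝ, ℝ) ∞ (testFunction gN F f ν (oneFormSharp gS η) v) := by
  have h1 : testFunction gN F f ν (oneFormSharp gS η) v = _ :=
    funext fun q => testFunction_eq κ F f ν (oneFormSharp gS η) hR v q
  rw [h1]
  exact ((wedgeCoeff κ v).contMDiff.comp
    (contMDiff_fieldLift_normal hs hcan hnd hR hF hf hν)).clm_apply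
    (contMDiff_fieldLift_sharp hs hcan hnd hR hF hf hη)

lemma continuous_jacobiOperator (hs : ∀ p, IsSymmetryAt gN p (s p)) (hcan : IsCanonicalMetric gN s)
    (hnd : ∀ x, (∀ y, paramForm κ x y = 0) → x = 0) (hR : ∀ α c, paramForm κ (R α) c = α c)
    (hF : IsIsometricImmersion gM gN F) (hFgeo : IsTotallyGeodesic (m + 1) gN F)
    (hf : IsIsometricImmersion gS gM f) (hν : IsUnitNormalField m gM f ν)
    {φ : S → ℝ} (hφ : ContMDiff (𝓡 m) 𝓘(ℝ, ℝ) ∞ φ) :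
    Continuous (jacobiOperator gS gM f ν φ) := by
  have hl := contMDiff_fieldLift_normal hs hcan hnd hR hF hf hν
  have h1 : jacobiOperator gS gM f ν φ = fun p => laplaceBeltrami gS φ p +
      (-∑ k, paramForm κ (fieldLift κ R F f ν p) (stdVec k) *
        laplaceBeltrami gS (fun q => fieldLift κ R F f ν q k) p) * φ p := by
    funext p
    rw [← jacobiPotential_eq hs hcan hnd hR hF hFgeo hf hν, jacobiOperator]
    ring
  have h2 : ∀ k, Continuous (laplaceBeltrami gS fun q => fieldLift κ R F f ν q k) := fun k =>
    continuous_laplaceBeltrami gS ((EuclideanSpace.proj k : E d →L[ℝ] ℝ).contMDiff.comp hl)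
  rw [h1]
  refine (continuous_laplaceBeltrami gS hφ).add (Continuous.mul (Continuous.neg ?_) hφ.continuous)
  exact continuous_finsetSum _ fun k _ => Continuous.mul
    (((paramForm κ).continuous.comp hl.continuous).clm_apply continuous_const) (h2 k)

end Regularity

/-! ### Finite dimension of the isometry algebra -/

section Main

variable {r : ℕ} {N : Type*} [TopologicalSpace N] [ChartedSpace (E r) N] [IsManifold (𝓡 r) ∞ N]

/-- `LinearMap.trace` is zero by convention when there is no finite basis, and the Killing form
would then vanish. -/
lemma finite_of_algebraForm_ne_zero {g : Metric r N} (h : algebraForm g ≠ 0) :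
    Module.Finite ℝ (IsometryAlgebra g) := by
  by_contra hfin
  refine h ?_
  ext X Y
  have h1 : LinearMap.trace ℝ (IsometryAlgebra g) = 0 := by
    rw [LinearMap.trace, dif_neg]
    rintro ⟨t, ⟨b⟩⟩
    exact hfin (Module.Finite.of_basis b)
  rw [algebraForm, LinearMap.neg_apply, LinearMap.neg_apply, killingForm_apply_apply, h1]
  simp

end Main

end TraceFormula

end
theorem mainTheorem6 {m r : ℕ}
    {N : Type*} [TopologicalSpace N] [ChartedSpace (TraceFormula.E r) N] [IsManifold (𝓡 r) ∞ N]
    [T2Space N] [CompactSpace N] [ConnectedSpace N]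
    {M : Type*} [TopologicalSpace M] [ChartedSpace (TraceFormula.E (m + 1)) M]
    [IsManifold (𝓡 (m + 1)) ∞ M] [T2Space M] [SecondCountableTopology M]
    {S : Type*} [TopologicalSpace S] [ChartedSpace (TraceFormula.E m) S] [IsManifold (𝓡 m) ∞ S]
    [T2Space S] [CompactSpace S] [MeasurableSpace S] [BorelSpace S]
    (gN : TraceFormula.Metric r N) (gM : TraceFormula.Metric (m + 1) M)
    (gS : TraceFormula.Metric m S)
    (s : N → N → N) (hs : ∀ p, TraceFormula.IsSymmetryAt gN p (s p))
    (hss : LieAlgebra.IsSemisimple ℝ (TraceFormula.IsometryAlgebra gN))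
    (hcan : TraceFormula.IsCanonicalMetric gN s)
    (F : M → N) (hF : TraceFormula.IsIsometricImmersion gM gN F)
    (hFgeo : TraceFormula.IsTotallyGeodesic (m + 1) gN F)
    (f : S → M) (hf : TraceFormula.IsIsometricImmersion gS gM f)
    (hfmin : TraceFormula.IsMinimal gS gM f)
    (ν : ∀ q : S, TangentSpace (𝓡 (m + 1)) (f q))
    (hν : TraceFormula.IsUnitNormalField m gM f ν)
    (η : ∀ x : S, TangentSpace (𝓡 m) x →L[ℝ] ℝ) (hη : TraceFormula.IsHarmonicOneForm gS η)
    {ι : Type*} [Fintype ι] [DecidableEq ι]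
    (b : Module.Basis ι ℝ (⋀[ℝ]^2 (TraceFormula.IsometryAlgebra gN)))
    (hb : ∀ i j, TraceFormula.wedgeForm (TraceFormula.algebraForm gN) (b i) (b j) =
      if i = j then 1 else 0) :
    ∑ i, TraceFormula.testQuadraticForm gS gM gN F f ν (TraceFormula.oneFormSharp gS η)
      (b i) (b i) = 0 := by
  open TraceFormula in
  -- With an empty basis the sum is empty. Otherwise an orthonormal bivector exists, which makes the
  -- form on `𝔤` nonzero, hence `𝔤` finite-dimensional, and then nondegenerate.
  rcases isEmpty_or_nonempty ι with hι | hι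
  · simp
  have := finite_of_algebraForm_ne_zero (form_ne_zero b hb)
  let κ : E (Module.finrank ℝ (IsometryAlgebra gN)) ≃ₗ[ℝ] IsometryAlgebra gN :=
    LinearEquiv.ofFinrankEq _ _ (by simp)
  have hnd : ∀ x, (∀ y, paramForm κ x y = 0) → x = 0 := fun x hx => by
    refine κ.map_eq_zero_iff.1 (form_nondegenerate b hb fun y => ?_)
    obtain ⟨c, rfl⟩ := κ.surjective y
    exact hx c
  obtain ⟨R, hR⟩ := exists_raise hnd
  have := isFiniteMeasure_riemannianMeasure gS
  -- Each term must be integrable separately before the sum can be moved under the integral, where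
  -- it vanishes pointwise.
  have hint : ∀ i, Integrable (fun p =>
      jacobiOperator gS gM f ν (testFunction gN F f ν (oneFormSharp gS η) (b i)) p
        * testFunction gN F f ν (oneFormSharp gS η) (b i) p) (riemannianMeasure gS) := by
    intro i
    have hφ := contMDiff_testFunction hs hcan hnd hR hF hf hν hη (b i)
    exact ((continuous_jacobiOperator hs hcan hnd hR hF hFgeo hf hν hφ).mul
      hφ.continuous).integrable_of_hasCompactSupport (HasCompactSupport.of_compactSpace _)
  simp only [testQuadraticForm, indexForm]
  rw [Finset.sum_neg_distrib, ← integral_finsetSum _ fun i _ => hint i, neg_eq_zero]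
  simp only [sum_jacobiOperator_mul_eq_zero hs hcan hnd hR hF hFgeo hf hfmin hν hη hb,
    integral_zero]
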